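/- Let $V(x)=\sum_{m} g_m x^m$ be a real polynomial of degree $d$ such that $x\mapsto V(x^2)$ is uniformly convex (second derivative bounded below by a positive constant), let $\beta\ge 1$ and let $a$ be real with $1+a\ge 1/\beta$ (so $a>-1$). For $n\ge 1$ let $B=B(x,y)$ be the $n\times n$ lower bidiagonal matrix with $B_{i,i}=x_i$ $(1\le i\le n)$ and $B_{i+1,i}=-y_i$ $(1\le i\le n-1)$, and $$H(x,y)=\mathrm{tr}\,V(BB^T)-\sum_{k=1}^n\Bigl(\frac kn+\frac an-\frac1{n\beta}\Bigr)\log x_k-\sum_{k=1}^{n-1}\Bigl(\frac kn-\frac1{n\beta}\Bigr)\log y_k$$ on $[0,\infty)^{2n-1}$, with the conventions $0\cdot\log 0=0$ and $-w\log 0=+\infty$ for $w>0$ (all coordinates of a point where $H$ is finite are positive, except that $y_1$ may vanish if $\beta=1$ and $x_1$ may vanish if $1+a=1/\beta$). For $t\in[0,1]$ let $\phi(t)\ge 0$ be the unique nonnegative solution of $t=\sum_{m=1}^d m\binom{2m}{m}g_m\phi(t)^{2m}$ (it extends smoothly, by the same equation, to all $t>0$, which defines $\phi'(1)$). Let $\theta(t)=\kappa\bigl(\int_0^t\frac{du}{\phi(u)}\bigr)^2$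 with $\kappa$ such that $\theta(1)=1$. For $t\in(0,1]$ define $x^1(t),y^1(t)$ by $$x^1(t)-y^1(t)=\Bigl(a+\tfrac12\Bigr)\Bigl(\int_0^t\frac{du}{\phi(u)}\Bigr)^{-1}-\frac{\phi'(t)}2,\qquad x^1(t)+y^1(t)=\Bigl(a-\frac2\beta\Bigr)\phi'(t),$$ and the fine minimizer by $\mathbf x_i=\phi(i/n)+\frac1n x^1(i/n)$, $\mathbf y_i=\phi(i/n)+\frac1n y^1(i/n)$. Then there are positive constants $c,c',C$ depending only on $V,\beta,a$ such that for every $n\ge1$ the function $H$ has a unique minimizer $(x^o,y^o)$, and the following hold. (1) For every $i\in\{1,\dots,n\}$, $$|(\mathbf x_i,\mathbf y_i)-(x_i^o,y_i^o)|\le c'\cdot\begin{cases}\frac1{\sqrt n}& i\le c\log n,\\ \frac1{\sqrt{ni^3}}& c\log n<i\le n-c\log n,\\ e^{-(n-i)/c'}& n-c\log n<i\le n,\end{cases}$$ where for $i=n$ only the $x$-coordinate is compared (there is no variable $y_n$); if $i$ is in both the first and the third range, both bounds hold. (2) For all $0<s<t\le1$, provided that either $\beta>1$ and $1+a>1/\beta$,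 or $ns\ge2$, $$\left|\sum_{k}\log\frac{x_k^o}{y_k^o}-\left(\Bigl(\frac a2+\frac14\Bigr)\log\frac{\theta(t)}{\theta(s)}-\frac12\log\frac{\phi(t)}{\phi(s)}\right)\right|\le C\left(\frac1{ns}+\sum_{k=\max(1,\lfloor ns\rfloor)}^{\lfloor c\log n\rfloor}\frac1{\sqrt k}+\sum_{k=\lfloor n(1-t)\rfloor}^{\lfloor c\log n\rfloor}e^{-k/c}\right),$$ where the sum on the left is over the integers $k$ with $\lfloor ns\rfloor\le k\le\lfloor nt\rfloor$ and $1\le k\le n-1$. -/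

import Mathlib

namespace HardEdge

open Polynomial

/-- `x ↦ V(x²)` is uniformly convex: its second derivative is bounded below by a positive
constant. -/
def UniformlyConvexPotential (V : ℝ[X]) : Prop :=
  ∃ m : ℝ, 0 < m ∧ StrongConvexOn Set.univ m (fun x : ℝ => V.eval (x ^ 2))

/-- The `n × n` lower bidiagonal matrix with diagonal `x 1, …, x n` and subdiagonal
`-y 1, …, -y (n-1)`. The sequences are indexed from `1`, the rows and columns from `0`. -/
def bidiag (n : ℕ) (x y : ℕ → ℝ) : Matrix (Fin n) (Fin n) ℝ :=
  Matrix.of fun i j =>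
    if i = j then x ((j : ℕ) + 1)
    else if (i : ℕ) = (j : ℕ) + 1 then - y ((j : ℕ) + 1)
    else 0

/-- The coefficient of `log (x k)` in the Hamiltonian. -/
noncomputable def xWeight (β a : ℝ) (n k : ℕ) : ℝ :=
  (k : ℝ) / n + a / n - 1 / (n * β)

/-- The coefficient of `log (y k)` in the Hamiltonian. -/
noncomputable def yWeight (β : ℝ) (n k : ℕ) : ℝ :=
  (k : ℝ) / n - 1 / (n * β)

/-- The Hamiltonian; only `x 1, …, x n` and `y 1, …, y (n-1)` enter. -/
noncomputable def hamiltonian (V : ℝ[X]) (β a : ℝ) (n : ℕ) (x y : ℕ → ℝ) : ℝ :=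
  (aeval (bidiag n x y * (bidiag n x y).transpose) V).trace
    - ∑ k ∈ Finset.Icc 1 n, xWeight β a n k * Real.log (x k)
    - ∑ k ∈ Finset.Icc 1 (n - 1), yWeight β n k * Real.log (y k)

/-- The part of the closed orthant on which the Hamiltonian is finite, with the conventions
`0 * log 0 = 0` and `- w * log 0 = +∞` for `w > 0`: a coordinate may vanish only if the
coefficient of its logarithm is zero. When all coefficients are positive this is the open
orthant. -/
def hamiltonianDomain (β a : ℝ) (n : ℕ) (x y : ℕ → ℝ) : Prop :=
  (∀ k ∈ Finset.Icc 1 n, 0 ≤ x k ∧ (xWeight β a n k ≠ 0 → 0 < x k)) ∧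
  (∀ k ∈ Finset.Icc 1 (n - 1), 0 ≤ y k ∧ (yWeight β n k ≠ 0 → 0 < y k))

/-- `(x, y)` is a (global) minimizer of the Hamiltonian. -/
def IsHamiltonianMinimizer (V : ℝ[X]) (β a : ℝ) (n : ℕ) (x y : ℕ → ℝ) : Prop :=
  hamiltonianDomain β a n x y ∧
  ∀ x' y' : ℕ → ℝ, hamiltonianDomain β a n x' y' →
    hamiltonian V β a n x y ≤ hamiltonian V β a n x' y'

/-- The coarse minimizer `φ(t)`: the solution `r ≥ 0` of `t = ∑ m (2m choose m) g_m r^(2m)`,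
where `V = ∑ g_m x^m`. For an admissible potential and `t ≥ 0` there is exactly one such `r`
(positive for `t > 0`), so the infimum is over a one-point set. -/
noncomputable def phi (V : ℝ[X]) (t : ℝ) : ℝ :=
  sInf {r : ℝ | 0 ≤ r ∧
    t = ∑ m ∈ Finset.Icc 1 V.natDegree,
      (m : ℝ) * (Nat.choose (2 * m) m : ℝ) * V.coeff m * r ^ (2 * m)}

/-- `∫₀ᵗ du / φ(u)`. -/
noncomputable def intInvPhi (V : ℝ[X]) (t : ℝ) : ℝ :=
  ∫ u in (0 : ℝ)..t, 1 / phi V u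

/-- `κ`, chosen so that `θ(1) = 1`. -/
noncomputable def kappa (V : ℝ[X]) : ℝ := 1 / intInvPhi V 1 ^ 2

noncomputable def theta (V : ℝ[X]) (t : ℝ) : ℝ := kappa V * intInvPhi V t ^ 2

/-- The prescribed difference of the two first order corrections. -/
noncomputable def corrDiff (V : ℝ[X]) (a t : ℝ) : ℝ :=
  (a + 1 / 2) * (intInvPhi V t)⁻¹ - deriv (phi V) t / 2

/-- The prescribed sum of the two first order corrections. -/
noncomputable def corrSum (V : ℝ[X]) (β a t : ℝ) : ℝ :=
  (a - 2 / β) * deriv (phi V) t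

/-- First order correction for `x`. -/
noncomputable def corrX (V : ℝ[X]) (β a t : ℝ) : ℝ :=
  (corrSum V β a t + corrDiff V a t) / 2

/-- First order correction for `y`. -/
noncomputable def corrY (V : ℝ[X]) (β a t : ℝ) : ℝ :=
  (corrSum V β a t - corrDiff V a t) / 2

/-- The `x`-coordinates of the fine minimizer. -/
noncomputable def fineX (V : ℝ[X]) (β a : ℝ) (n i : ℕ) : ℝ :=
  phi V ((i : ℝ) / n) + corrX V β a ((i : ℝ) / n) / n

/-- The `y`-coordinates of the fine minimizer. -/
noncomputable def fineY (V : ℝ[X]) (β a : ℝ) (n i : ℕ) : ℝ :=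
  phi V ((i : ℝ) / n) + corrY V β a ((i : ℝ) / n) / n

/-- The Euclidean distance between the `i`-th coordinates of `(x, y)` and of the fine minimizer.
There is no variable `y n`, so for `i = n` only the `x`-coordinate counts. -/
noncomputable def fineDist (V : ℝ[X]) (β a : ℝ) (n : ℕ) (x y : ℕ → ℝ) (i : ℕ) : ℝ :=
  Real.sqrt ((fineX V β a n i - x i) ^ 2 + if i < n then (fineY V β a n i - y i) ^ 2 else 0)

/-- The sum of `log (x k / y k)` over `⌊n s⌋ ≤ k ≤ ⌊n t⌋`, restricted to the indices
`1 ≤ k ≤ n - 1` for which both variables exist. -/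
noncomputable def logRatioSum (n : ℕ) (x y : ℕ → ℝ) (s t : ℝ) : ℝ :=
  ∑ k ∈ Finset.Icc (max 1 ⌊(n : ℝ) * s⌋₊) (min (n - 1) ⌊(n : ℝ) * t⌋₊), Real.log (x k / y k)

/-- The error term for the sum of logarithms. -/
noncomputable def meanError (c : ℝ) (n : ℕ) (s t : ℝ) : ℝ :=
  1 / ((n : ℝ) * s)
    + ∑ k ∈ Finset.Icc (max 1 ⌊(n : ℝ) * s⌋₊) ⌊c * Real.log n⌋₊, 1 / Real.sqrt (k : ℝ)
    + ∑ k ∈ Finset.Icc ⌊(n : ℝ) * (1 - t)⌋₊ ⌊c * Real.log n⌋₊, Real.exp (-(k : ℝ) / c)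

end HardEdge

/-! Read `x 1, y 1, x 2, y 2, …` as the weights `z 0, z 1, …` of the `2 n - 1` consecutive bonds of
a path. The bidiagonal matrix `B` becomes, up to signs, the off-diagonal block of the Jacobi matrix
`J` of the path, and with `W(u) = V(u²)` one has `tr V(B Bᵀ) = tr W(J) / 2` (`trace_bidiag`).
Klein's inequality (`klein_inequality`) makes this energy uniformly convex in the bond weights with
a constant independent of `n`, and the logarithmic terms are convex because their coefficients are
nonnegative. This gives existence, uniqueness and the critical point equations `bondEntry = w / z`
(`exists_isBondMinimizer`, `IsBondMinimizer.unique`, `IsBondMinimizer.bondEntry_eq`).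

The fine minimizer nearly solves these equations. The entry `bondEntry` at a bond is a weighted sum
over walks of bounded length, so it depends on boundedly many neighbouring bonds. For constant
weights `φ` the equation is the one defining `phi`. To first order the deviation of the weights from
`φ` near a bond is a constant plus an alternating part plus a linear drift. The drift drops out by
reflection symmetry (`exists_walk_expansion`). The constant and alternating parts enter through
`coarse` and `coarseInt`, that is, through `φ'` and `∫ du / φ`, and the corrections `corrX`, `corrY`
are exactly the solution of the linearized equations. The residual at bond `l` is therefore of order
`bondScale n l / (l + 1)²`, except near the right end, where the path is cut off and only a bounded
residual is available (`Tangent.exists_residual_bounds`).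

A local residual causes only a local error. Conjugating `J` by a diagonal matrix of slowly varying
exponential weights perturbs the convexity estimate by a small amount, so monotonicity survives with
exponential weights (`weighted_bondEntry_monotone`, a Combes–Thomas argument). Hence the squared
error at a bond is at most an exponentially weighted sum of squared residuals
(`IsBondMinimizer.exists_sq_error_le`), which gives the pointwise comparison
`Tangent.exists_abs_sub_fineBond_le`. Claim (1) is this bound read in three ranges of the index
(`exists_range_bounds`).

For claim (2), the critical point equations bound the minimizer from below by its natural size, so
the comparison passes to logarithms: `log (x k / y k)` equals `corrDiff / (n φ)` at `k / n` up to `1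
/ k²` and a term decaying away from the right end (`Tangent.exists_abs_log_ratio_sub_le`). Since
`corrDiff / φ` is the derivative of `logProfile`, the sum is a Riemann sum for an increment of
`logProfile`, which is the claimed limit (`Tangent.exists_abs_logRatioSum_sub_le`). -/

namespace HardEdge

open Polynomial Matrix

/-! ### Trace inequalities for polynomials of symmetric matrices. -/

section Spectral

variable {ι : Type*} [Fintype ι] [DecidableEq ι]

/-- A real symmetric matrix is orthogonally diagonalizable. -/
theorem exists_orthogonal_diagonalization {A : Matrix ι ι ℝ} (hA : A.IsSymm) :
    ∃ (U : Matrix ι ι ℝ) (d : ι → ℝ), Uᵀ * U = 1 ∧ U * Uᵀ = 1 ∧ A = U * diagonal d * Uᵀ := by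
  have hH : A.IsHermitian := by
    rw [Matrix.IsHermitian, Matrix.conjTranspose_eq_transpose_of_trivial]; exact hA
  refine ⟨hH.eigenvectorUnitary, hH.eigenvalues, ?_, ?_, ?_⟩
  · have := (Matrix.mem_unitaryGroup_iff'.1 hH.eigenvectorUnitary.2)
    rwa [Matrix.star_eq_conjTranspose, Matrix.conjTranspose_eq_transpose_of_trivial] at this
  · have := (Matrix.mem_unitaryGroup_iff.1 hH.eigenvectorUnitary.2)
    rwa [Matrix.star_eq_conjTranspose, Matrix.conjTranspose_eq_transpose_of_trivial] at this
  · have := hH.spectral_theorem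
    rw [Unitary.conjStarAlgAut_apply] at this
    rw [← Matrix.conjTranspose_eq_transpose_of_trivial, ← Matrix.star_eq_conjTranspose]
    exact this

theorem conj_pow_eq {U A D : Matrix ι ι ℝ} (h1 : Uᵀ * U = 1) (hA : A = U * D * Uᵀ)
    (h2 : U * Uᵀ = 1) (k : ℕ) : A ^ k = U * D ^ k * Uᵀ := by
  induction k with
  | zero => simp [h2]
  | succ k ih =>
    rw [pow_succ, ih, hA, pow_succ]
    calc U * D ^ k * Uᵀ * (U * D * Uᵀ) = U * D ^ k * (Uᵀ * U) * D * Uᵀ := by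
          simp only [Matrix.mul_assoc]
      _ = _ := by rw [h1]; simp only [Matrix.mul_assoc, Matrix.one_mul]

theorem aeval_diagonal (p : ℝ[X]) (d : ι → ℝ) :
    aeval (diagonal d) p = diagonal fun i => p.eval (d i) := by
  have := Polynomial.aeval_algHom_apply (Matrix.diagonalAlgHom (n := ι) (α := ℝ) ℝ) d p
  simp only [Matrix.diagonalAlgHom_apply] at this
  rw [this]
  congr 1
  ext i
  have := Polynomial.aeval_algHom_apply (Pi.evalAlgHom ℝ (fun _ : ι => ℝ) i) d p
  simp only [Pi.evalAlgHom_apply] at this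
  rw [← this, Polynomial.coe_aeval_eq_eval]

theorem aeval_conj {U A : Matrix ι ι ℝ} {d : ι → ℝ} (h1 : Uᵀ * U = 1) (h2 : U * Uᵀ = 1)
    (hA : A = U * diagonal d * Uᵀ) (p : ℝ[X]) :
    aeval A p = U * diagonal (fun i => p.eval (d i)) * Uᵀ := by
  rw [← aeval_diagonal, aeval_eq_sum_range, aeval_eq_sum_range, Finset.mul_sum, Finset.sum_mul]
  refine Finset.sum_congr rfl fun k _ => ?_
  rw [conj_pow_eq h1 hA h2, Matrix.mul_smul, Matrix.smul_mul]

/-- In the two eigenbases every mixed trace becomes a double sum over pairs of eigenvalues with the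
same nonnegative weights, the squared overlaps of the eigenvectors. Trace inequalities thereby
reduce to scalar ones. -/
theorem trace_aeval_mul_aeval {U A V B : Matrix ι ι ℝ} {d e : ι → ℝ}
    (hU1 : Uᵀ * U = 1) (hU2 : U * Uᵀ = 1) (hA : A = U * diagonal d * Uᵀ)
    (hV1 : Vᵀ * V = 1) (hV2 : V * Vᵀ = 1) (hB : B = V * diagonal e * Vᵀ) (p q : ℝ[X]) :
    (aeval A p * aeval B q).trace
      = ∑ i, ∑ j, (Uᵀ * V) i j ^ 2 * (p.eval (d i) * q.eval (e j)) := by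
  rw [aeval_conj hU1 hU2 hA, aeval_conj hV1 hV2 hB]
  have h : (U * diagonal (fun i => p.eval (d i)) * Uᵀ * (V * diagonal (fun i => q.eval (e i)) * Vᵀ)).trace
      = (diagonal (fun i => p.eval (d i)) * (Uᵀ * V) *
          (diagonal (fun i => q.eval (e i)) * (Uᵀ * V)ᵀ)).trace := by
    rw [Matrix.transpose_mul, Matrix.transpose_transpose]
    have := Matrix.trace_mul_comm U (diagonal (fun i => p.eval (d i)) * Uᵀ *
      (V * diagonal (fun i => q.eval (e i)) * Vᵀ))
    simp only [Matrix.mul_assoc] at this ⊢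
    exact this
  rw [h]
  simp only [Matrix.trace, Matrix.diag_apply]
  refine Finset.sum_congr rfl fun i _ => ?_
  rw [Matrix.mul_apply]
  refine Finset.sum_congr rfl fun j _ => ?_
  rw [Matrix.diagonal_mul, Matrix.diagonal_mul, Matrix.transpose_apply]
  ring

/-- Klein's inequality for a uniformly convex polynomial. -/
theorem klein_inequality {W : ℝ[X]} {m : ℝ}
    (hW : ∀ s t : ℝ, W.eval t + W.derivative.eval t * (s - t) + m / 2 * (s - t) ^ 2 ≤ W.eval s)
    {A B : Matrix ι ι ℝ} (hA : A.IsSymm) (hB : B.IsSymm) :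
    (aeval B W).trace + ((A - B) * aeval B (derivative W)).trace
      + m / 2 * ((A - B) * (A - B)).trace ≤ (aeval A W).trace := by
  obtain ⟨U, d, hU1, hU2, hA'⟩ := exists_orthogonal_diagonalization hA
  obtain ⟨V, e, hV1, hV2, hB'⟩ := exists_orthogonal_diagonalization hB
  -- All seven traces needed are expressed with the same weights, so that the claim becomes the
  -- tangent inequality at each pair of eigenvalues.
  have key := trace_aeval_mul_aeval hU1 hU2 hA' hV1 hV2 hB'
  have h1 := key W 1
  have h2 := key 1 W
  have h3 := key X (derivative W)
  have h4 := key 1 (X * derivative W)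
  have h5 := key (X * X) 1
  have h6 := key X X
  have h7 := key 1 (X * X)
  simp only [map_one, mul_one, one_mul, aeval_X, map_mul, eval_mul, eval_X, eval_one] at h1 h2 h3 h4 h5 h6 h7
  have e1 : ((A - B) * aeval B (derivative W)).trace
      = (A * aeval B (derivative W)).trace - (B * aeval B (derivative W)).trace := by
    rw [Matrix.sub_mul, Matrix.trace_sub]
  have e2 : ((A - B) * (A - B)).trace
      = (A * A).trace - 2 * (A * B).trace + (B * B).trace := by
    rw [Matrix.sub_mul, Matrix.mul_sub, Matrix.mul_sub, Matrix.trace_sub, Matrix.trace_sub,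
      Matrix.trace_sub, Matrix.trace_mul_comm B A]
    ring
  rw [e1, e2, h1, h2, h3, h4, h5, h6, h7, ← sub_nonneg]
  have : (∑ i, ∑ j, (Uᵀ * V) i j ^ 2 * W.eval (d i)) -
      (((∑ i, ∑ j, (Uᵀ * V) i j ^ 2 * W.eval (e j)) +
        ((∑ i, ∑ j, (Uᵀ * V) i j ^ 2 * (d i * (derivative W).eval (e j))) -
          ∑ i, ∑ j, (Uᵀ * V) i j ^ 2 * (e j * (derivative W).eval (e j)))) +
        m / 2 * (((∑ i, ∑ j, (Uᵀ * V) i j ^ 2 * (d i * d i)) -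
          2 * ∑ i, ∑ j, (Uᵀ * V) i j ^ 2 * (d i * e j)) +
          ∑ i, ∑ j, (Uᵀ * V) i j ^ 2 * (e j * e j)))
      = ∑ i, ∑ j, (Uᵀ * V) i j ^ 2 * (W.eval (d i) - (W.eval (e j) +
          (derivative W).eval (e j) * (d i - e j) + m / 2 * (d i - e j) ^ 2)) := by
    simp only [Finset.mul_sum, ← Finset.sum_add_distrib, ← Finset.sum_sub_distrib]
    refine Finset.sum_congr rfl fun i _ => Finset.sum_congr rfl fun j _ => ?_
    ring
  rw [this]
  exact Finset.sum_nonneg fun i _ => Finset.sum_nonneg fun j _ =>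
    mul_nonneg (sq_nonneg _) (sub_nonneg.2 (hW _ _))

/-- The noncommutative divided difference of a polynomial at a pair of matrices. -/
noncomputable def divDiff (Q : ℝ[X]) (A B E : Matrix ι ι ℝ) : Matrix ι ι ℝ :=
  ∑ p ∈ Finset.range (Q.natDegree + 1), Q.coeff p •
    ∑ i ∈ Finset.range p, A ^ i * E * B ^ (p - 1 - i)

/-- A telescoping sum which needs no commutativity. It expresses a difference of matrix polynomials
as a linear function of `A - B`. -/
theorem sum_pow_mul_sub_mul_pow {R : Type*} [Ring R] (A B : R) (p : ℕ) :
    ∑ i ∈ Finset.range p, A ^ i * (A - B) * B ^ (p - 1 - i) = A ^ p - B ^ p := by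
  induction p with
  | zero => simp
  | succ p ih =>
    rw [Finset.sum_range_succ]
    have : ∑ i ∈ Finset.range p, A ^ i * (A - B) * B ^ (p + 1 - 1 - i)
        = (∑ i ∈ Finset.range p, A ^ i * (A - B) * B ^ (p - 1 - i)) * B := by
      rw [Finset.sum_mul]
      refine Finset.sum_congr rfl fun i hi => ?_
      have hi := Finset.mem_range.1 hi
      rw [mul_assoc _ _ B, ← pow_succ]
      congr 2
      omega
    rw [this, ih]
    simp only [add_tsub_cancel_right, tsub_self, pow_zero, mul_one, pow_succ]
    noncomm_ring

theorem divDiff_sub (Q : ℝ[X]) (A B : Matrix ι ι ℝ) :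
    divDiff Q A B (A - B) = aeval A Q - aeval B Q := by
  rw [divDiff, aeval_eq_sum_range, aeval_eq_sum_range, ← Finset.sum_sub_distrib]
  refine Finset.sum_congr rfl fun p _ => ?_
  rw [sum_pow_mul_sub_mul_pow, smul_sub]

theorem sub_mul_sum_pow (Q : ℝ[X]) (s t : ℝ) :
    (s - t) * ∑ p ∈ Finset.range (Q.natDegree + 1), Q.coeff p *
      ∑ i ∈ Finset.range p, s ^ i * t ^ (p - 1 - i) = Q.eval s - Q.eval t := by
  rw [eval_eq_sum_range, eval_eq_sum_range, ← Finset.sum_sub_distrib, Finset.mul_sum]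
  refine Finset.sum_congr rfl fun p _ => ?_
  rw [← mul_sub, ← sum_pow_mul_sub_mul_pow, mul_left_comm, Finset.mul_sum]
  congr 1
  refine Finset.sum_congr rfl fun i _ => ?_
  ring

/-- For `s ≠ t` divide by `(s - t) ^ 2`; the case `s = t` follows because the divided difference is
a polynomial, hence continuous, and the points other than `t` are dense. -/
theorem le_scalar_divDiff {Q : ℝ[X]} {m : ℝ}
    (hQ : ∀ s t : ℝ, m * (s - t) ^ 2 ≤ (s - t) * (Q.eval s - Q.eval t)) (s t : ℝ) :
    m ≤ ∑ p ∈ Finset.range (Q.natDegree + 1), Q.coeff p *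
      ∑ i ∈ Finset.range p, s ^ i * t ^ (p - 1 - i) := by
  have hne : ∀ u, u ≠ t → m ≤ ∑ p ∈ Finset.range (Q.natDegree + 1), Q.coeff p *
      ∑ i ∈ Finset.range p, u ^ i * t ^ (p - 1 - i) := by
    intro u hu
    have h := hQ u t
    rw [← sub_mul_sum_pow Q u t, ← mul_assoc, ← sq, mul_comm] at h
    exact le_of_mul_le_mul_left h (by have := sub_ne_zero.2 hu; positivity)
  have hcont : Continuous fun u : ℝ => ∑ p ∈ Finset.range (Q.natDegree + 1), Q.coeff p *
      ∑ i ∈ Finset.range p, u ^ i * t ^ (p - 1 - i) := by fun_prop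
  have hd : Dense {u : ℝ | u ≠ t} := dense_compl_singleton t
  exact (isClosed_Ici.preimage hcont).closure_subset_iff.2 (fun u hu => hne u hu) (hd s)

/-- In the eigenbases of `A` and `B` the map `Y ↦ divDiff Q A B Y` multiplies each entry by a scalar
divided difference of `Q`, which is at least `m`. It matters that `Y` is arbitrary: the weighted
estimate uses a `Y` different from `A - B`. -/
theorem le_trace_mul_divDiff {Q : ℝ[X]} {m : ℝ}
    (hQ : ∀ s t : ℝ, m * (s - t) ^ 2 ≤ (s - t) * (Q.eval s - Q.eval t))
    {A B : Matrix ι ι ℝ} (hA : A.IsSymm) (hB : B.IsSymm) (Y : Matrix ι ι ℝ) :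
    m * (Yᵀ * Y).trace ≤ (Yᵀ * divDiff Q A B Y).trace := by
  obtain ⟨U, d, hU1, hU2, hA'⟩ := exists_orthogonal_diagonalization hA
  obtain ⟨V, e, hV1, hV2, hB'⟩ := exists_orthogonal_diagonalization hB
  obtain ⟨Z, hZ⟩ : ∃ Z, Z = Uᵀ * Y * V := ⟨_, rfl⟩
  have hY : Y = U * Z * Vᵀ := by
    rw [hZ]
    calc Y = (U * Uᵀ) * Y * (V * Vᵀ) := by rw [hU2, hV2]; simp
      _ = _ := by simp only [Matrix.mul_assoc]
  have htr : ∀ C : Matrix ι ι ℝ, (Yᵀ * (U * C * Vᵀ)).trace = ∑ i, ∑ j, Z i j * C i j := by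
    intro C
    have : (Yᵀ * (U * C * Vᵀ)).trace = (Zᵀ * C).trace := by
      rw [hY, Matrix.transpose_mul, Matrix.transpose_mul, Matrix.transpose_transpose]
      calc (V * (Zᵀ * Uᵀ) * (U * C * Vᵀ)).trace = (V * (Zᵀ * (Uᵀ * U) * C * Vᵀ)).trace := by
            simp only [Matrix.mul_assoc]
        _ = ((Zᵀ * C) * (Vᵀ * V)).trace := by
            rw [hU1, Matrix.trace_mul_comm]; simp only [Matrix.mul_assoc, Matrix.one_mul]
        _ = _ := by rw [hV1, Matrix.mul_one]
    rw [this, Matrix.trace, Finset.sum_comm]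
    refine Finset.sum_congr rfl fun j _ => ?_
    rw [Matrix.diag_apply, Matrix.mul_apply]
    rfl
  have hL : divDiff Q A B Y = U * (Matrix.of fun i j =>
      (∑ p ∈ Finset.range (Q.natDegree + 1), Q.coeff p *
        ∑ k ∈ Finset.range p, d i ^ k * e j ^ (p - 1 - k)) * Z i j) * Vᵀ := by
    have hterm : ∀ k l : ℕ, A ^ k * Y * B ^ l
        = U * (Matrix.of fun i j => d i ^ k * e j ^ l * Z i j) * Vᵀ := by
      intro k l
      rw [conj_pow_eq hU1 hA' hU2, conj_pow_eq hV1 hB' hV2, hY]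
      have : (Matrix.of fun i j => d i ^ k * e j ^ l * Z i j)
          = diagonal d ^ k * Z * diagonal e ^ l := by
        ext i j
        rw [Matrix.diagonal_pow, Matrix.diagonal_pow, Matrix.mul_diagonal, Matrix.diagonal_mul]
        simp only [Matrix.of_apply, Pi.pow_apply]
        ring
      rw [this]
      calc U * diagonal d ^ k * Uᵀ * (U * Z * Vᵀ) * (V * diagonal e ^ l * Vᵀ)
          = U * diagonal d ^ k * (Uᵀ * U) * Z * (Vᵀ * V) * diagonal e ^ l * Vᵀ := by
            simp only [Matrix.mul_assoc]
        _ = _ := by rw [hU1, hV1]; simp only [Matrix.mul_assoc, Matrix.one_mul]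
    have hsum : (Matrix.of fun i j => (∑ p ∈ Finset.range (Q.natDegree + 1), Q.coeff p *
        ∑ k ∈ Finset.range p, d i ^ k * e j ^ (p - 1 - k)) * Z i j)
        = ∑ p ∈ Finset.range (Q.natDegree + 1), Q.coeff p • ∑ k ∈ Finset.range p,
            Matrix.of fun i j => d i ^ k * e j ^ (p - 1 - k) * Z i j := by
      ext i j
      simp only [Matrix.sum_apply, Matrix.smul_apply, Matrix.of_apply, smul_eq_mul,
        Finset.sum_mul, Finset.mul_sum, mul_assoc]
    rw [divDiff, hsum, Finset.mul_sum, Finset.sum_mul]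
    refine Finset.sum_congr rfl fun p _ => ?_
    rw [Matrix.mul_smul, Matrix.smul_mul, Finset.mul_sum, Finset.sum_mul]
    simp only [hterm]
  have h1 := htr Z
  rw [← hY] at h1
  rw [hL, htr, h1, Finset.mul_sum]
  refine Finset.sum_le_sum fun i _ => ?_
  rw [Finset.mul_sum]
  refine Finset.sum_le_sum fun j _ => ?_
  rw [Matrix.of_apply]
  have := mul_le_mul_of_nonneg_right (le_scalar_divDiff hQ (d i) (e j)) (mul_self_nonneg (Z i j))
  linarith

end Spectral

/-! ### Uniform convexity as a tangent inequality. -/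

section Convex

theorem UniformlyConvexPotential.exists_tangent {V : ℝ[X]} (hV : UniformlyConvexPotential V) :
    ∃ m : ℝ, 0 < m ∧ ∀ s t : ℝ, (V.comp (X ^ 2)).eval t
      + (V.comp (X ^ 2)).derivative.eval t * (s - t) + m / 2 * (s - t) ^ 2
        ≤ (V.comp (X ^ 2)).eval s := by
  obtain ⟨m, hm, h⟩ := hV
  refine ⟨m, hm, fun s t => ?_⟩
  rw [strongConvexOn_iff_convex] at h
  -- After subtraction of `m / 2 * x ^ 2` the function is still convex, hence above its tangents;
  -- adding the square back gives the quadratic gain.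
  have hd : ∀ t : ℝ, HasDerivAt (fun x : ℝ => V.eval (x ^ 2) - m / 2 * ‖x‖ ^ 2)
      ((V.comp (X ^ 2)).derivative.eval t - m * t) t := by
    intro t
    have h1 := (V.comp (X ^ 2)).hasDerivAt t
    have h2 := (hasDerivAt_pow 2 t).const_mul (m / 2)
    have h3 : HasDerivAt (fun x : ℝ => (V.comp (X ^ 2)).eval x - m / 2 * x ^ 2)
        ((V.comp (X ^ 2)).derivative.eval t - m * t) t :=
      (h1.sub h2).congr_deriv (by norm_num; ring)
    simpa only [eval_comp, eval_pow, eval_X, Real.norm_eq_abs, sq_abs] using h3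
  have key : ∀ s t : ℝ, (V.eval (t ^ 2) - m / 2 * ‖t‖ ^ 2)
      + ((V.comp (X ^ 2)).derivative.eval t - m * t) * (s - t)
        ≤ V.eval (s ^ 2) - m / 2 * ‖s‖ ^ 2 := by
    intro s t
    rcases lt_trichotomy s t with hst | rfl | hst
    · have := h.slope_le_of_hasDerivAt (Set.mem_univ s) (Set.mem_univ t) hst (hd t)
      rw [slope_def_field, div_le_iff₀ (by linarith)] at this
      linarith
    · simp
    · have := h.le_slope_of_hasDerivAt (Set.mem_univ t) (Set.mem_univ s) hst (hd t)
      rw [slope_def_field, le_div_iff₀ (by linarith)] at this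
      linarith
  have := key s t
  simp only [Real.norm_eq_abs, sq_abs] at this
  simp only [eval_comp, eval_pow, eval_X]
  linarith [this, show m / 2 * (s - t) ^ 2 = m / 2 * s ^ 2 - m / 2 * t ^ 2 - m * t * (s - t) by ring]

end Convex

end HardEdge

namespace HardEdge

open Polynomial Matrix

/-! ### Jacobi matrices of a path, their powers as walk sums, and the energy. -/

section Jacobi

/-- The Jacobi matrix with zero diagonal and off-diagonal entries `z 0, …, z (N - 1)`. -/
def jacobi (N : ℕ) (z : ℕ → ℝ) : Matrix (Fin (N + 1)) (Fin (N + 1)) ℝ :=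
  Matrix.of fun u v =>
    if (v : ℕ) = u + 1 then z u else if (u : ℕ) = v + 1 then z v else 0

theorem jacobi_isSymm (N : ℕ) (z : ℕ → ℝ) : (jacobi N z).IsSymm := by
  ext u v
  simp only [jacobi, Matrix.transpose_apply, Matrix.of_apply]
  split_ifs <;> first | rfl | omega

theorem jacobi_sub (N : ℕ) (z z' : ℕ → ℝ) :
    jacobi N z - jacobi N z' = jacobi N (fun l => z l - z' l) := by
  ext u v
  simp only [jacobi, Matrix.sub_apply, Matrix.of_apply]
  split_ifs <;> simp

theorem jacobi_apply_eq_add (N : ℕ) (z : ℕ → ℝ) (u v : Fin (N + 1)) :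
    jacobi N z u v = (if (v : ℕ) = u + 1 then z u else 0) + if (u : ℕ) = v + 1 then z v else 0 := by
  simp only [jacobi, Matrix.of_apply]
  split_ifs <;> first | omega | simp

theorem sum_ite_eq_val_add_one (N : ℕ) (c : ℕ → ℕ → ℝ) :
    ∑ u : Fin (N + 1), ∑ v : Fin (N + 1), (if (v : ℕ) = u + 1 then c u v else 0)
      = ∑ l ∈ Finset.range N, c l (l + 1) := by
  rw [← Fin.sum_univ_eq_sum_range (fun l => c l (l + 1)), Finset.sum_comm, Fin.sum_univ_succ]
  have h0 : ∑ u : Fin (N + 1), (if ((0 : Fin (N + 1)) : ℕ) = u + 1 then c u (0 : Fin (N + 1)) else 0)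
      = 0 := Finset.sum_eq_zero fun u _ => if_neg (by simp)
  rw [h0, zero_add]
  refine Finset.sum_congr rfl fun l _ => ?_
  rw [Finset.sum_eq_single l.castSucc]
  · simp
  · intro u _ hu
    refine if_neg fun h => hu ?_
    ext
    simp at h ⊢
    omega
  · simp

theorem sum_jacobi_mul (N : ℕ) (z : ℕ → ℝ) (f : ℕ → ℕ → ℝ) :
    ∑ u : Fin (N + 1), ∑ v : Fin (N + 1), jacobi N z u v * f u v
      = ∑ l ∈ Finset.range N, z l * (f l (l + 1) + f (l + 1) l) := by
  have h1 := sum_ite_eq_val_add_one N (fun u v => z u * f u v)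
  have h2 := sum_ite_eq_val_add_one N (fun u v => z u * f v u)
  rw [Finset.sum_comm] at h2
  simp only [mul_add, Finset.sum_add_distrib]
  rw [← h1, ← h2, ← Finset.sum_add_distrib]
  refine Finset.sum_congr rfl fun u _ => ?_
  rw [← Finset.sum_add_distrib]
  refine Finset.sum_congr rfl fun v _ => ?_
  rw [jacobi_apply_eq_add, add_mul, ite_mul, zero_mul, ite_mul, zero_mul]

/-- The bond weights extended by zero to all integers. -/
def extend (N : ℕ) (z : ℕ → ℝ) (s : ℤ) : ℝ :=
  if 0 ≤ s ∧ s < N then z s.toNat else 0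

theorem extend_natCast {N l : ℕ} (z : ℕ → ℝ) (h : l < N) : extend N z l = z l := by
  rw [extend, if_pos (by omega)]; simp

theorem sum_jacobi_row (N : ℕ) (z : ℕ → ℝ) (f : ℤ → ℝ) (u : Fin (N + 1)) :
    ∑ v : Fin (N + 1), jacobi N z u v * f v
      = extend N z u * f (u + 1) + extend N z (u - 1) * f (u - 1) := by
  simp only [jacobi_apply_eq_add, add_mul, Finset.sum_add_distrib, ite_mul, zero_mul]
  congr 1
  · by_cases h : (u : ℕ) < N
    · rw [extend_natCast z h, Finset.sum_eq_single ⟨u + 1, by omega⟩]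
      · simp
      · intro v _ hv
        refine if_neg fun h' => hv (Fin.ext h')
      · simp
    · rw [extend, if_neg (by omega), zero_mul]
      exact Finset.sum_eq_zero fun v _ => if_neg (by omega)
  · by_cases h : 1 ≤ (u : ℕ)
    · have e : ((u : ℕ) : ℤ) - 1 = ((u - 1 : ℕ) : ℤ) := by omega
      rw [e, extend_natCast z (by omega), Finset.sum_eq_single ⟨u - 1, by omega⟩]
      · simp only
        rw [if_pos (by omega)]
      · intro v _ hv
        exact if_neg fun h' => hv (Fin.ext (by simp; omega))
      · simp
    · rw [extend, if_neg (by omega), zero_mul]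
      exact Finset.sum_eq_zero fun v _ => if_neg (by omega)

/-- The total weight of the nearest neighbour walks of length `p` from `v` to `w`, where `Z s` is
the weight of the bond between `s` and `s + 1`. -/
noncomputable def walk (Z : ℤ → ℝ) (w : ℤ) : ℕ → ℤ → ℝ
  | 0, v => if v = w then 1 else 0
  | p + 1, v => Z v * walk Z w p (v + 1) + Z (v - 1) * walk Z w p (v - 1)

/-- Bonds beyond either end carry weight zero, so walks on `ℤ` automatically stay on the path and
the recursion needs no boundary cases. -/
theorem jacobi_pow_apply (N : ℕ) (z : ℕ → ℝ) (p : ℕ) (u w : Fin (N + 1)) :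
    (jacobi N z ^ p) u w = walk (extend N z) w p u := by
  induction p generalizing u with
  | zero => simp [walk, Matrix.one_apply, Fin.ext_iff]
  | succ p ih =>
    rw [pow_succ', Matrix.mul_apply, walk, ← sum_jacobi_row]
    simp only [ih]

/-- The entry on bond `l` of the polynomial `Q` of the Jacobi matrix; for `Q = W'` this is half of
the derivative of `tr W` with respect to the weight of that bond. -/
noncomputable def bondEntry (Q : ℝ[X]) (N : ℕ) (z : ℕ → ℝ) (l : ℕ) : ℝ :=
  ∑ p ∈ Finset.range (Q.natDegree + 1), Q.coeff p * walk (extend N z) (l + 1) p l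

theorem aeval_jacobi_apply (Q : ℝ[X]) (N : ℕ) (z : ℕ → ℝ) (u w : Fin (N + 1)) :
    aeval (jacobi N z) Q u w
      = ∑ p ∈ Finset.range (Q.natDegree + 1), Q.coeff p * walk (extend N z) w p u := by
  rw [aeval_eq_sum_range, Matrix.sum_apply]
  simp only [Matrix.smul_apply, jacobi_pow_apply, smul_eq_mul]

theorem aeval_isSymm {ι : Type*} [Fintype ι] [DecidableEq ι] {A : Matrix ι ι ℝ} (hA : A.IsSymm)
    (Q : ℝ[X]) : (aeval A Q).IsSymm := by
  rw [Matrix.IsSymm, aeval_eq_sum_range, Matrix.transpose_sum]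
  refine Finset.sum_congr rfl fun p _ => ?_
  rw [Matrix.transpose_smul, Matrix.transpose_pow, hA]

/-- Pairing a polynomial of a Jacobi matrix with a Jacobi matrix, with weights on the vertices. -/
theorem sum_jacobi_mul_aeval (Q : ℝ[X]) (N : ℕ) (e z : ℕ → ℝ) (c : ℕ → ℝ) :
    ∑ u : Fin (N + 1), ∑ v : Fin (N + 1), jacobi N e u v * (c u * aeval (jacobi N z) Q u v)
      = ∑ l ∈ Finset.range N, (c l + c (l + 1)) * (e l * bondEntry Q N z l) := by
  simp only [aeval_jacobi_apply]
  rw [sum_jacobi_mul N e (fun u v => c u * ∑ p ∈ Finset.range (Q.natDegree + 1),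
    Q.coeff p * walk (extend N z) v p u)]
  refine Finset.sum_congr rfl fun l hl => ?_
  have hl := Finset.mem_range.1 hl
  have h1 := aeval_jacobi_apply Q N z ⟨l, by omega⟩ ⟨l + 1, by omega⟩
  have h2 := aeval_jacobi_apply Q N z ⟨l + 1, by omega⟩ ⟨l, by omega⟩
  -- By symmetry both orientations of a bond give the same entry, so the vertex weights at its two
  -- ends simply add.
  have h3 := (aeval_isSymm (jacobi_isSymm N z) Q).apply ⟨l, by omega⟩ ⟨l + 1, by omega⟩
  rw [h1, h2] at h3
  simp only [bondEntry]
  simp only [Nat.cast_add, Nat.cast_one] at h3 ⊢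
  rw [h3]
  ring

theorem trace_transpose_mul_eq {ι : Type*} [Fintype ι] (A B : Matrix ι ι ℝ) :
    (Aᵀ * B).trace = ∑ i, ∑ j, A i j * B i j := by
  rw [Matrix.trace, Finset.sum_comm]
  refine Finset.sum_congr rfl fun j _ => ?_
  rw [Matrix.diag_apply, Matrix.mul_apply]
  rfl

theorem sum_jacobi_sq (N : ℕ) (e c : ℕ → ℝ) :
    ∑ u : Fin (N + 1), ∑ v : Fin (N + 1), jacobi N e u v * (c u * jacobi N e u v)
      = ∑ l ∈ Finset.range N, (c l + c (l + 1)) * e l ^ 2 := by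
  have := sum_jacobi_mul N e (fun u v => c u *
    ((if v = u + 1 then e u else 0) + if u = v + 1 then e v else 0))
  simp only [← jacobi_apply_eq_add] at this
  rw [this]
  refine Finset.sum_congr rfl fun l _ => ?_
  have hne : ¬ l = l + 1 + 1 := by omega
  simp only [if_true, if_neg hne]
  ring

/-- Half of the trace of `W` of a Jacobi matrix. -/
noncomputable def energy (W : ℝ[X]) (N : ℕ) (z : ℕ → ℝ) : ℝ :=
  (aeval (jacobi N z) W).trace / 2

/-- Klein's inequality for two Jacobi matrices. Each bond occupies two entries of the matrix, and
the resulting factor two cancels the half in `energy`. -/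
theorem energy_ge {W : ℝ[X]} {m : ℝ}
    (hW : ∀ s t : ℝ, W.eval t + W.derivative.eval t * (s - t) + m / 2 * (s - t) ^ 2 ≤ W.eval s)
    (N : ℕ) (z z' : ℕ → ℝ) :
    energy W N z' + ∑ l ∈ Finset.range N, (z l - z' l) * bondEntry (derivative W) N z' l
      + m / 2 * ∑ l ∈ Finset.range N, (z l - z' l) ^ 2 ≤ energy W N z := by
  have h := klein_inequality hW (jacobi_isSymm N z) (jacobi_isSymm N z')
  rw [jacobi_sub] at h
  have h1 := sum_jacobi_mul_aeval (derivative W) N (fun l => z l - z' l) z' (fun _ => 1)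
  have h2 := sum_jacobi_sq N (fun l => z l - z' l) (fun _ => 1)
  simp only [one_mul] at h1 h2
  rw [← trace_transpose_mul_eq, jacobi_isSymm] at h1 h2
  rw [h1, h2] at h
  rw [energy, energy]
  rw [← Finset.mul_sum] at h
  rw [← Finset.mul_sum] at h
  linarith

/-- The sum of two tangent inequalities with the roles of the points exchanged. -/
theorem bondEntry_monotone {W : ℝ[X]} {m : ℝ}
    (hW : ∀ s t : ℝ, W.eval t + W.derivative.eval t * (s - t) + m / 2 * (s - t) ^ 2 ≤ W.eval s)
    (N : ℕ) (z z' : ℕ → ℝ) :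
    m * ∑ l ∈ Finset.range N, (z l - z' l) ^ 2 ≤ ∑ l ∈ Finset.range N,
      (z l - z' l) * (bondEntry (derivative W) N z l - bondEntry (derivative W) N z' l) := by
  have h1 := energy_ge hW N z z'
  have h2 := energy_ge hW N z' z
  have h3 : ∑ l ∈ Finset.range N, (z' l - z l) * bondEntry (derivative W) N z l
      = -∑ l ∈ Finset.range N, (z l - z' l) * bondEntry (derivative W) N z l := by
    rw [← Finset.sum_neg_distrib]; exact Finset.sum_congr rfl fun l _ => by ring
  have h4 : ∑ l ∈ Finset.range N, (z' l - z l) ^ 2 = ∑ l ∈ Finset.range N, (z l - z' l) ^ 2 :=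
    Finset.sum_congr rfl fun l _ => by ring
  have h5 : ∑ l ∈ Finset.range N, (z l - z' l) *
        (bondEntry (derivative W) N z l - bondEntry (derivative W) N z' l)
      = ∑ l ∈ Finset.range N, (z l - z' l) * bondEntry (derivative W) N z l
        - ∑ l ∈ Finset.range N, (z l - z' l) * bondEntry (derivative W) N z' l := by
    rw [← Finset.sum_sub_distrib]; exact Finset.sum_congr rfl fun l _ => by ring
  rw [h4] at h2
  linarith

end Jacobi

/-! ### Monotonicity of the gradient in exponentially weighted norms. -/

section Weighted

attribute [local instance] Matrix.frobeniusNormedAddCommGroup Matrix.frobeniusNormedSpace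

variable {ι : Type*} [Fintype ι]

theorem frobenius_norm_sq (X : Matrix ι ι ℝ) : ‖X‖ ^ 2 = ∑ i, ∑ j, X i j ^ 2 := by
  rw [Matrix.frobenius_norm_def, ← Real.sqrt_eq_rpow, Real.sq_sqrt]
  · simp
  · positivity

theorem abs_trace_transpose_mul_le (X Y : Matrix ι ι ℝ) :
    |(Xᵀ * Y).trace| ≤ ‖X‖ * ‖Y‖ := by
  refine abs_le_of_sq_le_sq ?_ (by positivity)
  rw [mul_pow, frobenius_norm_sq, frobenius_norm_sq, trace_transpose_mul_eq]
  simp only [← Finset.sum_product']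
  exact Finset.sum_mul_sq_le_sq_mul_sq _ _ _

/-- Schur's test for left multiplication. -/
theorem norm_mul_le_of_row_col_sum {C : Matrix ι ι ℝ} {s : ℝ} (hs : 0 ≤ s)
    (hrow : ∀ i, ∑ j, |C i j| ≤ s) (hcol : ∀ j, ∑ i, |C i j| ≤ s) (X : Matrix ι ι ℝ) :
    ‖C * X‖ ≤ s * ‖X‖ := by
  refine le_of_sq_le_sq ?_ (by positivity)
  rw [mul_pow, frobenius_norm_sq, frobenius_norm_sq]
  have h1 : ∀ i k, (C * X) i k ^ 2 ≤ s * ∑ j, |C i j| * X j k ^ 2 := by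
    intro i k
    rw [Matrix.mul_apply]
    have := Finset.sum_sq_le_sum_mul_sum_of_sq_le_mul Finset.univ
      (r := fun j => C i j * X j k) (f := fun j => |C i j|) (g := fun j => |C i j| * X j k ^ 2)
      (fun j _ => abs_nonneg _) (fun j _ => by positivity)
      (fun j _ => by rw [mul_pow, ← sq_abs (C i j)]; exact le_of_eq (by ring))
    refine this.trans ?_
    exact mul_le_mul_of_nonneg_right (hrow i) (Finset.sum_nonneg fun j _ => by positivity)
  calc ∑ i, ∑ k, (C * X) i k ^ 2 ≤ ∑ i, ∑ k, s * ∑ j, |C i j| * X j k ^ 2 :=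
        Finset.sum_le_sum fun i _ => Finset.sum_le_sum fun k _ => h1 i k
    _ = s * ∑ j, (∑ i, |C i j|) * ∑ k, X j k ^ 2 := by
        simp only [← Finset.mul_sum]
        congr 1
        have : ∀ i, ∑ k, ∑ j, |C i j| * X j k ^ 2 = ∑ j, |C i j| * ∑ k, X j k ^ 2 := by
          intro i
          rw [Finset.sum_comm]
          simp only [Finset.mul_sum]
        simp only [this]
        rw [Finset.sum_comm]
        simp only [Finset.sum_mul]
    _ ≤ s * ∑ j, s * ∑ k, X j k ^ 2 := by
        refine mul_le_mul_of_nonneg_left ?_ hs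
        exact Finset.sum_le_sum fun j _ => mul_le_mul_of_nonneg_right (hcol j)
          (Finset.sum_nonneg fun k _ => sq_nonneg _)
    _ = s ^ 2 * ∑ j, ∑ k, X j k ^ 2 := by rw [← Finset.mul_sum]; ring

variable [DecidableEq ι]

/-- Every row and column has at most two nonzero entries, so Schur's test applies with `2 * k`,
independently of the size of the matrix. -/
theorem norm_mul_le_of_tridiagonal {N : ℕ} {C : Matrix (Fin (N + 1)) (Fin (N + 1)) ℝ} {k : ℝ}
    (hk : 0 ≤ k) (h1 : ∀ u v, |C u v| ≤ k)
    (h0 : ∀ u v : Fin (N + 1), (v : ℕ) ≠ u + 1 → (u : ℕ) ≠ v + 1 → C u v = 0)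
    (X : Matrix (Fin (N + 1)) (Fin (N + 1)) ℝ) : ‖C * X‖ ≤ 2 * k * ‖X‖ := by
  have hind : ∀ u v : Fin (N + 1), |C u v|
      ≤ (if (v : ℕ) = u + 1 then k else 0) + if (u : ℕ) = v + 1 then k else 0 := by
    intro u v
    by_cases h : (v : ℕ) = u + 1
    · rw [if_pos h, if_neg (by omega), add_zero]; exact h1 u v
    · by_cases h' : (u : ℕ) = v + 1
      · rw [if_neg h, if_pos h', zero_add]; exact h1 u v
      · rw [h0 u v h h', if_neg h, if_neg h']; simp
  have hs1 : ∀ u : Fin (N + 1), ∑ v : Fin (N + 1), (if (v : ℕ) = u + 1 then k else 0) ≤ k := by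
    intro u
    rw [← Finset.sum_filter, Finset.sum_const, nsmul_eq_mul]
    have : (Finset.univ.filter fun v : Fin (N + 1) => (v : ℕ) = u + 1).card ≤ 1 :=
      Finset.card_le_one.2 fun a ha b hb => by
        simp at ha hb; exact Fin.ext (ha.trans hb.symm)
    have : ((Finset.univ.filter fun v : Fin (N + 1) => (v : ℕ) = u + 1).card : ℝ) ≤ 1 := by
      exact_mod_cast this
    nlinarith
  have hs2 : ∀ u : Fin (N + 1), ∑ v : Fin (N + 1), (if (u : ℕ) = v + 1 then k else 0) ≤ k := by
    intro u
    rw [← Finset.sum_filter, Finset.sum_const, nsmul_eq_mul]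
    have : (Finset.univ.filter fun v : Fin (N + 1) => (u : ℕ) = v + 1).card ≤ 1 :=
      Finset.card_le_one.2 fun a ha b hb => by
        simp at ha hb; exact Fin.ext (by omega)
    have : ((Finset.univ.filter fun v : Fin (N + 1) => (u : ℕ) = v + 1).card : ℝ) ≤ 1 := by
      exact_mod_cast this
    nlinarith
  refine norm_mul_le_of_row_col_sum (by positivity) (fun u => ?_) (fun v => ?_) X
  · refine (Finset.sum_le_sum fun v _ => hind u v).trans ?_
    rw [Finset.sum_add_distrib]
    linarith [hs1 u, hs2 u]
  · refine (Finset.sum_le_sum fun u _ => hind u v).trans ?_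
    rw [Finset.sum_add_distrib]
    linarith [hs1 v, hs2 v]

theorem norm_pow_mul_le {A : Matrix ι ι ℝ} {κ : ℝ} (hκ : 0 ≤ κ)
    (hA : ∀ X, ‖A * X‖ ≤ κ * ‖X‖) (i : ℕ) (X : Matrix ι ι ℝ) : ‖A ^ i * X‖ ≤ κ ^ i * ‖X‖ := by
  induction i with
  | zero => simp
  | succ i ih =>
    rw [pow_succ', Matrix.mul_assoc, pow_succ', mul_assoc]
    exact (hA _).trans (mul_le_mul_of_nonneg_left ih hκ)

theorem norm_pow_sub_pow_mul_le {A A' : Matrix ι ι ℝ} {κ η : ℝ} (hκ : 0 ≤ κ) (hη : 0 ≤ η)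
    (hA : ∀ X, ‖A * X‖ ≤ κ * ‖X‖) (hA' : ∀ X, ‖A' * X‖ ≤ κ * ‖X‖)
    (hd : ∀ X, ‖(A' - A) * X‖ ≤ κ * η * ‖X‖) (i : ℕ) (X : Matrix ι ι ℝ) :
    ‖(A' ^ i - A ^ i) * X‖ ≤ i * κ ^ i * η * ‖X‖ := by
  induction i with
  | zero => simp
  | succ i ih =>
    have e : (A' ^ (i + 1) - A ^ (i + 1)) * X
        = A' * ((A' ^ i - A ^ i) * X) + (A' - A) * (A ^ i * X) := by
      rw [pow_succ', pow_succ']; noncomm_ring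
    rw [e]
    refine (norm_add_le _ _).trans ?_
    have h1 := (hA' ((A' ^ i - A ^ i) * X)).trans (mul_le_mul_of_nonneg_left ih hκ)
    have h2 := (hd (A ^ i * X)).trans
      (mul_le_mul_of_nonneg_left (norm_pow_mul_le hκ hA i X) (by positivity))
    push_cast
    rw [pow_succ]
    nlinarith

/-- The constant in the perturbation bound for conjugated divided differences. -/
noncomputable def divDiffConst (Q : ℝ[X]) (κ : ℝ) : ℝ :=
  ∑ p ∈ Finset.range (Q.natDegree + 1), |Q.coeff p| *
    ∑ i ∈ Finset.range p, (i * κ ^ i * κ ^ (p - 1 - i))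

/-- Only the left argument is perturbed, so only the powers `A' ^ i - A ^ i` matter, and these are
of order `η`. No symmetry of `A'` is required, which allows `A'` to be a conjugate of `A` by a
non-orthogonal matrix. -/
theorem abs_trace_mul_divDiff_sub_le (Q : ℝ[X]) {A A' B : Matrix ι ι ℝ} {κ η : ℝ} (hκ : 0 ≤ κ)
    (hη : 0 ≤ η) (hA : ∀ X, ‖A * X‖ ≤ κ * ‖X‖) (hA' : ∀ X, ‖A' * X‖ ≤ κ * ‖X‖)
    (hB : ∀ X, ‖B * X‖ ≤ κ * ‖X‖) (hBs : B.IsSymm)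
    (hd : ∀ X, ‖(A' - A) * X‖ ≤ κ * η * ‖X‖) (Y : Matrix ι ι ℝ) :
    |(Yᵀ * divDiff Q A' B Y).trace - (Yᵀ * divDiff Q A B Y).trace|
      ≤ divDiffConst Q κ * η * ‖Y‖ ^ 2 := by
  have e : (Yᵀ * divDiff Q A' B Y).trace - (Yᵀ * divDiff Q A B Y).trace
      = ∑ p ∈ Finset.range (Q.natDegree + 1), Q.coeff p *
        ∑ i ∈ Finset.range p, (Yᵀ * ((A' ^ i - A ^ i) * (Y * B ^ (p - 1 - i)))).trace := by
    rw [← Matrix.trace_sub, ← Matrix.mul_sub, divDiff, divDiff, ← Finset.sum_sub_distrib,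
      Finset.mul_sum, Matrix.trace_sum]
    refine Finset.sum_congr rfl fun p _ => ?_
    rw [← smul_sub, ← Finset.sum_sub_distrib, Matrix.mul_smul, Matrix.trace_smul, smul_eq_mul,
      Finset.mul_sum, Matrix.trace_sum]
    congr 1
    refine Finset.sum_congr rfl fun i _ => ?_
    congr 2
    noncomm_ring
  rw [e, divDiffConst, Finset.sum_mul, Finset.sum_mul]
  refine (Finset.abs_sum_le_sum_abs _ _).trans (Finset.sum_le_sum fun p _ => ?_)
  rw [abs_mul, mul_assoc, mul_assoc]
  refine mul_le_mul_of_nonneg_left ?_ (abs_nonneg _)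
  rw [Finset.sum_mul]
  refine (Finset.abs_sum_le_sum_abs _ _).trans (Finset.sum_le_sum fun i _ => ?_)
  refine (abs_trace_transpose_mul_le _ _).trans ?_
  have h1 := norm_pow_sub_pow_mul_le hκ hη hA hA' hd i (Y * B ^ (p - 1 - i))
  -- The operator bounds are for left multiplication; transposing, with `B` symmetric, gives right
  -- multiplication.
  have h2 : ‖Y * B ^ (p - 1 - i)‖ ≤ κ ^ (p - 1 - i) * ‖Y‖ := by
    have := norm_pow_mul_le hκ hB (p - 1 - i) Yᵀ
    rw [Matrix.frobenius_norm_transpose] at this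
    rw [← Matrix.frobenius_norm_transpose, Matrix.transpose_mul, Matrix.transpose_pow, hBs]
    exact this
  have h3 := h1.trans (mul_le_mul_of_nonneg_left h2 (by positivity))
  calc ‖Y‖ * _ ≤ _ := mul_le_mul_of_nonneg_left h3 (norm_nonneg _)
    _ = _ := by ring

/-- The Combes–Thomas device. With `R` the diagonal matrix of the `ρ v` and `E = A - B`, one has `R
(Q(A) - Q(B)) = divDiff Q A' B (R E)` for `A' = R A R⁻¹`. Since `ρ` varies slowly, `A'` is close to
`A`, for which the divided difference is bounded below. A bond appears at two entries, in the rows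
of its two ends, whence the weights `ρ l ^ 2 + ρ (l + 1) ^ 2`. -/
theorem weighted_bondEntry_monotone {W : ℝ[X]} {m : ℝ}
    (hW : ∀ s t : ℝ, W.eval t + W.derivative.eval t * (s - t) + m / 2 * (s - t) ^ 2 ≤ W.eval s)
    {K η : ℝ} (hK : 0 ≤ K) (hη : 0 ≤ η) (hη1 : η ≤ 1) {N : ℕ} {z z' ρ : ℕ → ℝ}
    (hz : ∀ l < N, |z l| ≤ K) (hz' : ∀ l < N, |z' l| ≤ K) (hρ : ∀ v, 0 < ρ v)
    (hρ1 : ∀ v, |ρ v / ρ (v + 1) - 1| ≤ η) (hρ2 : ∀ v, |ρ (v + 1) / ρ v - 1| ≤ η) :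
    (m - divDiffConst (derivative W) (4 * K) * η) *
        ∑ l ∈ Finset.range N, (ρ l ^ 2 + ρ (l + 1) ^ 2) * (z l - z' l) ^ 2
      ≤ ∑ l ∈ Finset.range N, (ρ l ^ 2 + ρ (l + 1) ^ 2) * ((z l - z' l) *
          (bondEntry (derivative W) N z l - bondEntry (derivative W) N z' l)) := by
  set Q := derivative W with hQdef
  have hQ : ∀ s t : ℝ, m * (s - t) ^ 2 ≤ (s - t) * (Q.eval s - Q.eval t) := fun s t => by
    linarith [hW s t, hW t s, show m / 2 * (t - s) ^ 2 = m / 2 * (s - t) ^ 2 by ring]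
  set A := jacobi N z with hAdef
  set B := jacobi N z' with hBdef
  set E := jacobi N (fun l => z l - z' l) with hEdef
  have hAB : A - B = E := jacobi_sub N z z'
  set R : Matrix (Fin (N + 1)) (Fin (N + 1)) ℝ := diagonal fun u => ρ u with hR
  set A' : Matrix (Fin (N + 1)) (Fin (N + 1)) ℝ :=
    Matrix.of fun u v => ρ u / ρ v * A u v with hA'
  have hRA : R * A = A' * R := by
    ext u v
    rw [hR, Matrix.diagonal_mul, Matrix.mul_diagonal, hA', Matrix.of_apply]
    have := (hρ v).ne'
    field_simp
  have hRApow : ∀ i, R * A ^ i = A' ^ i * R := by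
    intro i
    induction i with
    | zero => simp
    | succ i ih => rw [pow_succ, ← Matrix.mul_assoc, ih, Matrix.mul_assoc, hRA, pow_succ,
        Matrix.mul_assoc]
  have hzero : ∀ (z : ℕ → ℝ) (u v : Fin (N + 1)), (v : ℕ) ≠ u + 1 → (u : ℕ) ≠ v + 1 →
      jacobi N z u v = 0 := by
    intro z u v h1 h2
    simp [jacobi, h1, h2]
  have hbd : ∀ (z : ℕ → ℝ), (∀ l < N, |z l| ≤ K) → ∀ u v, |jacobi N z u v| ≤ K := by
    intro z hz u v
    simp only [jacobi, Matrix.of_apply]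
    split_ifs
    · exact hz _ (by omega)
    · exact hz _ (by omega)
    · simpa using hK
  have hratio : ∀ u v : Fin (N + 1), ((v : ℕ) = u + 1 ∨ (u : ℕ) = v + 1) →
      |ρ u / ρ v - 1| ≤ η := by
    rintro u v (h | h)
    · rw [h]; exact hρ1 _
    · rw [h]; exact hρ2 _
  have hK4 : ∀ X : Matrix (Fin (N + 1)) (Fin (N + 1)) ℝ, 2 * K * ‖X‖ ≤ 4 * K * ‖X‖ := fun X => by
    have := norm_nonneg X
    nlinarith [mul_nonneg hK this]
  have hAn : ∀ X, ‖A * X‖ ≤ 4 * K * ‖X‖ := fun X =>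
    (norm_mul_le_of_tridiagonal hK (hbd z hz) (hzero z) X).trans (hK4 X)
  have hBn : ∀ X, ‖B * X‖ ≤ 4 * K * ‖X‖ := fun X =>
    (norm_mul_le_of_tridiagonal hK (hbd z' hz') (hzero z') X).trans (hK4 X)
  have hdn : ∀ X, ‖(A' - A) * X‖ ≤ 2 * (K * η) * ‖X‖ := by
    refine norm_mul_le_of_tridiagonal (by positivity) (fun u v => ?_) (fun u v h1 h2 => ?_)
    · rw [Matrix.sub_apply, hA', Matrix.of_apply, ← sub_one_mul, abs_mul]
      by_cases h : (v : ℕ) = u + 1 ∨ (u : ℕ) = v + 1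
      · rw [mul_comm]
        exact mul_le_mul (hbd z hz u v) (hratio u v h) (abs_nonneg _) hK
      · push Not at h
        rw [hAdef, hzero z u v h.1 h.2]
        simp; positivity
    · rw [Matrix.sub_apply, hA', Matrix.of_apply, hAdef, hzero z u v h1 h2]; simp
  -- The constant `4 * K` allows `2 * K` for `A` and `2 * K * η ≤ 2 * K` for `A' - A`.
  have hA'n : ∀ X, ‖A' * X‖ ≤ 4 * K * ‖X‖ := fun X => by
    have e : A' * X = (A' - A) * X + A * X := by rw [Matrix.sub_mul]; abel
    have h1 := hdn X
    have h2 := norm_mul_le_of_tridiagonal hK (hbd z hz) (hzero z) X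
    rw [e]
    have h3 := norm_add_le ((A' - A) * X) (A * X)
    have h4 : K * η * ‖X‖ ≤ K * 1 * ‖X‖ := by gcongr
    nlinarith
  have hpert := abs_trace_mul_divDiff_sub_le Q (A := A) (A' := A') (B := B) (κ := 4 * K)
    (by positivity) hη hAn hA'n hBn (jacobi_isSymm N z') (fun X => by
      have := hdn X
      have h0 : 0 ≤ K * η * ‖X‖ := by positivity
      nlinarith) (R * E)
  -- Positivity is available for the symmetric pair `A`, `B` only, but at the weighted argument `R *
  -- E`; `hpert` carries it over to `A'`.
  have hpos := le_trace_mul_divDiff hQ (jacobi_isSymm N z) (jacobi_isSymm N z') (R * E)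
  have hconj : divDiff Q A' B (R * E) = R * (aeval A Q - aeval B Q) := by
    rw [← divDiff_sub, hAB, divDiff, divDiff, Finset.mul_sum]
    refine Finset.sum_congr rfl fun p _ => ?_
    rw [Matrix.mul_smul, Finset.mul_sum]
    congr 1
    refine Finset.sum_congr rfl fun i _ => ?_
    simp only [← Matrix.mul_assoc]
    rw [← hRApow]
  have hnorm : ((R * E)ᵀ * (R * E)).trace
      = ∑ l ∈ Finset.range N, (ρ l ^ 2 + ρ (l + 1) ^ 2) * (z l - z' l) ^ 2 := by
    rw [trace_transpose_mul_eq, ← sum_jacobi_sq N (fun l => z l - z' l) (fun v => ρ v ^ 2)]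
    refine Finset.sum_congr rfl fun u _ => Finset.sum_congr rfl fun v _ => ?_
    rw [hR, Matrix.diagonal_mul]
    ring
  have hnorm2 : ‖R * E‖ ^ 2 = ((R * E)ᵀ * (R * E)).trace := by
    rw [frobenius_norm_sq, trace_transpose_mul_eq]; simp only [sq]
  have hlhs : ((R * E)ᵀ * divDiff Q A' B (R * E)).trace
      = ∑ l ∈ Finset.range N, (ρ l ^ 2 + ρ (l + 1) ^ 2) * ((z l - z' l) *
          (bondEntry Q N z l - bondEntry Q N z' l)) := by
    have h1 := sum_jacobi_mul_aeval Q N (fun l => z l - z' l) z (fun v => ρ v ^ 2)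
    have h2 := sum_jacobi_mul_aeval Q N (fun l => z l - z' l) z' (fun v => ρ v ^ 2)
    have h3 : ∑ l ∈ Finset.range N, (ρ l ^ 2 + ρ (l + 1) ^ 2) * ((z l - z' l) *
          (bondEntry Q N z l - bondEntry Q N z' l))
        = ∑ l ∈ Finset.range N, (ρ l ^ 2 + ρ (l + 1) ^ 2) * ((z l - z' l) * bondEntry Q N z l)
          - ∑ l ∈ Finset.range N,
            (ρ l ^ 2 + ρ (l + 1) ^ 2) * ((z l - z' l) * bondEntry Q N z' l) := by
      rw [← Finset.sum_sub_distrib]; exact Finset.sum_congr rfl fun l _ => by ring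
    rw [h3, hconj, trace_transpose_mul_eq, ← h1, ← h2, ← Finset.sum_sub_distrib]
    refine Finset.sum_congr rfl fun u _ => ?_
    rw [← Finset.sum_sub_distrib]
    refine Finset.sum_congr rfl fun v _ => ?_
    rw [hR, Matrix.diagonal_mul, Matrix.diagonal_mul, Matrix.sub_apply]
    ring
  rw [hlhs, hnorm2, hnorm] at hpert
  rw [hnorm] at hpos
  have := (abs_le.1 hpert).1
  linarith

end Weighted

end HardEdge

namespace HardEdge

open Polynomial Matrix

/-! ### Existence, uniqueness and critical point equations of the minimizer. -/

section Variational

/-- Conjugation by a diagonal matrix of signs: along a walk the signs at the inner vertices cancel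
in pairs and only the two ends remain. -/
theorem walk_mul_sign {Z Z' σ : ℤ → ℝ} (hσ : ∀ s, σ s * σ s = 1)
    (h : ∀ s, Z' s = σ s * σ (s + 1) * Z s) (w : ℤ) (p : ℕ) (v : ℤ) :
    walk Z' w p v = σ v * σ w * walk Z w p v := by
  induction p generalizing v with
  | zero =>
    simp only [walk]
    split_ifs with h
    · rw [h, hσ, one_mul]
    · simp
  | succ p ih =>
    have h1 := h (v - 1)
    rw [sub_add_cancel] at h1
    rw [walk, walk, ih, ih, h, h1]
    linear_combination (σ v * σ w * Z v * walk Z w p (v + 1)) * hσ (v + 1)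
      + (σ v * σ w * Z (v - 1) * walk Z w p (v - 1)) * hσ (v - 1)

theorem walk_continuous {T : Type*} [TopologicalSpace T] {Z : T → ℤ → ℝ}
    (hZ : ∀ s, Continuous fun τ => Z τ s) (w : ℤ) (p : ℕ) (v : ℤ) :
    Continuous fun τ => walk (Z τ) w p v := by
  induction p generalizing v with
  | zero => simp only [walk]; exact continuous_const
  | succ p ih =>
    simp only [walk]
    exact ((hZ _).mul (ih _)).add ((hZ _).mul (ih _))

theorem extend_continuous (N : ℕ) (s : ℤ) : Continuous fun z : ℕ → ℝ => extend N z s := by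
  unfold extend
  split_ifs
  · exact continuous_apply _
  · exact continuous_const

theorem extend_congr {N : ℕ} {z z' : ℕ → ℝ} (h : ∀ l < N, z l = z' l) : extend N z = extend N z' := by
  ext s
  simp only [extend]
  split_ifs with hs
  · exact h _ (by omega)
  · rfl

theorem bondEntry_continuous (Q : ℝ[X]) (N l : ℕ) : Continuous fun z => bondEntry Q N z l := by
  unfold bondEntry
  exact continuous_finsetSum _ fun p _ =>
    continuous_const.mul (walk_continuous (fun s => extend_continuous N s) _ _ _)

theorem energy_eq (W : ℝ[X]) (N : ℕ) (z : ℕ → ℝ) : energy W N z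
    = (∑ u : Fin (N + 1), ∑ p ∈ Finset.range (W.natDegree + 1),
        W.coeff p * walk (extend N z) u p u) / 2 := by
  simp only [energy, Matrix.trace, Matrix.diag_apply, aeval_jacobi_apply]

theorem energy_continuous (W : ℝ[X]) (N : ℕ) : Continuous fun z => energy W N z := by
  simp only [energy_eq]
  exact (continuous_finsetSum _ fun u _ => continuous_finsetSum _ fun p _ =>
    continuous_const.mul (walk_continuous (fun s => extend_continuous N s) _ _ _)).div_const 2

theorem energy_congr (W : ℝ[X]) {N : ℕ} {z z' : ℕ → ℝ} (h : ∀ l < N, z l = z' l) :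
    energy W N z = energy W N z' := by
  rw [energy_eq, energy_eq, extend_congr h]

theorem energy_mul_sign (W : ℝ[X]) {N : ℕ} {z z' : ℕ → ℝ} {σ : ℤ → ℝ} (hσ : ∀ s, σ s * σ s = 1)
    (h : ∀ l < N, z' l = σ l * σ (l + 1) * z l) : energy W N z' = energy W N z := by
  have hZ : ∀ s, extend N z' s = σ s * σ (s + 1) * extend N z s := by
    intro s
    by_cases hs : 0 ≤ s ∧ s < N
    · obtain ⟨l, rfl⟩ := Int.eq_ofNat_of_zero_le hs.1
      have hl : l < N := by omega
      rw [extend_natCast z' hl, extend_natCast z hl, h l hl]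
    · rw [extend, extend, if_neg hs, if_neg hs, mul_zero]
  simp only [energy_eq, walk_mul_sign hσ hZ, hσ, one_mul]

/-- A bond of weight zero cuts the path. Flipping the sign of every vertex to its right changes no
bond weight but reverses the sign of the entry across the cut. -/
theorem bondEntry_eq_zero (Q : ℝ[X]) {N l : ℕ} {z : ℕ → ℝ} (hl : l < N) (h : z l = 0) :
    bondEntry Q N z l = 0 := by
  rw [bondEntry]
  refine Finset.sum_eq_zero fun p _ => ?_
  have := walk_mul_sign (Z := extend N z) (Z' := extend N z)
    (σ := fun s => if s ≤ l then 1 else -1) (fun s => by split_ifs <;> simp)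
    (fun s => by
      rcases lt_trichotomy s l with hs | rfl | hs
      · simp [hs.le, Int.add_one_le_iff.2 hs]
      · rw [extend_natCast z hl, h, mul_zero]
      · have h1 : ¬ s ≤ l := by omega
        have h2 : ¬ s + 1 ≤ l := by omega
        simp [h1, h2]) (l + 1) p l
  simp at this
  have h0 : walk (extend N z) (↑l + 1) p ↑l = 0 := by linarith
  rw [h0, mul_zero]

/-- The Hamiltonian as a function of all the off-diagonal weights. -/
noncomputable def bondHam (W : ℝ[X]) (N : ℕ) (w z : ℕ → ℝ) : ℝ :=
  energy W N z - ∑ l ∈ Finset.range N, w l * Real.log (z l)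

/-- The domain of the Hamiltonian. -/
def bondDomain (N : ℕ) (w z : ℕ → ℝ) : Prop := ∀ l < N, 0 ≤ z l ∧ (w l ≠ 0 → 0 < z l)

/-- A minimizer of the Hamiltonian. -/
def IsBondMinimizer (W : ℝ[X]) (N : ℕ) (w z : ℕ → ℝ) : Prop :=
  bondDomain N w z ∧ ∀ z', bondDomain N w z' → bondHam W N w z ≤ bondHam W N w z'

theorem bondHam_congr (W : ℝ[X]) {N : ℕ} (w : ℕ → ℝ) {z z' : ℕ → ℝ} (h : ∀ l < N, z l = z' l) :
    bondHam W N w z = bondHam W N w z' := by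
  rw [bondHam, bondHam, energy_congr W h]
  congr 1
  exact Finset.sum_congr rfl fun l hl => by rw [h l (Finset.mem_range.1 hl)]

variable {W : ℝ[X]} {m : ℝ}

/-- The critical point equations. They persist at a vanishing coordinate, where the coefficient of
the logarithm is zero and the entry across the cut bond vanishes too. -/
theorem IsBondMinimizer.bondEntry_eq (hm : 0 < m)
    (hW : ∀ s t : ℝ, W.eval t + W.derivative.eval t * (s - t) + m / 2 * (s - t) ^ 2 ≤ W.eval s)
    {N : ℕ} {w z : ℕ → ℝ} (hw : ∀ l < N, 0 ≤ w l) (hz : IsBondMinimizer W N w z) {l : ℕ}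
    (hl : l < N) : bondEntry (derivative W) N z l = w l / z l := by
  rcases eq_or_lt_of_le (hz.1 l hl).1 with h0 | hpos
  · have hwl : w l = 0 := by
      by_contra h
      exact absurd ((hz.1 l hl).2 h) (by rw [← h0]; exact lt_irrefl _)
    rw [bondEntry_eq_zero _ hl h0.symm, hwl, zero_div]
  -- The tangent inequality is taken at the perturbed point instead of at the minimizer. Together
  -- with minimality it gives the sign of the slope there, so that letting `t → 0` from either side
  -- needs only continuity of `bondEntry`.
  have key : ∀ t, -z l < t → 0 ≤ t * (bondEntry (derivative W) N (Function.update z l (z l + t)) l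
      - w l / (z l + t)) := by
    intro t ht
    set z' := Function.update z l (z l + t) with hz'
    have hz'l : z' l = z l + t := by simp [hz']
    have hz'k : ∀ k, k ≠ l → z' k = z k := fun k hk => by simp [hz', hk]
    have hdom : bondDomain N w z' := by
      intro k hk
      by_cases h : k = l
      · rw [h, hz'l]; exact ⟨by linarith, fun _ => by linarith⟩
      · rw [hz'k k h]; exact hz.1 k hk
    have h1 := hz.2 z' hdom
    have h2 := energy_ge hW N z z'
    have e1 : ∑ k ∈ Finset.range N, (z k - z' k) * bondEntry (derivative W) N z' k
        = -t * bondEntry (derivative W) N z' l := by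
      rw [Finset.sum_eq_single l]
      · rw [hz'l]; ring
      · intro k _ hk; rw [hz'k k hk]; ring
      · intro h; exact absurd (Finset.mem_range.2 hl) h
    have e2 : ∑ k ∈ Finset.range N, w k * Real.log (z k)
        - ∑ k ∈ Finset.range N, w k * Real.log (z' k)
        = w l * (Real.log (z l) - Real.log (z l + t)) := by
      rw [← Finset.sum_sub_distrib, Finset.sum_eq_single l]
      · rw [hz'l]; ring
      · intro k _ hk; rw [hz'k k hk]; ring
      · intro h; exact absurd (Finset.mem_range.2 hl) h
    have e3 : 0 ≤ m / 2 * ∑ k ∈ Finset.range N, (z k - z' k) ^ 2 :=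
      mul_nonneg (by positivity) (Finset.sum_nonneg fun _ _ => sq_nonneg _)
    have hp : 0 < z l + t := by linarith
    have h3 : Real.log (z l) - Real.log (z l + t) ≤ -t / (z l + t) := by
      rw [← Real.log_div hpos.ne' hp.ne']
      refine (Real.log_le_sub_one_of_pos (by positivity)).trans (le_of_eq ?_)
      field_simp; ring
    have h4 := mul_le_mul_of_nonneg_left h3 (hw l hl)
    have e5 : w l * (-t / (z l + t)) = -(t * (w l / (z l + t))) := by ring
    rw [bondHam, bondHam] at h1
    rw [mul_sub]
    linarith
  have hcont : ContinuousAt (fun t => bondEntry (derivative W) N (Function.update z l (z l + t)) l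
      - w l / (z l + t)) 0 := by
    refine ContinuousAt.sub ?_ ?_
    · refine ((bondEntry_continuous (derivative W) N l).comp ?_).continuousAt
      exact continuous_const.update l (continuous_const.add continuous_id)
    · exact continuousAt_const.div (continuousAt_const.add continuousAt_id) (by simpa using hpos.ne')
  have hlim := hcont.tendsto
  have hval : bondEntry (derivative W) N (Function.update z l (z l + 0)) l
      - w l / (z l + 0) = bondEntry (derivative W) N z l - w l / z l := by simp
  rw [hval] at hlim
  have hge : 0 ≤ bondEntry (derivative W) N z l - w l / z l := by
    refine ge_of_tendsto (hlim.mono_left (nhdsWithin_le_nhds (s := Set.Ioi 0))) ?_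
    filter_upwards [self_mem_nhdsWithin] with t ht
    exact nonneg_of_mul_nonneg_right (key t (by linarith [Set.mem_Ioi.1 ht])) ht
  have hle : bondEntry (derivative W) N z l - w l / z l ≤ 0 := by
    refine le_of_tendsto (hlim.mono_left (nhdsWithin_le_nhds (s := Set.Iio 0))) ?_
    filter_upwards [self_mem_nhdsWithin, nhdsWithin_le_nhds (lt_mem_nhds (neg_lt_zero.2 hpos))]
      with t ht ht'
    by_contra hcon
    exact absurd (key t ht') (not_le.2 (mul_neg_of_neg_of_pos ht (not_le.1 hcon)))
  linarith

theorem sub_mul_div_sub_div_nonpos {w s t : ℝ} (hw : 0 ≤ w) (hs : w ≠ 0 → 0 < s)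
    (ht : w ≠ 0 → 0 < t) : (s - t) * (w / s - w / t) ≤ 0 := by
  by_cases h : w = 0
  · simp [h]
  have hs := hs h
  have ht := ht h
  have e : (s - t) * (w / s - w / t) = -(w * (s - t) ^ 2 / (s * t)) := by
    field_simp; ring
  rw [e]
  have : 0 ≤ w * (s - t) ^ 2 / (s * t) := by positivity
  linarith

/-- Two solutions of the critical point equations: the left side is strongly monotone, while `w / z`
is decreasing in `z`. -/
theorem IsBondMinimizer.unique (hm : 0 < m)
    (hW : ∀ s t : ℝ, W.eval t + W.derivative.eval t * (s - t) + m / 2 * (s - t) ^ 2 ≤ W.eval s)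
    {N : ℕ} {w z z' : ℕ → ℝ} (hw : ∀ l < N, 0 ≤ w l) (hz : IsBondMinimizer W N w z)
    (hz' : IsBondMinimizer W N w z') : ∀ l < N, z l = z' l := by
  have h := bondEntry_monotone hW N z z'
  have h2 : ∑ l ∈ Finset.range N, (z l - z' l) * (bondEntry (derivative W) N z l
      - bondEntry (derivative W) N z' l) ≤ 0 := by
    refine Finset.sum_nonpos fun l hl => ?_
    have hl := Finset.mem_range.1 hl
    rw [hz.bondEntry_eq hm hW hw hl, hz'.bondEntry_eq hm hW hw hl]
    exact sub_mul_div_sub_div_nonpos (hw l hl) (hz.1 l hl).2 (hz'.1 l hl).2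
  have h3 : ∑ l ∈ Finset.range N, (z l - z' l) ^ 2 ≤ 0 :=
    nonpos_of_mul_nonpos_right (h.trans h2) hm
  intro l hl
  have h4 := (Finset.sum_eq_zero_iff_of_nonneg (fun l _ => sq_nonneg (z l - z' l))).1
    (le_antisymm h3 (Finset.sum_nonneg fun _ _ => sq_nonneg _)) l (Finset.mem_range.2 hl)
  exact sub_eq_zero.1 (pow_eq_zero_iff (two_ne_zero) |>.1 h4)

/-- The energy grows quadratically and beats the logarithms, while a logarithm with positive
coefficient keeps its coordinate away from zero. A sublevel set thus lies in a compact box on which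
the Hamiltonian is continuous. -/
theorem exists_isBondMinimizer (hm : 0 < m)
    (hW : ∀ s t : ℝ, W.eval t + W.derivative.eval t * (s - t) + m / 2 * (s - t) ^ 2 ≤ W.eval s)
    {N : ℕ} {w : ℕ → ℝ} (hw : ∀ l < N, 0 ≤ w l) : ∃ z, IsBondMinimizer W N w z := by
  set E := energy W N (fun _ => 0) with hE
  have hlow : ∀ z, E + m / 2 * ∑ l ∈ Finset.range N, z l ^ 2 ≤ energy W N z := by
    intro z
    have h := energy_ge hW N z (fun _ => 0)
    have h0 : ∑ l ∈ Finset.range N, (z l - 0) * bondEntry (derivative W) N (fun _ => 0) l = 0 :=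
      Finset.sum_eq_zero fun l hl => by
        rw [bondEntry_eq_zero _ (Finset.mem_range.1 hl) rfl, mul_zero]
    rw [h0] at h
    simp only [sub_zero, add_zero] at h
    exact h
  -- From `log s ≤ s` and Young's inequality; half of the quadratic growth is kept.
  have hterm : ∀ l < N, ∀ s : ℝ, 0 ≤ s → m / 4 * s ^ 2 - w l ^ 2 / m ≤
      m / 2 * s ^ 2 - w l * Real.log s := by
    intro l hl s hs
    have h1 : Real.log s ≤ s := (Real.log_le_self hs)
    have h2 := mul_le_mul_of_nonneg_left h1 (hw l hl)
    have h3 : w l * s ≤ m / 4 * s ^ 2 + w l ^ 2 / m := by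
      have : 0 ≤ (m * s / 2 - w l) ^ 2 / m := by positivity
      have e : (m * s / 2 - w l) ^ 2 / m = m / 4 * s ^ 2 + w l ^ 2 / m - w l * s := by
        field_simp; ring
      linarith
    linarith
  set one : ℕ → ℝ := fun _ => 1 with hone
  set H1 := bondHam W N w one with hH1
  set Λ := H1 - E + ∑ l ∈ Finset.range N, w l ^ 2 / m with hΛ
  have hbox : ∀ z, bondDomain N w z → bondHam W N w z ≤ H1 → ∀ l < N,
      m / 2 * z l ^ 2 - w l * Real.log (z l) ≤ Λ := by
    intro z hz hH l hl
    have h1 := hlow z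
    have h2 : ∑ k ∈ Finset.range N, (m / 2 * z k ^ 2 - w k * Real.log (z k) + w k ^ 2 / m) ≤ Λ := by
      rw [Finset.sum_add_distrib, Finset.sum_sub_distrib, ← Finset.mul_sum]
      rw [bondHam] at hH
      linarith
    have h3 := Finset.single_le_sum
      (f := fun k => m / 2 * z k ^ 2 - w k * Real.log (z k) + w k ^ 2 / m)
      (fun k hk => by
        have := hterm k (Finset.mem_range.1 hk) (z k) (hz k (Finset.mem_range.1 hk)).1
        have h0 : 0 ≤ m / 4 * z k ^ 2 := by positivity
        linarith) (Finset.mem_range.2 hl)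
    have h4 : 0 ≤ w l ^ 2 / m := by positivity
    linarith
  -- A coordinate whose logarithm has coefficient zero may reach the boundary of the orthant.
  set δ : ℕ → ℝ := fun l => if w l = 0 then 0 else Real.exp (-Λ / w l) with hδ
  set R : ℕ → ℝ := fun l => 1 + 4 / m * (Λ + w l ^ 2 / m) with hR
  -- The irrelevant coordinates `l ≥ N` are frozen at `1`, so that the infinite product is compact.
  set B : ℕ → Set ℝ := fun l => if l < N then Set.Icc (δ l) (R l) else {1} with hB
  have hcomp : IsCompact (Set.univ.pi B) := by
    refine isCompact_univ_pi fun l => ?_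
    simp only [hB]
    split_ifs
    · exact isCompact_Icc
    · exact isCompact_singleton
  have hmem : ∀ z, bondDomain N w z → bondHam W N w z ≤ H1 →
      (fun l => if l < N then z l else 1) ∈ Set.univ.pi B := by
    intro z hz hH l _
    simp only [hB]
    split_ifs with hl
    · have h1 := hbox z hz hH l hl
      constructor
      · simp only [hδ]
        split_ifs with h0
        · exact (hz l hl).1
        · have hwl : 0 < w l := lt_of_le_of_ne (hw l hl) (Ne.symm h0)
          have hzl := (hz l hl).2 h0
          rw [← Real.le_log_iff_exp_le hzl, div_le_iff₀ hwl]
          have : 0 ≤ m / 2 * z l ^ 2 := by positivity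
          linarith
      · have h2 := hterm l hl (z l) (hz l hl).1
        have h3 : z l ^ 2 ≤ 4 / m * (Λ + w l ^ 2 / m) := by
          rw [div_mul_eq_mul_div, le_div_iff₀ hm]
          linarith
        simp only [hR]
        nlinarith [sq_nonneg (z l - 1)]
    · rfl
  have hone_dom : bondDomain N w one := fun l _ => ⟨zero_le_one, fun _ => one_pos⟩
  have hne : (Set.univ.pi B).Nonempty := ⟨_, hmem one hone_dom le_rfl⟩
  have hBdom : ∀ z ∈ Set.univ.pi B, bondDomain N w z := by
    intro z hz l hl
    have := hz l (Set.mem_univ l)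
    simp only [hB, if_pos hl] at this
    have h1 := this.1
    simp only [hδ] at h1
    split_ifs at h1 with h0
    · exact ⟨h1, fun h => absurd h0 h⟩
    · have := (Real.exp_pos (-Λ / w l)).trans_le h1
      exact ⟨this.le, fun _ => this⟩
  have hcont : ContinuousOn (bondHam W N w) (Set.univ.pi B) := by
    refine (energy_continuous W N).continuousOn.sub (continuousOn_finsetSum _ fun l hl => ?_)
    by_cases h0 : w l = 0
    · simp only [h0, zero_mul]; exact continuousOn_const
    · refine continuousOn_const.mul (ContinuousOn.log (continuous_apply l).continuousOn ?_)
      intro z hz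
      exact ((hBdom z hz l (Finset.mem_range.1 hl)).2 h0).ne'
  obtain ⟨z, hzB, hzmin⟩ := hcomp.exists_isMinOn hne hcont
  refine ⟨z, hBdom z hzB, fun z' hz' => ?_⟩
  have htr : ∀ z', bondHam W N w (fun l => if l < N then z' l else 1) = bondHam W N w z' :=
    fun z' => bondHam_congr W w fun l hl => if_pos hl
  by_cases h : bondHam W N w z' ≤ H1
  · have := hzmin (hmem z' hz' h)
    rw [Set.mem_ofPred_eq, htr] at this
    exact this
  · have := hzmin (hmem one hone_dom le_rfl)
    rw [Set.mem_ofPred_eq, htr] at this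
    exact this.trans (not_le.1 h).le

end Variational

end HardEdge

namespace HardEdge

open Polynomial Matrix

/-! ### From the bidiagonal matrix to a path with alternating weights. -/

section Translation

/-- The weights `x 1, y 1, x 2, y 2, …` of the consecutive bonds. -/
def interlace (x y : ℕ → ℝ) (l : ℕ) : ℝ := if l % 2 = 0 then x (l / 2 + 1) else y (l / 2 + 1)

theorem interlace_even (x y : ℕ → ℝ) {k : ℕ} (hk : 1 ≤ k) : interlace x y (2 * k - 2) = x k := by
  rw [interlace, if_pos (by omega)]; congr 1; omega

theorem interlace_odd (x y : ℕ → ℝ) {k : ℕ} (hk : 1 ≤ k) : interlace x y (2 * k - 1) = y k := by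
  rw [interlace, if_neg (by omega)]; congr 1; omega

theorem sum_interlace (n : ℕ) (hn : 1 ≤ n) (f : ℕ → ℝ) :
    ∑ l ∈ Finset.range (2 * n - 1), f l = ∑ k ∈ Finset.Icc 1 n, f (2 * k - 2)
      + ∑ k ∈ Finset.Icc 1 (n - 1), f (2 * k - 1) := by
  induction n, hn using Nat.le_induction with
  | base => simp
  | succ n hn ih =>
    have e : 2 * (n + 1) - 1 = 2 * n - 1 + 1 + 1 := by omega
    rw [e, Finset.sum_range_succ, Finset.sum_range_succ, ih, Finset.sum_Icc_succ_top (by omega)]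
    have e2 : n + 1 - 1 = n - 1 + 1 := by omega
    rw [e2, Finset.sum_Icc_succ_top (by omega)]
    have e3 : 2 * (n + 1) - 2 = 2 * n - 1 + 1 := by omega
    have e4 : 2 * (n - 1 + 1) - 1 = 2 * n - 1 := by omega
    rw [e3, e4]
    ring

theorem trace_aeval_submatrix {ι κ : Type*} [Fintype ι] [DecidableEq ι] [Fintype κ]
    [DecidableEq κ] (e : ι ≃ κ) (A : Matrix κ κ ℝ) (p : ℝ[X]) :
    (aeval (A.submatrix e e) p).trace = (aeval A p).trace := by
  have h := Polynomial.aeval_algHom_apply (Matrix.reindexAlgEquiv ℝ ℝ e.symm) A p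
  have h2 : (Matrix.reindexAlgEquiv ℝ ℝ e.symm) A = A.submatrix e e := by
    ext i j; simp
  rw [h2] at h
  rw [h]
  simp [Matrix.trace]
  exact Equiv.sum_comp e (fun i => aeval A p i i)

/-- The block matrix squares to the block diagonal of `B * Bᵀ` and `Bᵀ * B`, whose powers have equal
traces; this is the origin of the factor `2`. -/
theorem trace_aeval_fromBlocks {ι : Type*} [Fintype ι] [DecidableEq ι] (B : Matrix ι ι ℝ)
    (V : ℝ[X]) : (aeval (fromBlocks 0 B Bᵀ 0) (V.comp (X ^ 2))).trace
      = 2 * (aeval (B * Bᵀ) V).trace := by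
  have h2 : (fromBlocks 0 B Bᵀ 0 : Matrix (ι ⊕ ι) (ι ⊕ ι) ℝ) ^ 2
      = fromBlocks (B * Bᵀ) 0 0 (Bᵀ * B) := by
    rw [sq, Matrix.fromBlocks_multiply]; simp
  rw [aeval_comp, map_pow, aeval_X, h2, aeval_eq_sum_range, aeval_eq_sum_range, Matrix.trace_sum,
    Matrix.trace_sum, Finset.mul_sum]
  refine Finset.sum_congr rfl fun p _ => ?_
  have htr : ∀ C D : Matrix ι ι ℝ, (fromBlocks C 0 0 D).trace = C.trace + D.trace := fun C D => by
    simp [Matrix.trace, Fintype.sum_sum_type]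
  rw [Matrix.trace_smul, Matrix.trace_smul, Matrix.fromBlocks_diagonal_pow, htr]
  have : ((Bᵀ * B) ^ p).trace = ((B * Bᵀ) ^ p).trace := by
    cases p with
    | zero => simp
    | succ p =>
      have : ∀ p, B * (Bᵀ * B) ^ p = (B * Bᵀ) ^ p * B := by
        intro p
        induction p with
        | zero => simp
        | succ p ih => rw [pow_succ, ← Matrix.mul_assoc, ih, pow_succ]; simp only [Matrix.mul_assoc]
      rw [pow_succ', Matrix.mul_assoc, this, Matrix.trace_mul_comm, Matrix.mul_assoc, ← pow_succ]
  rw [this, smul_eq_mul, smul_eq_mul]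
  ring

/-- The vertex of the path belonging to a row or a column of the bidiagonal matrix. -/
def vertexFun (n : ℕ) : Fin n ⊕ Fin n → Fin (2 * n - 1 + 1)
  | Sum.inl i => ⟨2 * i, by omega⟩
  | Sum.inr i => ⟨2 * i + 1, by omega⟩

theorem vertexFun_bijective {n : ℕ} (hn : 1 ≤ n) : Function.Bijective (vertexFun n) := by
  rw [Fintype.bijective_iff_injective_and_card]
  constructor
  · rintro (i | i) (j | j) h <;> simp [vertexFun, Fin.ext_iff] at h ⊢ <;> omega
  · simp; omega

/-- The path is bipartite. With the rows of `B` at the even and its columns at the odd vertices, the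
Jacobi matrix is the block matrix with off-diagonal blocks `B` and `Bᵀ`. -/
theorem trace_bidiag (V : ℝ[X]) {n : ℕ} (hn : 1 ≤ n) (x y : ℕ → ℝ) :
    (aeval (bidiag n x y * (bidiag n x y).transpose) V).trace
      = energy (V.comp (X ^ 2)) (2 * n - 1) (interlace x y) := by
  -- Vertex signs `+ + - -`, repeated with period four, reverse exactly the odd bonds, which carry
  -- the weights `y`.
  have hs : energy (V.comp (X ^ 2)) (2 * n - 1) (interlace x fun k => -y k)
      = energy (V.comp (X ^ 2)) (2 * n - 1) (interlace x y) := by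
    refine energy_mul_sign (σ := fun s => if s % 4 < 2 then 1 else -1) _
      (fun s => by split_ifs <;> simp) (fun l _ => ?_)
    simp only [interlace]
    split_ifs <;> first | omega | simp
  have hb : (jacobi (2 * n - 1) (interlace x fun k => -y k)).submatrix
      (Equiv.ofBijective _ (vertexFun_bijective hn)) (Equiv.ofBijective _ (vertexFun_bijective hn))
      = fromBlocks 0 (bidiag n x y) (bidiag n x y)ᵀ 0 := by
    have h0 : ∀ i j : Fin n, jacobi (2 * n - 1) (interlace x fun k => -y k)
        ⟨2 * i, by omega⟩ ⟨2 * j + 1, by omega⟩ = bidiag n x y i j := by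
      intro i j
      simp only [jacobi, bidiag, Matrix.of_apply, interlace, Fin.ext_iff]
      by_cases h1 : (i : ℕ) = j
      · simp [h1]
      · by_cases h2 : (i : ℕ) = j + 1
        · have e : (2 * (j : ℕ) + 1) / 2 = j := by omega
          simp [h2, e]
          omega
        · rw [if_neg (by omega), if_neg (by omega), if_neg h1, if_neg h2]
    ext (i | i) (j | j)
    · simp [vertexFun, jacobi]
      rw [if_neg (by omega), if_neg (by omega)]
    · simpa [vertexFun] using h0 i j
    · have h1 := (jacobi_isSymm (2 * n - 1) (interlace x fun k => -y k)).apply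
        (⟨2 * j, by omega⟩) (⟨2 * i + 1, by omega⟩)
      rw [h0 j i] at h1
      simpa [vertexFun] using h1
    · simp [vertexFun, jacobi]
      rw [if_neg (by omega), if_neg (by omega)]
  rw [← hs, energy, ← trace_aeval_submatrix (Equiv.ofBijective _ (vertexFun_bijective hn)), hb,
    trace_aeval_fromBlocks]
  ring

/-- The coefficients of the logarithms of all the weights. -/
noncomputable def bondWeight (β a : ℝ) (n : ℕ) : ℕ → ℝ := interlace (xWeight β a n) (yWeight β n)

theorem hamiltonian_eq (V : ℝ[X]) (β a : ℝ) {n : ℕ} (hn : 1 ≤ n) (x y : ℕ → ℝ) :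
    hamiltonian V β a n x y
      = bondHam (V.comp (X ^ 2)) (2 * n - 1) (bondWeight β a n) (interlace x y) := by
  rw [hamiltonian, bondHam, trace_bidiag V hn, sum_interlace n hn, sub_sub]
  congr 2
  · refine Finset.sum_congr rfl fun k hk => ?_
    rw [bondWeight, interlace_even _ _ (Finset.mem_Icc.1 hk).1,
      interlace_even _ _ (Finset.mem_Icc.1 hk).1]
  · refine Finset.sum_congr rfl fun k hk => ?_
    rw [bondWeight, interlace_odd _ _ (Finset.mem_Icc.1 hk).1,
      interlace_odd _ _ (Finset.mem_Icc.1 hk).1]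

theorem hamiltonianDomain_iff (β a : ℝ) {n : ℕ} (x y : ℕ → ℝ) :
    hamiltonianDomain β a n x y ↔ bondDomain (2 * n - 1) (bondWeight β a n) (interlace x y) := by
  constructor
  · rintro ⟨h1, h2⟩ l hl
    rcases Nat.even_or_odd' l with ⟨k, rfl | rfl⟩
    · have := h1 (k + 1) (Finset.mem_Icc.2 ⟨by omega, by omega⟩)
      rw [bondWeight, ← interlace_even x y (by omega),
        ← interlace_even (xWeight β a n) (yWeight β n) (by omega)] at *
      exact this
    · have := h2 (k + 1) (Finset.mem_Icc.2 ⟨by omega, by omega⟩)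
      rw [bondWeight, ← interlace_odd x y (by omega),
        ← interlace_odd (xWeight β a n) (yWeight β n) (by omega)] at *
      exact this
  · intro h
    constructor
    · intro k hk
      obtain ⟨hk1, hk2⟩ := Finset.mem_Icc.1 hk
      have := h (2 * k - 2) (by omega)
      rwa [bondWeight, interlace_even _ _ hk1, interlace_even _ _ hk1] at this
    · intro k hk
      obtain ⟨hk1, hk2⟩ := Finset.mem_Icc.1 hk
      have := h (2 * k - 1) (by omega)
      rwa [bondWeight, interlace_odd _ _ hk1, interlace_odd _ _ hk1] at this

theorem exists_interlace_eq (z : ℕ → ℝ) : ∃ x y, interlace x y = z := by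
  refine ⟨fun k => z (2 * k - 2), fun k => z (2 * k - 1), ?_⟩
  ext l
  simp only [interlace]
  split_ifs <;> congr 1 <;> omega

theorem isHamiltonianMinimizer_iff (V : ℝ[X]) (β a : ℝ) {n : ℕ} (hn : 1 ≤ n) (x y : ℕ → ℝ) :
    IsHamiltonianMinimizer V β a n x y
      ↔ IsBondMinimizer (V.comp (X ^ 2)) (2 * n - 1) (bondWeight β a n) (interlace x y) := by
  rw [IsHamiltonianMinimizer, IsBondMinimizer, hamiltonianDomain_iff]
  refine and_congr_right fun _ => ⟨fun h z hz => ?_, fun h x' y' h' => ?_⟩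
  · obtain ⟨x', y', rfl⟩ := exists_interlace_eq z
    rw [← hamiltonian_eq V β a hn, ← hamiltonian_eq V β a hn]
    exact h x' y' ((hamiltonianDomain_iff β a x' y').2 hz)
  · rw [hamiltonian_eq V β a hn, hamiltonian_eq V β a hn]
    exact h _ ((hamiltonianDomain_iff β a x' y').1 h')

/-- The critical coefficients are those with `k = 1`, namely `(1 + a - 1 / β) / n` and `(1 - 1 / β)
/ n`. -/
theorem bondWeight_nonneg {β a : ℝ} (hβ : 1 ≤ β) (ha : 1 / β ≤ 1 + a) (n l : ℕ) :
    0 ≤ bondWeight β a n l := by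
  have hb : 1 / β ≤ 1 := by rw [div_le_one (by linarith)]; exact hβ
  rcases Nat.eq_zero_or_pos n with rfl | hn
  · simp [bondWeight, interlace, xWeight, yWeight]
  have hn' : (0 : ℝ) < n := by exact_mod_cast hn
  have hk : (1 : ℝ) ≤ ((l / 2 + 1 : ℕ) : ℝ) := by exact_mod_cast Nat.le_add_left 1 _
  simp only [bondWeight, interlace, xWeight, yWeight]
  split_ifs
  · have : ((l / 2 + 1 : ℕ) : ℝ) / n + a / n - 1 / (n * β)
        = (((l / 2 + 1 : ℕ) : ℝ) + a - 1 / β) / n := by field_simp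
    rw [this]
    exact div_nonneg (by linarith) hn'.le
  · have : ((l / 2 + 1 : ℕ) : ℝ) / n - 1 / (n * β)
        = (((l / 2 + 1 : ℕ) : ℝ) - 1 / β) / n := by field_simp
    rw [this]
    exact div_nonneg (by linarith) hn'.le

end Translation

end HardEdge

namespace HardEdge

open Polynomial

/-! ### The coarse minimizer `φ`, its derivative and the integral of `1 / φ`. -/

section Coarse

/-- The polynomial `∑ m (2m choose m) g_m q^m`. -/
noncomputable def coarse (V : ℝ[X]) : ℝ[X] :=
  ∑ m ∈ Finset.Icc 1 V.natDegree, C ((m : ℝ) * (Nat.choose (2 * m) m : ℝ) * V.coeff m) * X ^ m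

theorem coarse_eval (V : ℝ[X]) (q : ℝ) : (coarse V).eval q
    = ∑ m ∈ Finset.Icc 1 V.natDegree, (m : ℝ) * (Nat.choose (2 * m) m : ℝ) * V.coeff m * q ^ m := by
  simp [coarse, eval_finsetSum]

theorem coarse_derivative_eval (V : ℝ[X]) (q : ℝ) : (derivative (coarse V)).eval q
    = ∑ m ∈ Finset.Icc 1 V.natDegree,
      (m : ℝ) * (Nat.choose (2 * m) m : ℝ) * V.coeff m * (m * q ^ (m - 1)) := by
  simp [coarse, eval_finsetSum, derivative_X_pow]

/-- Wallis' formula: it turns the central binomial coefficients of `coarse` into averages over an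
angle. -/
theorem integral_two_sin_pow (m : ℕ) :
    ∫ x in (0 : ℝ)..Real.pi, Real.sin x ^ (2 * m)
      = Real.pi * ((Nat.choose (2 * m) m : ℝ) / 4 ^ m) := by
  rw [integral_sin_pow_even]
  congr 1
  induction m with
  | zero => simp
  | succ m ih =>
    rw [Finset.prod_range_succ, ih]
    have h := Nat.succ_mul_centralBinom_succ m
    simp only [Nat.centralBinom] at h
    have h' : ((m : ℝ) + 1) * (Nat.choose (2 * (m + 1)) (m + 1) : ℝ)
        = 2 * (2 * m + 1) * (Nat.choose (2 * m) m : ℝ) := by exact_mod_cast h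
    have h1 : (m : ℝ) + 1 ≠ 0 := by positivity
    rw [pow_succ]
    field_simp
    linear_combination -2 * h'

theorem sq_derivative_eval (V : ℝ[X]) (u : ℝ) :
    (V.comp (X ^ 2)).derivative.eval u = 2 * u * V.derivative.eval (u ^ 2) := by
  simp [derivative_comp]
  norm_num

/-- On the diagonal the divided difference is the derivative. -/
theorem le_eval_derivative_of_monotone {Q : ℝ[X]} {m : ℝ}
    (hQ : ∀ s t : ℝ, m * (s - t) ^ 2 ≤ (s - t) * (Q.eval s - Q.eval t)) (t : ℝ) :
    m ≤ Q.derivative.eval t := by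
  have h := le_scalar_divDiff hQ t t
  rw [derivative_eval, sum_over_range _ (by simp)]
  convert h using 2 with p
  rw [Finset.sum_congr rfl (g := fun _ => t ^ (p - 1)) fun i hi => by
    rw [← pow_add]; congr 1; have := Finset.mem_range.1 hi; omega]
  rw [Finset.sum_const, Finset.card_range, nsmul_eq_mul]
  ring

variable {V : ℝ[X]} {m : ℝ}

/-- The hypothesis on the potential in the form in which it is used. -/
def Tangent (V : ℝ[X]) (m : ℝ) : Prop := ∀ s t : ℝ, (V.comp (X ^ 2)).eval t
      + (V.comp (X ^ 2)).derivative.eval t * (s - t) + m / 2 * (s - t) ^ 2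
        ≤ (V.comp (X ^ 2)).eval s

theorem Tangent.monotone (hW : Tangent V m) (s t : ℝ) : m * (s - t) ^ 2 ≤ (s - t) *
    ((V.comp (X ^ 2)).derivative.eval s - (V.comp (X ^ 2)).derivative.eval t) := by
  linarith [hW s t, hW t s, show m / 2 * (t - s) ^ 2 = m / 2 * (s - t) ^ 2 by ring]

/-- At `s = u²` the second derivative of `V(u²)` gives `2 V'(s) + 4 s V''(s) ≥ m`, and comparing its
first derivatives at `u` and `0` gives `V'(s) ≥ m / 2`. The claim is a combination of the two. -/
theorem Tangent.le_eval (hW : Tangent V m) {s : ℝ} (hs : 0 ≤ s) :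
    m / 2 ≤ V.derivative.eval s + s * V.derivative.derivative.eval s := by
  obtain ⟨u, hu⟩ : ∃ u, u = Real.sqrt s := ⟨_, rfl⟩
  have hsu : s = u ^ 2 := by rw [hu, Real.sq_sqrt hs]
  rw [hsu]
  have h1 := le_eval_derivative_of_monotone hW.monotone u
  have h2 : (V.comp (X ^ 2)).derivative.derivative.eval u
      = 2 * V.derivative.eval (u ^ 2) + 4 * u ^ 2 * V.derivative.derivative.eval (u ^ 2) := by
    simp [derivative_comp]
    ring
  rw [h2] at h1
  have h3 : m / 2 ≤ V.derivative.eval (u ^ 2) := by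
    by_cases h0 : u = 0
    · rw [h0] at h1 ⊢; norm_num at h1 ⊢; linarith
    · have h4 := hW.monotone u 0
      rw [sq_derivative_eval, sq_derivative_eval] at h4
      have : 0 < u ^ 2 := by positivity
      nlinarith
  linarith

/-- With `K(s) = s V'(s)`, the polynomial `coarse V` at `q` is the average of `K(4 q sin² x)` over
an angle. Differentiating, its slope is the average of `4 sin² x * K'`, where `K' ≥ m / 2` by
`Tangent.le_eval` and `4 sin² x` has average `2`. Thus `φ` is well defined although `V` may have
negative coefficients. -/
theorem Tangent.le_coarse_derivative (hW : Tangent V m) {q : ℝ} (hq : 0 ≤ q) :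
    m ≤ (coarse V).derivative.eval q := by
  set K : ℝ[X] := X * V.derivative with hK
  have hKd : ∀ s, K.derivative.eval s = V.derivative.eval s + s * V.derivative.derivative.eval s := by
    intro s; simp [hK]
  have hKs : ∀ s, K.derivative.eval s
      = ∑ j ∈ Finset.Icc 1 V.natDegree, (j : ℝ) * V.coeff j * (j * s ^ (j - 1)) := by
    intro s
    have : K = ∑ j ∈ Finset.Icc 1 V.natDegree, C ((j : ℝ) * V.coeff j) * X ^ j := by
      conv_lhs => rw [hK, V.as_sum_range_C_mul_X_pow]
      rw [derivative_sum, Finset.mul_sum, Finset.range_eq_Ico,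
        Finset.sum_eq_sum_Ico_succ_bot (by omega)]
      simp only [pow_zero, mul_one, derivative_C, mul_zero, zero_add]
      refine Finset.sum_congr (by ext; simp) fun j hj => ?_
      have : 1 ≤ j := (Finset.mem_Icc.1 hj).1
      obtain ⟨i, rfl⟩ := Nat.exists_eq_add_of_le' this
      simp [derivative_mul]
      ring
    rw [this]
    simp [eval_finsetSum, derivative_X_pow]
  have hint : ∫ x in (0 : ℝ)..Real.pi,
      4 * Real.sin x ^ 2 * K.derivative.eval (4 * q * Real.sin x ^ 2)
        = Real.pi * (coarse V).derivative.eval q := by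
    have e : ∀ x : ℝ, 4 * Real.sin x ^ 2 * K.derivative.eval (4 * q * Real.sin x ^ 2)
        = ∑ j ∈ Finset.Icc 1 V.natDegree,
          ((j : ℝ) * V.coeff j * (j * q ^ (j - 1)) * 4 ^ j) * Real.sin x ^ (2 * j) := by
      intro x
      rw [hKs, Finset.mul_sum]
      refine Finset.sum_congr rfl fun j hj => ?_
      have : 1 ≤ j := (Finset.mem_Icc.1 hj).1
      obtain ⟨i, rfl⟩ := Nat.exists_eq_add_of_le' this
      simp only [add_tsub_cancel_right, mul_pow, pow_succ, pow_mul]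
      ring
    simp only [e]
    rw [intervalIntegral.integral_finsetSum fun j _ =>
      (Continuous.intervalIntegrable (by fun_prop) _ _), coarse_derivative_eval, Finset.mul_sum]
    refine Finset.sum_congr rfl fun j _ => ?_
    rw [intervalIntegral.integral_const_mul, integral_two_sin_pow]
    field_simp
  have hlow : ∫ x in (0 : ℝ)..Real.pi, 4 * Real.sin x ^ 2 * (m / 2) = Real.pi * m := by
    have := integral_two_sin_pow 1
    norm_num at this
    rw [intervalIntegral.integral_mul_const, intervalIntegral.integral_const_mul]
    norm_num
    rw [this]
    ring
  have hle : Real.pi * m ≤ Real.pi * (coarse V).derivative.eval q := by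
    rw [← hlow, ← hint]
    refine intervalIntegral.integral_mono_on Real.pi_pos.le
      (Continuous.intervalIntegrable (by fun_prop) _ _)
      (Continuous.intervalIntegrable (by fun_prop) _ _) fun x _ => ?_
    refine mul_le_mul_of_nonneg_left ?_ (by positivity)
    rw [hKd]
    exact hW.le_eval (by positivity)
  exact le_of_mul_le_mul_left hle Real.pi_pos

theorem Tangent.mul_sub_le_coarse (hW : Tangent V m) {q q' : ℝ} (hq : 0 ≤ q) (hqq : q ≤ q') :
    m * (q' - q) ≤ (coarse V).eval q' - (coarse V).eval q := by
  refine (convex_Ici (0 : ℝ)).mul_sub_le_image_sub_of_le_deriv (coarse V).continuousOn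
    (coarse V).differentiable.differentiableOn (fun x hx => ?_) q hq q' (hq.trans hqq) hqq
  rw [Polynomial.deriv]
  exact hW.le_coarse_derivative (interior_subset hx)

theorem coarse_eval_zero (V : ℝ[X]) : (coarse V).eval 0 = 0 := by
  rw [coarse_eval]
  refine Finset.sum_eq_zero fun j hj => ?_
  have : 1 ≤ j := (Finset.mem_Icc.1 hj).1
  rw [zero_pow (by omega), mul_zero]

/-- Strict monotonicity of `coarse V` gives uniqueness and its linear growth, with the intermediate
value theorem on `[0, t / m]`, existence; the infimum defining `phi` is then over a singleton. -/
theorem Tangent.phi_spec (hm : 0 < m) (hW : Tangent V m) {t : ℝ} (ht : 0 ≤ t) :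
    0 ≤ phi V t ∧ (coarse V).eval (phi V t ^ 2) = t := by
  have hinj : ∀ r r' : ℝ, 0 ≤ r → 0 ≤ r' → (coarse V).eval (r ^ 2) = (coarse V).eval (r' ^ 2) →
      r = r' := by
    have aux : ∀ r r' : ℝ, 0 ≤ r → r ≤ r' → (coarse V).eval (r ^ 2) = (coarse V).eval (r' ^ 2) →
        r = r' := by
      intro r r' hr hrr h
      have h1 := hW.mul_sub_le_coarse (sq_nonneg r) (pow_le_pow_left₀ hr hrr 2)
      rw [h, sub_self] at h1
      have h2 : r' ^ 2 - r ^ 2 ≤ 0 := nonpos_of_mul_nonpos_right h1 hm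
      exact le_antisymm hrr (abs_le_of_sq_le_sq' (by linarith) hr).2
    intro r r' hr hr' h
    rcases le_total r r' with h1 | h1
    · exact aux r r' hr h1 h
    · exact (aux r' r hr' h1 h.symm).symm
  obtain ⟨r, hr0, hr⟩ : ∃ r : ℝ, 0 ≤ r ∧ (coarse V).eval (r ^ 2) = t := by
    have hT : t ∈ Set.Icc ((coarse V).eval 0) ((coarse V).eval (t / m)) := by
      have := hW.mul_sub_le_coarse le_rfl (div_nonneg ht hm.le)
      rw [coarse_eval_zero, sub_zero, sub_zero, mul_div_cancel₀ _ hm.ne'] at this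
      exact ⟨by rwa [coarse_eval_zero], this⟩
    obtain ⟨q, hq, hqt⟩ := intermediate_value_Icc (div_nonneg ht hm.le) (coarse V).continuousOn hT
    exact ⟨Real.sqrt q, Real.sqrt_nonneg _, by rw [Real.sq_sqrt hq.1]; exact hqt⟩
  have hset : {r : ℝ | 0 ≤ r ∧ t = ∑ m ∈ Finset.Icc 1 V.natDegree,
      (m : ℝ) * (Nat.choose (2 * m) m : ℝ) * V.coeff m * r ^ (2 * m)} = {r} := by
    ext r'
    simp only [pow_mul, ← coarse_eval, Set.mem_ofPred_eq, Set.mem_singleton_iff]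
    constructor
    · rintro ⟨h0, h1⟩
      exact hinj _ _ h0 hr0 (h1.symm.trans hr.symm)
    · rintro rfl
      exact ⟨hr0, hr.symm⟩
  rw [phi, hset, csInf_singleton]
  exact ⟨hr0, hr⟩

theorem Tangent.phi_zero (hm : 0 < m) (hW : Tangent V m) : phi V 0 = 0 := by
  obtain ⟨h0, h1⟩ := hW.phi_spec hm le_rfl
  have := hW.mul_sub_le_coarse le_rfl (sq_nonneg (phi V 0))
  rw [h1, coarse_eval_zero] at this
  have : phi V 0 ^ 2 ≤ 0 := by nlinarith
  nlinarith

theorem Tangent.phi_pos (hm : 0 < m) (hW : Tangent V m) {t : ℝ} (ht : 0 < t) : 0 < phi V t := by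
  obtain ⟨h0, h1⟩ := hW.phi_spec hm ht.le
  refine lt_of_le_of_ne h0 fun h => ?_
  rw [← h] at h1
  norm_num [coarse_eval_zero] at h1
  linarith

/-- The regular object is `φ²`, which is Lipschitz up to `0`; `φ` itself has a square root
singularity there. -/
theorem Tangent.abs_phi_sq_sub_le (hm : 0 < m) (hW : Tangent V m) {s t : ℝ} (hs : 0 ≤ s)
    (ht : 0 ≤ t) : m * |phi V s ^ 2 - phi V t ^ 2| ≤ |s - t| := by
  obtain ⟨-, h1⟩ := hW.phi_spec hm hs
  obtain ⟨-, h2⟩ := hW.phi_spec hm ht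
  rcases le_total (phi V s ^ 2) (phi V t ^ 2) with h | h
  · have := hW.mul_sub_le_coarse (sq_nonneg (phi V s)) h
    rw [h1, h2] at this
    rw [abs_sub_comm, abs_of_nonneg (sub_nonneg.2 h), abs_sub_comm]
    exact this.trans (le_abs_self _)
  · have := hW.mul_sub_le_coarse (sq_nonneg (phi V t)) h
    rw [h1, h2] at this
    rw [abs_of_nonneg (sub_nonneg.2 h)]
    exact this.trans (le_abs_self _)

theorem Tangent.phi_continuousOn (hm : 0 < m) (hW : Tangent V m) :
    ContinuousOn (phi V) (Set.Ici 0) := by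
  have h : ContinuousOn (fun t => phi V t ^ 2) (Set.Ici 0) := by
    refine LipschitzOnWith.continuousOn (K := (m⁻¹).toNNReal) ?_
    refine LipschitzOnWith.of_dist_le_mul fun s hs t ht => ?_
    rw [Real.dist_eq, Real.dist_eq, Real.coe_toNNReal _ (by positivity)]
    have := hW.abs_phi_sq_sub_le hm hs ht
    rw [inv_mul_eq_div, le_div_iff₀ hm]
    linarith
  refine (h.sqrt).congr fun t ht => ?_
  exact (Real.sqrt_sq (hW.phi_spec hm ht).1).symm

/-- The derivative of the coarse minimizer. -/
noncomputable def phiDeriv (V : ℝ[X]) (t : ℝ) : ℝ :=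
  1 / (2 * phi V t * (coarse V).derivative.eval (phi V t ^ 2))

theorem Tangent.phi_hasDerivAt (hm : 0 < m) (hW : Tangent V m) {t : ℝ} (ht : 0 < t) :
    HasDerivAt (phi V) (phiDeriv V t) t := by
  have hpos := hW.phi_pos hm ht
  have hd := hW.le_coarse_derivative (sq_nonneg (phi V t))
  have hd0 : 0 < (coarse V).derivative.eval (phi V t ^ 2) := by linarith
  have hF : HasDerivAt (fun r => (coarse V).eval (r ^ 2))
      (2 * phi V t * (coarse V).derivative.eval (phi V t ^ 2)) (phi V t) := by
    have h1 : HasDerivAt (fun q => (coarse V).eval q) ((coarse V).derivative.eval (phi V t ^ 2))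
      ((fun r : ℝ => r ^ 2) (phi V t)) := (coarse V).hasDerivAt (phi V t ^ 2)
    have h2 := hasDerivAt_pow 2 (phi V t)
    exact (HasDerivAt.comp (h₂ := fun q => (coarse V).eval q) (h := fun r : ℝ => r ^ 2)
      (phi V t) h1 h2).congr_deriv (by norm_num; ring)
  have := hF.of_local_left_inverse
    ((hW.phi_continuousOn hm).continuousAt (Ici_mem_nhds ht)) (by positivity) (by
      filter_upwards [Ioi_mem_nhds ht] with s hs
      exact (hW.phi_spec hm (le_of_lt hs)).2)
  rwa [phiDeriv, one_div]

theorem Tangent.deriv_phi (hm : 0 < m) (hW : Tangent V m) {t : ℝ} (ht : 0 < t) :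
    deriv (phi V) t = phiDeriv V t := (hW.phi_hasDerivAt hm ht).deriv

/-- `∫₀ᵗ du / φ(u)` as a function of `φ(t)`. -/
noncomputable def coarseInt (V : ℝ[X]) (r : ℝ) : ℝ :=
  ∑ j ∈ Finset.Icc 1 V.natDegree, (j : ℝ) * (Nat.choose (2 * j) j : ℝ) * V.coeff j *
    (2 * j / (2 * j - 1)) * r ^ (2 * j - 1)

/-- The factors `2 j / (2 j - 1)` are chosen so that the derivative of `coarseInt V (φ t)` in `t` is
`1 / φ t`. -/
theorem coarseInt_hasDerivAt (V : ℝ[X]) (r : ℝ) :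
    HasDerivAt (coarseInt V) (2 * (coarse V).derivative.eval (r ^ 2)) r := by
  unfold coarseInt
  rw [coarse_derivative_eval, Finset.mul_sum]
  refine HasDerivAt.fun_sum fun j hj => ?_
  have h1 : 1 ≤ j := (Finset.mem_Icc.1 hj).1
  have h2 : (1 : ℝ) ≤ j := by exact_mod_cast h1
  have h3 : ((j : ℝ) * 2 - 1) ≠ 0 := by linarith
  refine ((hasDerivAt_pow (2 * j - 1) r).const_mul _).congr_deriv ?_
  have e1 : 2 * j - 1 - 1 = 2 * (j - 1) := by omega
  rw [e1, pow_mul, Nat.cast_sub (by omega)]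
  push_cast
  rw [mul_comm (2 : ℝ) (j : ℝ)]
  field_simp

theorem coarseInt_zero (V : ℝ[X]) : coarseInt V 0 = 0 := by
  refine Finset.sum_eq_zero fun j hj => ?_
  have : 1 ≤ j := (Finset.mem_Icc.1 hj).1
  rw [zero_pow (by omega), mul_zero]

theorem Tangent.intInvPhi_eq (hm : 0 < m) (hW : Tangent V m) {t : ℝ} (ht : 0 ≤ t) :
    intInvPhi V t = coarseInt V (phi V t) := by
  have hcont : ContinuousOn (fun u => coarseInt V (phi V u)) (Set.Icc 0 t) := by
    have h1 : Continuous (coarseInt V) :=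
      continuous_iff_continuousAt.2 fun r => (coarseInt_hasDerivAt V r).continuousAt
    exact h1.comp_continuousOn ((hW.phi_continuousOn hm).mono Set.Icc_subset_Ici_self)
  have hderiv : ∀ u ∈ Set.Ioo 0 t, HasDerivAt (fun u => coarseInt V (phi V u)) (1 / phi V u) u := by
    intro u hu
    have hp := hW.phi_pos hm hu.1
    have hd := hW.le_coarse_derivative (sq_nonneg (phi V u))
    have hd' : (coarse V).derivative.eval (phi V u ^ 2) ≠ 0 := by linarith
    refine ((coarseInt_hasDerivAt V (phi V u)).comp u (hW.phi_hasDerivAt hm hu.1)).congr_deriv ?_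
    rw [phiDeriv]
    field_simp
  rw [intInvPhi, intervalIntegral.integral_eq_sub_of_hasDerivAt_of_le ht hcont hderiv]
  · rw [hW.phi_zero hm, coarseInt_zero, sub_zero]
  -- The integrand is unbounded at `0`; it is integrable as the nonnegative derivative of a function
  -- continuous up to `0`.
  · refine intervalIntegral.intervalIntegrable_deriv_of_nonneg (g := fun u => coarseInt V (phi V u))
      ?_ ?_ ?_
    · rwa [Set.uIcc_of_le ht]
    · rwa [min_eq_left ht, max_eq_right ht]
    · rw [min_eq_left ht, max_eq_right ht]
      intro u hu
      have := hW.phi_pos hm hu.1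
      positivity

theorem Tangent.intInvPhi_hasDerivAt (hm : 0 < m) (hW : Tangent V m) {t : ℝ} (ht : 0 < t) :
    HasDerivAt (intInvPhi V) (1 / phi V t) t := by
  have hp := hW.phi_pos hm ht
  have hd := hW.le_coarse_derivative (sq_nonneg (phi V t))
  have hd' : (coarse V).derivative.eval (phi V t ^ 2) ≠ 0 := by linarith
  have h : HasDerivAt (fun u => coarseInt V (phi V u)) (1 / phi V t) t := by
    refine ((coarseInt_hasDerivAt V (phi V t)).comp t (hW.phi_hasDerivAt hm ht)).congr_deriv ?_
    rw [phiDeriv]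
    field_simp
  refine h.congr_of_eventuallyEq ?_
  filter_upwards [Ioi_mem_nhds ht] with s hs
  exact hW.intInvPhi_eq hm (le_of_lt hs)

end Coarse

end HardEdge

namespace HardEdge

open Polynomial

/-! ### Quantitative behaviour of `φ`, `φ'` and `∫ du / φ` on `(0, 1]`. -/

section Bounds

/-- On `[t / 2, 1]` the bound on the derivative is worst at `t / 2`, where it loses the factor `2 ^
(3 / 2) < 3`. -/
theorem lipschitz_of_deriv_le {f f' : ℝ → ℝ} {C : ℝ} (hC : 0 ≤ C)
    (hf : ∀ u, 0 < u → u ≤ 1 → HasDerivAt f (f' u) u) (hb : ∀ u, 0 < u → u ≤ 1 → |f' u| ≤ C / √u ^ 3)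
    {s t : ℝ} (ht : 0 < t) (ht1 : t ≤ 1) (hs : t / 2 ≤ s) (hs1 : s ≤ 1) :
    |f s - f t| ≤ 3 * C / √t ^ 3 * |s - t| := by
  have hsub : ∀ u ∈ Set.Icc (t / 2) 1, 0 < u ∧ u ≤ 1 := fun u hu => ⟨by linarith [hu.1], hu.2⟩
  refine (convex_Icc (t / 2) 1).norm_image_sub_le_of_norm_hasDerivWithin_le
    (fun u hu => (hf u (hsub u hu).1 (hsub u hu).2).hasDerivWithinAt) (fun u hu => ?_)
    ⟨by linarith, ht1⟩ ⟨hs, hs1⟩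
  refine (hb u (hsub u hu).1 (hsub u hu).2).trans ?_
  have hu0 := (hsub u hu).1
  have h1 : 0 < √t := Real.sqrt_pos.2 ht
  have h2 : 0 < √u := Real.sqrt_pos.2 hu0
  rw [div_le_div_iff₀ (by positivity) (by positivity)]
  have h3 : √t ^ 3 ≤ 3 * √u ^ 3 := by
    refine le_of_sq_le_sq ?_ (by positivity)
    have e1 : (√t ^ 3) ^ 2 = t ^ 3 := by
      rw [← pow_mul, mul_comm, pow_mul, Real.sq_sqrt ht.le]
    have e2 : (3 * √u ^ 3) ^ 2 = 9 * u ^ 3 := by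
      rw [mul_pow, ← pow_mul, mul_comm 3 2, pow_mul, Real.sq_sqrt hu0.le]; norm_num
    rw [e1, e2]
    have h4 : t ≤ 2 * u := by linarith [hu.1]
    have h5 : t ^ 3 ≤ (2 * u) ^ 3 := pow_le_pow_left₀ ht.le h4 3
    have : 0 < u ^ 3 := by positivity
    nlinarith
  nlinarith

variable {V : ℝ[X]} {m : ℝ}

/-- Everything behaves as for `φ(t) = √t`: `φ` and the integral are at least of order `√t`, the
first derivative is at most of order `1 / √t`, and the next order costs a further factor `1 / t`. -/
theorem Tangent.exists_phi_bounds (hm : 0 < m) (hW : Tangent V m) :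
    ∃ C : ℝ, 1 ≤ C ∧
      (∀ t : ℝ, 0 < t → t ≤ 1 → √t ≤ C * phi V t ∧ phi V t ≤ C * √t ∧ 0 < phiDeriv V t ∧
        phiDeriv V t ≤ C / √t ∧ √t ≤ C * intInvPhi V t) ∧
      (∀ t s : ℝ, 0 < t → t ≤ 1 → t / 2 ≤ s → s ≤ 1 →
        |phi V s - phi V t - (s - t) * phiDeriv V t| ≤ C / √t ^ 3 * (s - t) ^ 2 ∧
        |phiDeriv V s - phiDeriv V t| ≤ C / √t ^ 3 * |s - t| ∧
        |(intInvPhi V s)⁻¹ - (intInvPhi V t)⁻¹| ≤ C / √t ^ 3 * |s - t|) := by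
  set f := coarse V with hf
  -- For `t ≤ 1` the value `φ(t)²` lies in `[0, 1 / m]`, so the derivatives of `coarse V` need
  -- bounding only there.
  obtain ⟨M1, hM1⟩ := (isCompact_Icc (a := (0 : ℝ)) (b := 1 / m)).exists_bound_of_continuousOn
    f.derivative.continuousOn
  obtain ⟨M2, hM2⟩ := (isCompact_Icc (a := (0 : ℝ)) (b := 1 / m)).exists_bound_of_continuousOn
    f.derivative.derivative.continuousOn
  have hM1m : m ≤ M1 := (hW.le_coarse_derivative le_rfl).trans
    ((le_abs_self _).trans (hM1 0 ⟨le_rfl, by positivity⟩))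
  have hM1pos : 0 < M1 := hm.trans_le hM1m
  have hM2pos : 0 ≤ M2 := (norm_nonneg _).trans (hM2 0 ⟨le_rfl, by positivity⟩)
  -- elementary bounds on `φ`
  have hsq : ∀ t, 0 < t → t ≤ 1 → m * phi V t ^ 2 ≤ t ∧ t ≤ M1 * phi V t ^ 2 := by
    intro t ht ht1
    have h1 := hW.abs_phi_sq_sub_le hm ht.le le_rfl
    rw [hW.phi_zero hm] at h1
    norm_num [abs_of_pos ht] at h1
    refine ⟨h1, ?_⟩
    have h2 : phi V t ^ 2 ≤ 1 / m := by rw [le_div_iff₀ hm]; linarith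
    have h3 := (convex_Icc 0 (1 / m)).image_sub_le_mul_sub_of_deriv_le (C := M1)
      f.continuousOn f.differentiable.differentiableOn (fun x hx => by
        rw [Polynomial.deriv]
        exact (le_abs_self _).trans (hM1 x (interior_subset hx)))
      0 ⟨le_rfl, by positivity⟩ (phi V t ^ 2) ⟨sq_nonneg _, h2⟩ (sq_nonneg _)
    rw [hf, coarse_eval_zero, (hW.phi_spec hm ht.le).2] at h3
    simpa using h3
  set c := 1 + √M1 with hc
  have hc1 : 1 ≤ c := by rw [hc]; linarith [Real.sqrt_nonneg M1]
  have hc0 : 0 < c := by linarith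
  have hlow : ∀ t, 0 < t → t ≤ 1 → √t ≤ c * phi V t := by
    intro t ht ht1
    have h1 := (hW.phi_pos hm ht).le
    calc √t ≤ √(M1 * phi V t ^ 2) := Real.sqrt_le_sqrt (hsq t ht ht1).2
      _ = √M1 * phi V t := by rw [Real.sqrt_mul hM1pos.le, Real.sqrt_sq h1]
      _ ≤ c * phi V t := by rw [hc]; nlinarith
  have hinv : ∀ t, 0 < t → t ≤ 1 → 1 / phi V t ≤ c / √t := by
    intro t ht ht1
    rw [div_le_div_iff₀ (hW.phi_pos hm ht) (Real.sqrt_pos.2 ht), one_mul]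
    exact hlow t ht ht1
  have hinv3 : ∀ t, 0 < t → t ≤ 1 → 1 / phi V t ^ 3 ≤ c ^ 3 / √t ^ 3 := by
    intro t ht ht1
    have hp := hW.phi_pos hm ht
    have h := pow_le_pow_left₀ (by positivity) (hinv t ht ht1) 3
    rwa [div_pow, div_pow, one_pow] at h
  set b := 1 + √(1 / m) with hb
  have hb1 : 0 ≤ √(1 / m) := Real.sqrt_nonneg _
  have hup : ∀ t, 0 < t → t ≤ 1 → phi V t ≤ b * √t := by
    intro t ht ht1
    have h1 := (hW.phi_pos hm ht).le
    have h2 : phi V t ^ 2 ≤ 1 / m * t := by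
      rw [one_div, inv_mul_eq_div, le_div_iff₀ hm]; linarith [(hsq t ht ht1).1]
    calc phi V t = √(phi V t ^ 2) := (Real.sqrt_sq h1).symm
      _ ≤ √(1 / m * t) := Real.sqrt_le_sqrt h2
      _ = √(1 / m) * √t := Real.sqrt_mul (by positivity) _
      _ ≤ b * √t := by rw [hb]; nlinarith [Real.sqrt_nonneg t]
  have hmem : ∀ t, 0 < t → t ≤ 1 → phi V t ^ 2 ∈ Set.Icc 0 (1 / m) := by
    intro t ht ht1
    refine ⟨sq_nonneg _, ?_⟩
    rw [le_div_iff₀ hm]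
    linarith [(hsq t ht ht1).1]
  have hdpos : ∀ t, 0 < f.derivative.eval (phi V t ^ 2) := fun t =>
    hm.trans_le (hW.le_coarse_derivative (sq_nonneg _))
  -- the derivative of `φ`
  have hDpos : ∀ t, 0 < t → 0 < phiDeriv V t := by
    intro t ht
    have := hW.phi_pos hm ht
    have := hdpos t
    rw [phiDeriv]
    positivity
  have hD : ∀ t, 0 < t → phiDeriv V t ≤ 1 / (2 * m) * (1 / phi V t) := by
    intro t ht
    have hp := hW.phi_pos hm ht
    have h1 := hW.le_coarse_derivative (sq_nonneg (phi V t))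
    rw [phiDeriv, ← one_div_mul_one_div_rev, ← mul_comm, ← one_div_mul_one_div_rev]
    rw [one_div_mul_one_div_rev, one_div_mul_one_div_rev, one_div_mul_one_div_rev]
    refine one_div_le_one_div_of_le (by positivity) ?_
    nlinarith
  set D' : ℝ → ℝ := fun t => -((2 * phiDeriv V t) * f.derivative.eval (phi V t ^ 2)
    + (2 * phi V t) * (f.derivative.derivative.eval (phi V t ^ 2) * (2 * phi V t * phiDeriv V t)))
      / (2 * phi V t * f.derivative.eval (phi V t ^ 2)) ^ 2 with hD'
  have hDder : ∀ t, 0 < t → t ≤ 1 → HasDerivAt (phiDeriv V) (D' t) t := by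
    intro t ht _
    have hp := hW.phi_pos hm ht
    have hd := hdpos t
    have h1 := hW.phi_hasDerivAt hm ht
    have h2 : HasDerivAt (fun t => phi V t ^ 2) (2 * phi V t * phiDeriv V t) t :=
      (h1.pow 2).congr_deriv (by norm_num)
    have h3 : HasDerivAt (fun t => f.derivative.eval (phi V t ^ 2))
        (f.derivative.derivative.eval (phi V t ^ 2) * (2 * phi V t * phiDeriv V t)) t :=
      HasDerivAt.comp (h₂ := fun q => f.derivative.eval q) (h := fun t => phi V t ^ 2) t
        (f.derivative.hasDerivAt (phi V t ^ 2)) h2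
    have h4 := ((h1.const_mul 2).mul h3).inv (mul_pos (mul_pos two_pos hp) hd).ne'
    have e : phiDeriv V = ((fun t => 2 * phi V t) * fun t => f.derivative.eval (phi V t ^ 2))⁻¹ := by
      ext t
      rw [phiDeriv, one_div]
      rfl
    conv => arg 1; rw [e]
    exact h4
  set K1 := (M1 + 2 * M2 / m) / (4 * m ^ 3) * c ^ 3 with hK1
  have hK1pos : 0 ≤ K1 := by positivity
  have hD'b : ∀ t, 0 < t → t ≤ 1 → |D' t| ≤ K1 / √t ^ 3 := by
    intro t ht ht1
    have hp := hW.phi_pos hm ht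
    have hd := hW.le_coarse_derivative (sq_nonneg (phi V t))
    have hDp := hDpos t ht
    have h1 : |f.derivative.eval (phi V t ^ 2)| ≤ M1 := hM1 _ (hmem t ht ht1)
    have h2 : |f.derivative.derivative.eval (phi V t ^ 2)| ≤ M2 := hM2 _ (hmem t ht ht1)
    have h3 : |(2 * phiDeriv V t) * f.derivative.eval (phi V t ^ 2)
        + (2 * phi V t) * (f.derivative.derivative.eval (phi V t ^ 2) * (2 * phi V t * phiDeriv V t))|
        ≤ 2 * phiDeriv V t * (M1 + 2 * M2 / m) := by
      refine (abs_add_le _ _).trans ?_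
      rw [abs_mul, abs_of_pos (by positivity : 0 < 2 * phiDeriv V t)]
      have e : |2 * phi V t * (f.derivative.derivative.eval (phi V t ^ 2) *
          (2 * phi V t * phiDeriv V t))|
          = 2 * phiDeriv V t * (2 * |f.derivative.derivative.eval (phi V t ^ 2)| * phi V t ^ 2) := by
        rw [show 2 * phi V t * (f.derivative.derivative.eval (phi V t ^ 2) *
            (2 * phi V t * phiDeriv V t)) = 4 * phi V t ^ 2 * phiDeriv V t *
              f.derivative.derivative.eval (phi V t ^ 2) by ring, abs_mul,
          abs_of_pos (by positivity : 0 < 4 * phi V t ^ 2 * phiDeriv V t)]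
        ring
      rw [e, ← mul_add]
      refine mul_le_mul_of_nonneg_left ?_ (by positivity)
      refine add_le_add h1 ?_
      have h5 := (hmem t ht ht1).2
      calc 2 * |f.derivative.derivative.eval (phi V t ^ 2)| * phi V t ^ 2 ≤ 2 * M2 * (1 / m) := by
            gcongr
        _ = 2 * M2 / m := by ring
    have h4 : (2 * phi V t * m) ^ 2 ≤ (2 * phi V t * f.derivative.eval (phi V t ^ 2)) ^ 2 := by
      gcongr
    have h5 : |D' t| ≤ 2 * phiDeriv V t * (M1 + 2 * M2 / m) / (2 * phi V t * m) ^ 2 := by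
      simp only [hD']
      rw [abs_div, abs_neg, abs_of_nonneg (sq_nonneg (2 * phi V t * _))]
      exact div_le_div₀ (by positivity) h3 (by positivity) h4
    refine h5.trans ?_
    have h6 := hD t ht
    calc 2 * phiDeriv V t * (M1 + 2 * M2 / m) / (2 * phi V t * m) ^ 2
        ≤ 2 * (1 / (2 * m) * (1 / phi V t)) * (M1 + 2 * M2 / m) / (2 * phi V t * m) ^ 2 := by
          gcongr
      _ = (M1 + 2 * M2 / m) / (4 * m ^ 3) * (1 / phi V t ^ 3) := by field_simp; ring
      _ ≤ (M1 + 2 * M2 / m) / (4 * m ^ 3) * (c ^ 3 / √t ^ 3) :=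
          mul_le_mul_of_nonneg_left (hinv3 t ht ht1) (by positivity)
      _ = K1 / √t ^ 3 := by rw [hK1]; ring
  -- the integral
  have hIlow : ∀ t, 0 < t → 2 * m * phi V t ≤ intInvPhi V t := by
    intro t ht
    rw [hW.intInvPhi_eq hm ht.le]
    have := (convex_Ici (0 : ℝ)).mul_sub_le_image_sub_of_le_deriv (f := coarseInt V) (C := 2 * m)
      (fun r _ => (coarseInt_hasDerivAt V r).continuousAt.continuousWithinAt)
      (fun r _ => (coarseInt_hasDerivAt V r).differentiableAt.differentiableWithinAt)
      (fun r _ => by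
        rw [(coarseInt_hasDerivAt V r).deriv]
        linarith [hW.le_coarse_derivative (sq_nonneg r)])
      0 Set.self_mem_Ici (phi V t) (hW.phi_pos hm ht).le (hW.phi_pos hm ht).le
    rw [coarseInt_zero] at this
    linarith
  have hIpos : ∀ t, 0 < t → 0 < intInvPhi V t := fun t ht =>
    lt_of_lt_of_le (by have := hW.phi_pos hm ht; positivity) (hIlow t ht)
  set I' : ℝ → ℝ := fun t => -(1 / phi V t) / intInvPhi V t ^ 2 with hI'
  have hIder : ∀ t, 0 < t → t ≤ 1 → HasDerivAt (fun t => (intInvPhi V t)⁻¹) (I' t) t := by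
    intro t ht _
    exact (hW.intInvPhi_hasDerivAt hm ht).inv (hIpos t ht).ne'
  set K2 := 1 / (4 * m ^ 2) * c ^ 3 with hK2
  have hK2pos : 0 ≤ K2 := by positivity
  have hI'b : ∀ t, 0 < t → t ≤ 1 → |I' t| ≤ K2 / √t ^ 3 := by
    intro t ht ht1
    have hp := hW.phi_pos hm ht
    simp only [hI']
    rw [abs_div, abs_neg, abs_of_pos (by positivity : 0 < 1 / phi V t), abs_of_nonneg (sq_nonneg _)]
    calc 1 / phi V t / intInvPhi V t ^ 2 ≤ 1 / phi V t / (2 * m * phi V t) ^ 2 := by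
          gcongr; exact hIlow t ht
      _ = 1 / (4 * m ^ 2) * (1 / phi V t ^ 3) := by field_simp; ring
      _ ≤ 1 / (4 * m ^ 2) * (c ^ 3 / √t ^ 3) :=
          mul_le_mul_of_nonneg_left (hinv3 t ht ht1) (by positivity)
      _ = K2 / √t ^ 3 := by rw [hK2]; ring
  have hDlip : ∀ t s : ℝ, 0 < t → t ≤ 1 → t / 2 ≤ s → s ≤ 1 →
      |phiDeriv V s - phiDeriv V t| ≤ 3 * K1 / √t ^ 3 * |s - t| := fun t s ht ht1 hs hs1 =>
    lipschitz_of_deriv_le hK1pos hDder hD'b ht ht1 hs hs1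
  have hIlip : ∀ t s : ℝ, 0 < t → t ≤ 1 → t / 2 ≤ s → s ≤ 1 →
      |(intInvPhi V s)⁻¹ - (intInvPhi V t)⁻¹| ≤ 3 * K2 / √t ^ 3 * |s - t| := fun t s ht ht1 hs hs1 =>
    lipschitz_of_deriv_le hK2pos hIder hI'b ht ht1 hs hs1
  refine ⟨c + b + 1 / (2 * m) * c + c / (2 * m) + 3 * K1 + 3 * K2, ?_, ?_, ?_⟩
  · have : 0 ≤ b + 1 / (2 * m) * c + c / (2 * m) + 3 * K1 + 3 * K2 := by positivity
    linarith
  · intro t ht ht1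
    have hp := hW.phi_pos hm ht
    have hst : 0 < √t := Real.sqrt_pos.2 ht
    have hb0 : 0 ≤ b := by positivity
    refine ⟨?_, ?_, hDpos t ht, ?_, ?_⟩
    · refine (hlow t ht ht1).trans (mul_le_mul_of_nonneg_right ?_ hp.le)
      have : 0 ≤ b + 1 / (2 * m) * c + c / (2 * m) + 3 * K1 + 3 * K2 := by positivity
      linarith
    · refine (hup t ht ht1).trans (mul_le_mul_of_nonneg_right ?_ hst.le)
      have : 0 ≤ c + 1 / (2 * m) * c + c / (2 * m) + 3 * K1 + 3 * K2 := by positivity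
      linarith
    · refine (hD t ht).trans ((mul_le_mul_of_nonneg_left (hinv t ht ht1) (by positivity)).trans ?_)
      rw [← mul_div_assoc]
      refine div_le_div_of_nonneg_right ?_ hst.le
      have : 0 ≤ c + b + c / (2 * m) + 3 * K1 + 3 * K2 := by positivity
      linarith
    · calc √t ≤ c * phi V t := hlow t ht ht1
        _ = c / (2 * m) * (2 * m * phi V t) := by field_simp
        _ ≤ c / (2 * m) * intInvPhi V t := mul_le_mul_of_nonneg_left (hIlow t ht) (by positivity)
        _ ≤ _ := by
          refine mul_le_mul_of_nonneg_right ?_ (hIpos t ht).le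
          have : 0 ≤ c + b + 1 / (2 * m) * c + 3 * K1 + 3 * K2 := by positivity
          linarith
  · intro t s ht ht1 hs hs1
    have hst : 0 < √t := Real.sqrt_pos.2 ht
    have hb0 : 0 ≤ b := by positivity
    have hmono : ∀ k x, k ≤ c + b + 1 / (2 * m) * c + c / (2 * m) + 3 * K1 + 3 * K2 → 0 ≤ x →
        k / √t ^ 3 * x ≤
          (c + b + 1 / (2 * m) * c + c / (2 * m) + 3 * K1 + 3 * K2) / √t ^ 3 * x := by
      intro k x hk hx
      gcongr
    refine ⟨?_, (hDlip t s ht ht1 hs hs1).trans (hmono _ _ ?_ (abs_nonneg _)),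
      (hIlip t s ht ht1 hs hs1).trans (hmono _ _ ?_ (abs_nonneg _))⟩
    · refine le_trans ?_ (hmono (3 * K1) _ ?_ (sq_nonneg _))
      · have hseg : ∀ u ∈ Set.uIcc t s, t / 2 ≤ u ∧ u ≤ 1 ∧ |u - t| ≤ |s - t| := by
          intro u hu
          have h3 := Set.abs_sub_left_of_mem_uIcc hu
          refine ⟨?_, ?_, h3⟩
          · exact le_trans (le_min (by linarith) hs) hu.1
          · exact le_trans hu.2 (max_le ht1 hs1)
        -- The Taylor remainder of `φ`: the mean value inequality for `φ` minus its linear part at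
        -- `t`, with the Lipschitz bound on `φ'`.
        have h := (convex_uIcc t s).norm_image_sub_le_of_norm_hasDerivWithin_le
          (f := fun u => phi V u - (u - t) * phiDeriv V t)
          (f' := fun u => phiDeriv V u - phiDeriv V t) (C := 3 * K1 / √t ^ 3 * |s - t|)
          (fun u hu => by
            have hu0 : 0 < u := by linarith [(hseg u hu).1]
            have h1 := (hW.phi_hasDerivAt hm hu0).sub
              (((hasDerivAt_id u).sub_const t).mul_const (phiDeriv V t))
            simp only [one_mul] at h1
            exact h1.hasDerivWithinAt)
          (fun u hu => by
            obtain ⟨h1, h2, h3⟩ := hseg u hu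
            refine (hDlip t u ht ht1 h1 h2).trans ?_
            gcongr)
          Set.left_mem_uIcc Set.right_mem_uIcc
        simp only [Real.norm_eq_abs] at h
        have e : phi V s - (s - t) * phiDeriv V t - (phi V t - (t - t) * phiDeriv V t)
            = phi V s - phi V t - (s - t) * phiDeriv V t := by ring
        rw [e] at h
        refine h.trans (le_of_eq ?_)
        rw [mul_assoc, ← sq, sq_abs]
      · have : 0 ≤ c + b + 1 / (2 * m) * c + c / (2 * m) + 3 * K2 := by positivity
        linarith
    · have : 0 ≤ c + b + 1 / (2 * m) * c + c / (2 * m) + 3 * K2 := by positivity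
      linarith
    · have : 0 ≤ c + b + 1 / (2 * m) * c + c / (2 * m) + 3 * K1 := by positivity
      linarith

end Bounds

end HardEdge

namespace HardEdge

open Polynomial

/-! ### First order expansion of walk sums and of the entries of `W'(J)`. -/

section Walks

theorem walk_shift (Z : ℤ → ℝ) (w c : ℤ) (p : ℕ) (v : ℤ) :
    walk Z (w + c) p (v + c) = walk (fun s => Z (s + c)) w p v := by
  induction p generalizing v with
  | zero => simp [walk]
  | succ p ih =>
    rw [walk, walk, ← ih, ← ih]
    have e1 : v + c + 1 = v + 1 + c := by ring
    have e2 : v + c - 1 = v - 1 + c := by ring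
    rw [e1, e2]

theorem abs_walk_le {Z : ℤ → ℝ} {M : ℝ} {D : ℤ} (hZ : ∀ s : ℤ, |s| ≤ D → |Z s| ≤ M) (w : ℤ)
    (hM : 0 ≤ M) (p : ℕ) (v : ℤ) (hv : |v| + p ≤ D) : |walk Z w p v| ≤ (2 * M) ^ p := by
  induction p generalizing v with
  | zero => simp only [walk]; split_ifs <;> simp
  | succ p ih =>
    push_cast at hv
    have a1 : |v + 1| ≤ |v| + 1 := abs_add_le v 1
    have a2 : |v - 1| ≤ |v| + 1 := abs_sub v 1
    have h1 := ih (v + 1) (by omega)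
    have h2 := ih (v - 1) (by omega)
    have z1 := hZ v (by omega)
    have z2 := hZ (v - 1) (by omega)
    rw [walk, pow_succ]
    refine (abs_add_le _ _).trans ?_
    rw [abs_mul, abs_mul]
    have h3 := mul_le_mul z1 h1 (abs_nonneg _) hM
    have h4 := mul_le_mul z2 h2 (abs_nonneg _) hM
    linarith

/-- The number of nearest neighbour walks of length `p` from `v` to `1`. -/
noncomputable def walkCount (p : ℕ) (v : ℤ) : ℝ := walk (fun _ => 1) 1 p v

theorem walkCount_succ (p : ℕ) (v : ℤ) :
    walkCount (p + 1) v = walkCount p (v + 1) + walkCount p (v - 1) := by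
  simp [walkCount, walk]

theorem abs_walkCount_le (p : ℕ) (v : ℤ) : |walkCount p v| ≤ 2 ^ p := by
  have := abs_walk_le (Z := fun _ => 1) (M := 1) (D := |v| + p) (fun _ _ => by simp) 1 zero_le_one
    p v le_rfl
  simpa [walkCount] using this

theorem walkCount_eq_zero (p : ℕ) (v : ℤ) (hv : v < 1 - p) : walkCount p v = 0 := by
  induction p generalizing v with
  | zero => simp [walkCount, walk]; intro h; simp [h] at hv
  | succ p ih =>
    push_cast at hv
    rw [walkCount_succ, ih _ (by omega), ih _ (by omega), add_zero]

/-- Here `j` is the number of down steps; the induction is Pascal's rule. -/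
theorem walkCount_eq_choose (p j : ℕ) : walkCount p (1 - p + 2 * j) = Nat.choose p j := by
  induction p generalizing j with
  | zero =>
    cases j with
    | zero => simp [walkCount, walk]
    | succ j =>
      simp [walkCount, walk]
      omega
  | succ p ih =>
    rw [walkCount_succ]
    cases j with
    | zero =>
      rw [walkCount_eq_zero p (1 - ((p + 1 : ℕ) : ℤ) + 2 * (0 : ℕ) - 1) (by push_cast; omega)]
      have := ih 0
      simp at this ⊢
      rwa [neg_add_eq_sub]
    | succ j =>
      have h1 := ih (j + 1)
      have h2 := ih j
      have e1 : 1 - ((p + 1 : ℕ) : ℤ) + 2 * ((j + 1 : ℕ) : ℤ) + 1 = 1 - p + 2 * ((j + 1 : ℕ) : ℤ) := by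
        push_cast; ring
      have e2 : 1 - ((p + 1 : ℕ) : ℤ) + 2 * ((j + 1 : ℕ) : ℤ) - 1 = 1 - p + 2 * (j : ℤ) := by
        push_cast; ring
      rw [e1, e2, h1, h2, Nat.choose_succ_succ]
      push_cast
      ring

theorem walkCount_even (k : ℕ) : walkCount (2 * k) 1 = Nat.choose (2 * k) k ∧
    (k + 1) * walkCount (2 * k) (-1) = k * Nat.choose (2 * k) k := by
  constructor
  · rw [← walkCount_eq_choose]; congr 1; push_cast; ring
  · cases k with
    | zero => rw [walkCount_eq_zero _ _ (by norm_num)]; simp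
    | succ k =>
      have h := walkCount_eq_choose (2 * (k + 1)) k
      have e : 1 - ((2 * (k + 1) : ℕ) : ℤ) + 2 * (k : ℤ) = -1 := by push_cast; ring
      rw [e] at h
      rw [h]
      have h2 := Nat.choose_succ_right_eq (2 * (k + 1)) k
      have e2 : 2 * (k + 1) - k = k + 2 := by omega
      rw [e2] at h2
      have h3 : (Nat.choose (2 * (k + 1)) (k + 1) : ℝ) * (k + 1)
          = Nat.choose (2 * (k + 1)) k * (k + 2) := by exact_mod_cast h2
      push_cast
      linarith

/-- These govern the responses to the three kinds of deviation: constant, alternating, and linear.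
The last identity is what makes the linear one cancel. -/
theorem walkCount_values (k : ℕ) :
    walkCount (2 * k + 1) 0 = Nat.choose (2 * (k + 1)) (k + 1) / 2 ∧
    walkCount (2 * k) 1 - walkCount (2 * k) (-1)
      = Nat.choose (2 * (k + 1)) (k + 1) / (2 * (2 * k + 1)) ∧
    (k : ℝ) * (walkCount (2 * k) 1 - walkCount (2 * k) (-1)) = walkCount (2 * k) (-1) := by
  obtain ⟨h1, h2⟩ := walkCount_even k
  have h := Nat.succ_mul_centralBinom_succ k
  simp only [Nat.centralBinom] at h
  have h' : ((k : ℝ) + 1) * (Nat.choose (2 * (k + 1)) (k + 1) : ℝ)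
      = 2 * (2 * k + 1) * (Nat.choose (2 * k) k : ℝ) := by exact_mod_cast h
  have hk : (k : ℝ) + 1 ≠ 0 := by positivity
  have hk2 : (2 * (k : ℝ) + 1) ≠ 0 := by positivity
  have h3 : walkCount (2 * k) (-1) = k * Nat.choose (2 * k) k / (k + 1) := by
    field_simp; linarith
  have h4 : (Nat.choose (2 * (k + 1)) (k + 1) : ℝ)
      = 2 * (2 * k + 1) * (Nat.choose (2 * k) k : ℝ) / (k + 1) := by field_simp; linarith
  refine ⟨?_, ?_, ?_⟩
  · rw [walkCount_succ, zero_add, zero_sub, h1, h3, h4]; field_simp; ring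
  · rw [h1, h3, h4]; field_simp; ring
  · rw [h1, h3]; field_simp; ring

/-- The part of a walk sum which is linear in the deviation `e` of the bond weights from `φ`. -/
noncomputable def walkLin (φ : ℝ) (e : ℤ → ℝ) : ℕ → ℤ → ℝ
  | 0, _ => 0
  | p + 1, v => φ * (walkLin φ e p (v + 1) + walkLin φ e p (v - 1))
      + φ ^ p * (e v * walkCount p (v + 1) + e (v - 1) * walkCount p (v - 1))

theorem walkLin_add (φ : ℝ) (e e' : ℤ → ℝ) (p : ℕ) (v : ℤ) :
    walkLin φ (fun s => e s + e' s) p v = walkLin φ e p v + walkLin φ e' p v := by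
  induction p generalizing v with
  | zero => simp [walkLin]
  | succ p ih => simp only [walkLin, ih]; ring

theorem walkLin_smul (φ c : ℝ) (e : ℤ → ℝ) (p : ℕ) (v : ℤ) :
    walkLin φ (fun s => c * e s) p v = c * walkLin φ e p v := by
  induction p generalizing v with
  | zero => simp [walkLin]
  | succ p ih => simp only [walkLin, ih]; ring

/-- A walk of length `p + 1` passes `p + 1` bonds, so a uniform deviation acts like the derivative
of `φ ^ (p + 1)`. -/
theorem walkLin_one (φ : ℝ) (p : ℕ) (v : ℤ) :
    walkLin φ (fun _ => 1) (p + 1) v = φ ^ p * ((p + 1) * walkCount (p + 1) v) := by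
  induction p generalizing v with
  | zero => simp [walkLin, walkCount_succ]
  | succ p ih =>
    rw [walkLin, ih, ih, walkCount_succ (p + 1)]
    push_cast
    ring

/-- In steps of two the contributions of an alternating deviation cancel. For odd lengths only that
of the first step survives. -/
theorem walkLin_alternating (φ : ℝ) (k : ℕ) :
    (∀ v, walkLin φ (fun s => (-1) ^ s) (2 * k) v = 0) ∧
    ∀ v, walkLin φ (fun s => (-1) ^ s) (2 * k + 1) v
      = φ ^ (2 * k) * ((-1) ^ v * (walkCount (2 * k) (v + 1) - walkCount (2 * k) (v - 1))) := by
  have hne : (-1 : ℝ) ≠ 0 := by norm_num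
  have hs : ∀ v : ℤ, (-1 : ℝ) ^ (v - 1) = -(-1) ^ v := fun v => by
    rw [zpow_sub_one₀ hne]; norm_num
  have ha : ∀ v : ℤ, (-1 : ℝ) ^ (v + 1) = -(-1) ^ v := fun v => by
    rw [zpow_add_one₀ hne]; norm_num
  have hstep : ∀ k, (∀ v, walkLin φ (fun s => (-1) ^ s) (2 * k) v = 0) →
      ∀ v, walkLin φ (fun s => (-1) ^ s) (2 * k + 1) v
        = φ ^ (2 * k) * ((-1) ^ v * (walkCount (2 * k) (v + 1) - walkCount (2 * k) (v - 1))) := by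
    intro k h v
    rw [walkLin, h, h, hs]
    ring
  induction k with
  | zero => exact ⟨fun v => rfl, hstep 0 fun v => rfl⟩
  | succ k ih =>
    have h0 : ∀ v, walkLin φ (fun s => (-1) ^ s) (2 * (k + 1)) v = 0 := by
      intro v
      have e : 2 * (k + 1) = 2 * k + 1 + 1 := by ring
      rw [e, walkLin, ih.2, ih.2, walkCount_succ, walkCount_succ, ha, hs]
      have e1 : v + 1 + 1 = v + 2 := by ring
      have e2 : v + 1 - 1 = v := by ring
      have e3 : v - 1 + 1 = v := by ring
      have e4 : v - 1 - 1 = v - 2 := by ring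
      rw [e1, e2, e3, e4]
      ring
    exact ⟨h0, hstep _ h0⟩

theorem walkLin_linear (φ : ℝ) (p : ℕ) (v : ℤ) :
    walkLin φ (fun s => (s : ℝ)) (p + 1) v = φ ^ p * ((p + 1) * v * walkCount (p + 1) v
      + (p + 1) * p / 2 * (walkCount p (v + 1) - walkCount p (v - 1))
      - (p + 1) * walkCount p (v - 1)) := by
  induction p generalizing v with
  | zero => simp [walkLin, walkCount_succ]; ring
  | succ p ih =>
    rw [walkLin, ih, ih, walkCount_succ (p + 1) v]
    have e1 : v + 1 + 1 = v + 2 := by ring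
    have e2 : v + 1 - 1 = v := by ring
    have e3 : v - 1 + 1 = v := by ring
    have e4 : v - 1 - 1 = v - 2 := by ring
    rw [walkCount_succ p (v + 1), walkCount_succ p (v - 1), e1, e2, e3, e4]
    push_cast
    ring

theorem exists_abs_walkLin_le (K : ℝ) (hK : 0 ≤ K) (p : ℕ) : ∃ L : ℝ, 0 ≤ L ∧
    ∀ (φ : ℝ) (e : ℤ → ℝ) (η : ℝ) (D : ℤ), |φ| ≤ K → 0 ≤ η → (∀ s : ℤ, |s| ≤ D → |e s| ≤ η) →
      ∀ v : ℤ, |v| + p ≤ D → |walkLin φ e p v| ≤ L * η := by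
  induction p with
  | zero => exact ⟨0, le_rfl, fun φ e η D _ _ _ v _ => by simp [walkLin]⟩
  | succ p ih =>
    obtain ⟨L, hL, h⟩ := ih
    refine ⟨2 * K * L + 2 * K ^ p * 2 ^ p, by positivity, fun φ e η D hφ hη he v hv => ?_⟩
    push_cast at hv
    have a1 : |v + 1| ≤ |v| + 1 := abs_add_le v 1
    have a2 : |v - 1| ≤ |v| + 1 := abs_sub v 1
    have h1 := h φ e η D hφ hη he (v + 1) (by omega)
    have h2 := h φ e η D hφ hη he (v - 1) (by omega)
    have z1 := he v (by omega)
    have z2 := he (v - 1) (by omega)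
    have h3 : |walkLin φ e p (v + 1) + walkLin φ e p (v - 1)| ≤ 2 * L * η :=
      (abs_add_le _ _).trans (by linarith)
    have h4 : |e v * walkCount p (v + 1) + e (v - 1) * walkCount p (v - 1)| ≤ 2 * η * 2 ^ p := by
      refine (abs_add_le _ _).trans ?_
      rw [abs_mul, abs_mul]
      have := mul_le_mul z1 (abs_walkCount_le p (v + 1)) (abs_nonneg _) hη
      have := mul_le_mul z2 (abs_walkCount_le p (v - 1)) (abs_nonneg _) hη
      linarith
    rw [walkLin]
    refine (abs_add_le _ _).trans ?_
    rw [abs_mul, abs_mul, abs_pow]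
    have h5 := mul_le_mul hφ h3 (abs_nonneg _) hK
    have h6 := mul_le_mul (pow_le_pow_left₀ (abs_nonneg _) hφ p) h4 (abs_nonneg _) (by positivity)
    refine (add_le_add h5 h6).trans (le_of_eq ?_)
    ring

/-- Splitting off the first step, the new remainder is the old one times a bounded weight, plus the
deviation of the first bond times the linear part of the rest, which is quadratic in `η`. -/
theorem exists_abs_walk_sub_le (K : ℝ) (hK : 0 ≤ K) (p : ℕ) : ∃ L : ℝ, 0 ≤ L ∧
    ∀ (φ : ℝ) (Z : ℤ → ℝ) (η : ℝ) (D : ℤ), |φ| ≤ K → 0 ≤ η → η ≤ K →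
      (∀ s : ℤ, |s| ≤ D → |Z s - φ| ≤ η) → ∀ v : ℤ, |v| + p ≤ D →
        |walk Z 1 p v - φ ^ p * walkCount p v - walkLin φ (fun s => Z s - φ) p v| ≤ L * η ^ 2 := by
  induction p with
  | zero => exact ⟨0, le_rfl, fun φ Z η D _ _ _ _ v _ => by simp [walk, walkLin, walkCount]⟩
  | succ p ih =>
    obtain ⟨L, hL, h⟩ := ih
    obtain ⟨L', hL', h'⟩ := exists_abs_walkLin_le K hK p
    refine ⟨4 * K * L + 2 * L', by positivity, fun φ Z η D hφ hη hηK hZ v hv => ?_⟩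
    push_cast at hv
    have a1 : |v + 1| ≤ |v| + 1 := abs_add_le v 1
    have a2 : |v - 1| ≤ |v| + 1 := abs_sub v 1
    have h1 := h φ Z η D hφ hη hηK hZ (v + 1) (by omega)
    have h2 := h φ Z η D hφ hη hηK hZ (v - 1) (by omega)
    have l1 := h' φ (fun s => Z s - φ) η D hφ hη hZ (v + 1) (by omega)
    have l2 := h' φ (fun s => Z s - φ) η D hφ hη hZ (v - 1) (by omega)
    have z1 := hZ v (by omega)
    have z2 := hZ (v - 1) (by omega)
    have z1' : |Z v| ≤ 2 * K := by
      have := abs_add_le (Z v - φ) φ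
      rw [sub_add_cancel] at this; linarith
    have z2' : |Z (v - 1)| ≤ 2 * K := by
      have := abs_add_le (Z (v - 1) - φ) φ
      rw [sub_add_cancel] at this; linarith
    have e : walk Z 1 (p + 1) v - φ ^ (p + 1) * walkCount (p + 1) v
        - walkLin φ (fun s => Z s - φ) (p + 1) v
        = (Z v * (walk Z 1 p (v + 1) - φ ^ p * walkCount p (v + 1)
              - walkLin φ (fun s => Z s - φ) p (v + 1))
            + Z (v - 1) * (walk Z 1 p (v - 1) - φ ^ p * walkCount p (v - 1)
              - walkLin φ (fun s => Z s - φ) p (v - 1)))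
          + ((Z v - φ) * walkLin φ (fun s => Z s - φ) p (v + 1)
            + (Z (v - 1) - φ) * walkLin φ (fun s => Z s - φ) p (v - 1)) := by
      rw [walk, walkLin, walkCount_succ, pow_succ]; ring
    rw [e]
    have b1 := mul_le_mul z1' h1 (abs_nonneg _) (by positivity)
    have b2 := mul_le_mul z2' h2 (abs_nonneg _) (by positivity)
    have b3 := mul_le_mul z1 l1 (abs_nonneg _) hη
    have b4 := mul_le_mul z2 l2 (abs_nonneg _) hη
    rw [← abs_mul] at b1 b2 b3 b4
    refine (abs_add_le _ _).trans ((add_le_add (abs_add_le _ _) (abs_add_le _ _)).trans ?_)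
    refine (add_le_add (add_le_add b1 b2) (add_le_add b3 b4)).trans (le_of_eq ?_)
    ring

/-- The drift `τ` is absent from the result: reflecting the path about the bond between `0` and `1`
and reversing the walks sends bond `s` to bond `-s`, so an odd deviation has no first order effect.
Therefore the residual is quadratic and does not see the slope of `φ`. -/
theorem exists_walk_expansion (K : ℝ) (hK : 0 ≤ K) (k : ℕ) : ∃ L : ℝ, 0 ≤ L ∧
    ∀ (φ α σ τ : ℝ) (Z : ℤ → ℝ) (η ε : ℝ) (D : ℤ), 2 * (k : ℤ) + 1 ≤ D → |φ| ≤ K → 0 ≤ η → η ≤ K →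
      0 ≤ ε → (∀ s : ℤ, |s| ≤ D → |Z s - φ| ≤ η) →
      (∀ s : ℤ, |s| ≤ D → |Z s - (φ + (α + σ * (-1) ^ s + τ * s))| ≤ ε) →
        |walk Z 1 (2 * k + 1) 0 - (Nat.choose (2 * (k + 1)) (k + 1) : ℝ) / 2 *
          (φ ^ (2 * k + 1) + φ ^ (2 * k) * (α * (2 * k + 1) + σ / (2 * k + 1)))|
          ≤ L * (η ^ 2 + ε) := by
  obtain ⟨L1, hL1, h1⟩ := exists_abs_walk_sub_le K hK (2 * k + 1)
  obtain ⟨L2, hL2, h2⟩ := exists_abs_walkLin_le K hK (2 * k + 1)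
  refine ⟨L1 + L2, by positivity, fun φ α σ τ Z η ε D hD hφ hη hηK hε hZ hZ' => ?_⟩
  have g1 := h1 φ Z η D hφ hη hηK hZ 0 (by push_cast; simpa using hD)
  have g2 := h2 φ (fun s => Z s - (φ + (α + σ * (-1) ^ s + τ * s))) ε D hφ hε hZ' 0
    (by push_cast; simpa using hD)
  have e : (fun s => Z s - φ) = fun s => (Z s - (φ + (α + σ * (-1) ^ s + τ * s)))
      + ((α * 1 + σ * (-1) ^ s) + τ * s) := by
    ext s; ring
  obtain ⟨v1, v2, v3⟩ := walkCount_values k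
  have hlin : walkLin φ (fun s : ℤ => (α * 1 + σ * (-1) ^ s) + τ * (s : ℝ)) (2 * k + 1) 0
      = (Nat.choose (2 * (k + 1)) (k + 1) : ℝ) / 2 *
        (φ ^ (2 * k) * (α * (2 * k + 1) + σ / (2 * k + 1))) := by
    rw [walkLin_add, walkLin_add, walkLin_smul, walkLin_smul, walkLin_smul, walkLin_one,
      (walkLin_alternating φ k).2, walkLin_linear, v1]
    simp only [zero_add, zero_sub, zpow_zero, Int.cast_zero]
    have hk2 : (2 * (k : ℝ) + 1) ≠ 0 := by positivity
    have v4 : ((2 * k : ℕ) : ℝ) = 2 * k := by push_cast; ring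
    -- This cancels the two surviving terms of `walkLin_linear` against each other.
    have v5 : (2 * (k : ℝ) + 1) * (2 * k) / 2 * (walkCount (2 * k) 1 - walkCount (2 * k) (-1))
        = (2 * k + 1) * walkCount (2 * k) (-1) := by
      linear_combination (2 * (k : ℝ) + 1) * v3
    rw [v4, v5, v2]
    field_simp
    ring
  rw [e, walkLin_add, hlin, v1] at g1
  have e2 : walk Z 1 (2 * k + 1) 0 - (Nat.choose (2 * (k + 1)) (k + 1) : ℝ) / 2 *
          (φ ^ (2 * k + 1) + φ ^ (2 * k) * (α * (2 * k + 1) + σ / (2 * k + 1)))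
      = (walk Z 1 (2 * k + 1) 0 - φ ^ (2 * k + 1) * ((Nat.choose (2 * (k + 1)) (k + 1) : ℝ) / 2) -
        (walkLin φ (fun s => Z s - (φ + (α + σ * (-1) ^ s + τ * s))) (2 * k + 1) 0 +
          (Nat.choose (2 * (k + 1)) (k + 1) : ℝ) / 2 *
            (φ ^ (2 * k) * (α * (2 * k + 1) + σ / (2 * k + 1)))))
        + walkLin φ (fun s => Z s - (φ + (α + σ * (-1) ^ s + τ * s))) (2 * k + 1) 0 := by ring
  rw [e2]
  refine (abs_add_le _ _).trans ((add_le_add g1 g2).trans ?_)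
  have := mul_nonneg hL1 hε
  have := mul_nonneg hL2 (sq_nonneg η)
  linarith

/-- The derivative of `V(u²)` is odd, so only walks of odd length occur; the bond is shifted to the
one between `0` and `1`. -/
theorem bondEntry_eq_sum (V : ℝ[X]) {N l : ℕ} (hl : l < N) (z : ℕ → ℝ) :
    bondEntry (derivative (V.comp (X ^ 2))) N z l = ∑ k ∈ Finset.range V.natDegree,
      2 * ((k : ℝ) + 1) * V.coeff (k + 1) * walk (fun s => extend N z (s + l)) 1 (2 * k + 1) 0 := by
  have hQ : derivative (V.comp (X ^ 2)) = ∑ k ∈ Finset.range V.natDegree,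
      C (2 * ((k : ℝ) + 1) * V.coeff (k + 1)) * X ^ (2 * k + 1) := by
    conv_lhs => rw [V.as_sum_range_C_mul_X_pow]
    rw [Finset.sum_range_succ', Polynomial.add_comp, Polynomial.sum_comp, derivative_add,
      derivative_sum]
    simp only [pow_zero, mul_one, C_comp, derivative_C, add_zero]
    refine Finset.sum_congr rfl fun k _ => ?_
    simp only [mul_comp, C_comp, X_pow_comp, ← pow_mul]
    rw [derivative_C_mul, derivative_X_pow]
    have e : 2 * (k + 1) - 1 = 2 * k + 1 := by omega
    rw [e, ← mul_assoc, ← C_mul]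
    congr 2
    push_cast
    ring
  have h := aeval_jacobi_apply (derivative (V.comp (X ^ 2))) N z ⟨l, by omega⟩ ⟨l + 1, by omega⟩
  have h2 : bondEntry (derivative (V.comp (X ^ 2))) N z l
      = aeval (jacobi N z) (derivative (V.comp (X ^ 2))) ⟨l, by omega⟩ ⟨l + 1, by omega⟩ := by
    rw [h, bondEntry]
    push_cast
    rfl
  rw [h2, hQ, map_sum, Matrix.sum_apply]
  refine Finset.sum_congr rfl fun k _ => ?_
  rw [← smul_eq_C_mul, map_smul, map_pow, aeval_X, Matrix.smul_apply, jacobi_pow_apply, smul_eq_mul]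
  congr 1
  have := walk_shift (extend N z) 1 l (2 * k + 1) 0
  rw [← this]
  push_cast
  rw [zero_add, add_comm (1 : ℤ)]

/-- All walks have length between `1` and `2 * V.natDegree`, so they stay near the bond and each
contributes at least one factor `M`. -/
theorem exists_abs_bondEntry_le (V : ℝ[X]) (K : ℝ) (hK : 0 ≤ K) : ∃ L : ℝ, 0 ≤ L ∧
    ∀ (N l : ℕ) (z : ℕ → ℝ) (M : ℝ), l < N → 0 ≤ M → M ≤ K →
      (∀ s : ℤ, |s| ≤ 2 * V.natDegree → |extend N z (s + l)| ≤ M) →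
        |bondEntry (derivative (V.comp (X ^ 2))) N z l| ≤ L * M := by
  refine ⟨∑ k ∈ Finset.range V.natDegree, |2 * ((k : ℝ) + 1) * V.coeff (k + 1)| *
    ((2 * K) ^ (2 * k) * 2), Finset.sum_nonneg fun _ _ => by positivity,
    fun N l z M hl hM hMK hz => ?_⟩
  rw [bondEntry_eq_sum V hl, Finset.sum_mul]
  refine (Finset.abs_sum_le_sum_abs _ _).trans (Finset.sum_le_sum fun k hk => ?_)
  have hk := Finset.mem_range.1 hk
  rw [abs_mul, mul_assoc |2 * ((k : ℝ) + 1) * V.coeff (k + 1)|]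
  refine mul_le_mul_of_nonneg_left ?_ (abs_nonneg (2 * ((k : ℝ) + 1) * V.coeff (k + 1)))
  have := abs_walk_le (D := 2 * V.natDegree) hz 1 hM (2 * k + 1) 0 (by push_cast; simp; omega)
  refine this.trans ?_
  rw [pow_succ, mul_assoc]
  gcongr

/-- Summing the walk expansions over the coefficients of `V`: the factors `2 k + 1` of the constant
part assemble to the derivative of `coarse V`, and the factors `1 / (2 k + 1)` of the alternating
part to `coarseInt V`. The latter is how `∫ du / φ` enters the problem. -/
theorem exists_bondEntry_expansion (V : ℝ[X]) (K : ℝ) (hK : 0 ≤ K) : ∃ L : ℝ, 0 ≤ L ∧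
    ∀ (N l : ℕ) (z : ℕ → ℝ) (φ α σ τ η ε : ℝ), l < N → 0 < φ → φ ≤ K → 0 ≤ η → η ≤ K → 0 ≤ ε →
      (∀ s : ℤ, |s| ≤ 2 * V.natDegree → |extend N z (s + l) - φ| ≤ η) →
      (∀ s : ℤ, |s| ≤ 2 * V.natDegree →
        |extend N z (s + l) - (φ + (α + σ * (-1) ^ s + τ * s))| ≤ ε) →
        |bondEntry (derivative (V.comp (X ^ 2))) N z l - ((coarse V).eval (φ ^ 2) / φ
          + α * (2 * (coarse V).derivative.eval (φ ^ 2) - (coarse V).eval (φ ^ 2) / φ ^ 2)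
          + σ * (coarseInt V φ / φ - (coarse V).eval (φ ^ 2) / φ ^ 2))| ≤ L * (η ^ 2 + ε) := by
  choose L hL h using exists_walk_expansion K hK
  refine ⟨∑ k ∈ Finset.range V.natDegree, |2 * ((k : ℝ) + 1) * V.coeff (k + 1)| * L k,
    Finset.sum_nonneg fun k _ => mul_nonneg (abs_nonneg _) (hL k),
    fun N l z φ α σ τ η ε hl hφ hφK hη hηK hε hz hz' => ?_⟩
  have hmain : (coarse V).eval (φ ^ 2) / φ
          + α * (2 * (coarse V).derivative.eval (φ ^ 2) - (coarse V).eval (φ ^ 2) / φ ^ 2)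
          + σ * (coarseInt V φ / φ - (coarse V).eval (φ ^ 2) / φ ^ 2)
      = ∑ k ∈ Finset.range V.natDegree, 2 * ((k : ℝ) + 1) * V.coeff (k + 1) *
        ((Nat.choose (2 * (k + 1)) (k + 1) : ℝ) / 2 *
          (φ ^ (2 * k + 1) + φ ^ (2 * k) * (α * (2 * k + 1) + σ / (2 * k + 1)))) := by
    have hI : Finset.Icc 1 V.natDegree = Finset.Ico 1 (V.natDegree + 1) := by ext; simp
    rw [coarse_eval, coarse_derivative_eval, coarseInt, hI]
    simp only [Finset.sum_Ico_eq_sum_range, add_tsub_cancel_right, Finset.sum_div, Finset.mul_sum]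
    rw [← Finset.sum_sub_distrib, ← Finset.sum_sub_distrib, Finset.mul_sum, Finset.mul_sum,
      ← Finset.sum_add_distrib, ← Finset.sum_add_distrib]
    refine Finset.sum_congr rfl fun k _ => ?_
    have e1 : 2 * (1 + k) - 1 = 2 * k + 1 := by omega
    have e2 : 1 + k - 1 = k := by omega
    rw [e1, e2, add_comm 1 k]
    have hk2 : (2 * (k : ℝ) + 1) ≠ 0 := by positivity
    have hk3 : (2 * ((k : ℝ) + 1) - 1) = 2 * k + 1 := by ring
    push_cast
    rw [hk3]
    have p1 : (φ ^ 2) ^ (k + 1) = φ ^ (2 * k) * φ ^ 2 := by rw [pow_succ, ← pow_mul]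
    have p2 : (φ ^ 2) ^ k = φ ^ (2 * k) := by rw [← pow_mul]
    have p3 : φ ^ (2 * k + 1) = φ ^ (2 * k) * φ := pow_succ _ _
    rw [p1, p2, p3]
    field_simp
    ring
  rw [hmain, bondEntry_eq_sum V hl, ← Finset.sum_sub_distrib, Finset.sum_mul]
  refine (Finset.abs_sum_le_sum_abs _ _).trans (Finset.sum_le_sum fun k hk => ?_)
  have hk := Finset.mem_range.1 hk
  rw [← mul_sub, abs_mul, mul_assoc |2 * ((k : ℝ) + 1) * V.coeff (k + 1)|]
  refine mul_le_mul_of_nonneg_left ?_ (abs_nonneg (2 * ((k : ℝ) + 1) * V.coeff (k + 1)))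
  exact h k φ α σ τ _ η ε (2 * V.natDegree) (by omega) (by rwa [abs_of_pos hφ]) hη hηK hε hz hz'

end Walks

end HardEdge

namespace HardEdge

open Polynomial

/-! ### The fine minimizer as a function on the bonds. -/

section FineExpansion

/-- The point of `(0, 1]` at which the expansion around bond `l` is centred. -/
noncomputable def bondPt (n l : ℕ) : ℝ := ((l : ℝ) + 1) / (2 * n)

/-- The size of the weights near bond `l`. -/
noncomputable def bondScale (n l : ℕ) : ℝ := √(bondPt n l)

/-- The point of `(0, 1]` belonging to the pair of weights which contains bond `l`. -/
noncomputable def nodePt (n l : ℕ) : ℝ := ((l / 2 + 1 : ℕ) : ℝ) / n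

/-- The first order correction on bond `l`. -/
noncomputable def bondCorr (V : ℝ[X]) (β a : ℝ) (l : ℕ) (t : ℝ) : ℝ :=
  if l % 2 = 0 then corrX V β a t else corrY V β a t

/-- The fine minimizer as a function of the bond. -/
noncomputable def fineBond (V : ℝ[X]) (β a : ℝ) (n : ℕ) : ℕ → ℝ :=
  interlace (fineX V β a n) (fineY V β a n)

theorem fineBond_eq (V : ℝ[X]) (β a : ℝ) (n l : ℕ) :
    fineBond V β a n l = phi V (nodePt n l) + bondCorr V β a l (nodePt n l) / n := by
  simp only [fineBond, interlace, fineX, fineY, nodePt, bondCorr]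
  split_ifs <;> rfl

theorem neg_one_pow_eq (l : ℕ) : (-1 : ℝ) ^ l = if l % 2 = 0 then 1 else -1 := by
  split_ifs with h
  · exact Even.neg_one_pow (Nat.even_iff.2 h)
  · exact Odd.neg_one_pow (Nat.odd_iff.2 (by omega))

/-- The weights `x k` and `y k` are both evaluated at `k / n`, although their bonds are half a
lattice unit apart; the even bond is displaced by `1 / (2 n)`. -/
theorem nodePt_eq {n : ℕ} (hn : 1 ≤ n) (l : ℕ) :
    nodePt n l = bondPt n l + (1 + (-1) ^ l) / (4 * n) := by
  have hn' : (n : ℝ) ≠ 0 := by positivity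
  rw [nodePt, bondPt, neg_one_pow_eq]
  split_ifs with h
  · obtain ⟨k, rfl⟩ : ∃ k, l = 2 * k := ⟨l / 2, by omega⟩
    have : 2 * k / 2 = k := by omega
    rw [this]; push_cast; field_simp; ring
  · obtain ⟨k, rfl⟩ : ∃ k, l = 2 * k + 1 := ⟨l / 2, by omega⟩
    have : (2 * k + 1) / 2 = k := by omega
    rw [this]; push_cast; field_simp; ring

theorem nodePt_le_one {n l : ℕ} (hl : l < 2 * n - 1) : nodePt n l ≤ 1 := by
  have hn : (0 : ℝ) < n := by exact_mod_cast (by omega : 0 < n)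
  rw [nodePt, div_le_one hn]
  exact_mod_cast (by omega : l / 2 + 1 ≤ n)

theorem bondPt_pos {n : ℕ} (hn : 1 ≤ n) (l : ℕ) : 0 < bondPt n l := by
  have hn : (0 : ℝ) < n := by exact_mod_cast hn
  rw [bondPt]; positivity

theorem one_add_neg_one_pow_mem (l : ℕ) : 0 ≤ 1 + (-1 : ℝ) ^ l ∧ 1 + (-1 : ℝ) ^ l ≤ 2 := by
  rw [neg_one_pow_eq]; split_ifs <;> norm_num

theorem bondPt_le_nodePt {n : ℕ} (hn : 1 ≤ n) (l : ℕ) : bondPt n l ≤ nodePt n l := by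
  rw [nodePt_eq hn]
  have := (one_add_neg_one_pow_mem l).1
  have : 0 ≤ (1 + (-1 : ℝ) ^ l) / (4 * n) := by positivity
  linarith

theorem nodePt_le_two_mul {n : ℕ} (hn : 1 ≤ n) (l : ℕ) : nodePt n l ≤ 2 * bondPt n l := by
  have hn' : (0 : ℝ) < n := by exact_mod_cast hn
  rw [nodePt_eq hn]
  have h := (one_add_neg_one_pow_mem l).2
  have h1 : (1 + (-1 : ℝ) ^ l) / (4 * n) ≤ 1 / (2 * n) := by
    rw [div_le_div_iff₀ (by positivity) (by positivity)]; nlinarith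
  have h2 : 1 / (2 * (n : ℝ)) ≤ bondPt n l := by
    rw [bondPt]
    gcongr
    have : (0 : ℝ) ≤ l := by positivity
    linarith
  linarith

theorem bondScale_pos {n : ℕ} (hn : 1 ≤ n) (l : ℕ) : 0 < bondScale n l :=
  Real.sqrt_pos.2 (bondPt_pos hn l)

theorem bondScale_sq {n : ℕ} (hn : 1 ≤ n) (l : ℕ) : bondScale n l ^ 2 = bondPt n l :=
  Real.sq_sqrt (bondPt_pos hn l).le

theorem bondPt_le_one {n l : ℕ} (hl : l < 2 * n - 1) : bondPt n l ≤ 1 :=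
  (bondPt_le_nodePt (by omega) l).trans (nodePt_le_one hl)

theorem bondScale_le_one {n l : ℕ} (hl : l < 2 * n - 1) : bondScale n l ≤ 1 := by
  exact Real.sqrt_le_one.2 (bondPt_le_one hl)

theorem one_div_eq_bondScale {n : ℕ} (hn : 1 ≤ n) (l : ℕ) :
    1 / (n : ℝ) = 2 * bondScale n l ^ 2 / (l + 1) := by
  have hn' : (n : ℝ) ≠ 0 := by positivity
  have : (l : ℝ) + 1 ≠ 0 := by positivity
  rw [bondScale_sq hn, bondPt]; field_simp

theorem bondScale_le_sqrt_nodePt {n : ℕ} (hn : 1 ≤ n) (l : ℕ) :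
    bondScale n l ≤ √(nodePt n l) ∧ √(nodePt n l) ≤ 2 * bondScale n l := by
  refine ⟨Real.sqrt_le_sqrt (bondPt_le_nodePt hn l), ?_⟩
  have h : (0 : ℝ) ≤ 2 * bondScale n l := by have := bondScale_pos hn l; positivity
  refine Real.sqrt_le_iff.2 ⟨h, ?_⟩
  rw [mul_pow, bondScale_sq hn]
  have := bondPt_pos hn l
  linarith [nodePt_le_two_mul hn l]

theorem bondScale_le_of_le {n : ℕ} (k l d : ℕ) (h : k ≤ l + d) :
    bondScale n k ≤ ((d : ℝ) + 1) * bondScale n l := by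
  have e : ((d : ℝ) + 1) * bondScale n l = √(((d : ℝ) + 1) ^ 2 * bondPt n l) := by
    rw [Real.sqrt_mul (by positivity), Real.sqrt_sq (by positivity), bondScale]
  rw [e]
  refine Real.sqrt_le_sqrt ?_
  rw [bondPt, bondPt, ← mul_div_assoc]
  refine div_le_div_of_nonneg_right ?_ (by positivity)
  have h' : (k : ℝ) ≤ l + d := by exact_mod_cast h
  have h1 : (0 : ℝ) ≤ l := by positivity
  have h2 : (0 : ℝ) ≤ d := by positivity
  nlinarith [mul_nonneg h1 h2, mul_nonneg h2 (mul_nonneg h1 h2)]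

variable {V : ℝ[X]} {m : ℝ}

/-- The last term undoes, to first order, the displacement in `nodePt_eq`. Seen from `bondPt`, a
symmetric part proportional to `φ'` and an alternating part proportional to the inverse of the
integral remain; this explains the term `-φ' / 2` in `corrDiff`. -/
theorem Tangent.bondCorr_eq (hm : 0 < m) (hW : Tangent V m) (β a : ℝ) (l : ℕ) {t : ℝ} (ht : 0 < t) :
    bondCorr V β a l t = ((a + 1 / 2 - 2 / β) * phiDeriv V t
      + (-1) ^ l * ((a + 1 / 2) * (intInvPhi V t)⁻¹)) / 2
        - (1 + (-1) ^ l) / 4 * phiDeriv V t := by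
  rw [bondCorr, neg_one_pow_eq]
  split_ifs <;> simp only [corrX, corrY, corrSum, corrDiff, hW.deriv_phi hm ht] <;> ring

theorem Tangent.exists_bondCorr_bounds (hm : 0 < m) (hW : Tangent V m) (β a : ℝ) :
    ∃ C : ℝ, 1 ≤ C ∧
      (∀ (l : ℕ) (t : ℝ), 0 < t → t ≤ 1 → |bondCorr V β a l t| ≤ C / √t) ∧
      (∀ (l : ℕ) (t s : ℝ), 0 < t → t ≤ 1 → t / 2 ≤ s → s ≤ 1 →
        |bondCorr V β a l s - bondCorr V β a l t| ≤ C / √t ^ 3 * |s - t|) := by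
  obtain ⟨C, hC1, hB, hL⟩ := hW.exists_phi_bounds hm
  have hC0 : 0 < C := by linarith
  set A := |a + 1 / 2 - 2 / β| with hA
  set B := |a + 1 / 2| with hB'
  have hA0 : 0 ≤ A := abs_nonneg _
  have hB0 : 0 ≤ B := abs_nonneg _
  have hgen : ∀ (l : ℕ) (x y c : ℝ), |x| ≤ c → |y| ≤ c →
      |((a + 1 / 2 - 2 / β) * x + (-1) ^ l * ((a + 1 / 2) * y)) / 2 - (1 + (-1) ^ l) / 4 * x|
        ≤ (A + B + 1) * c := by
    intro l x y c hx hy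
    have hc : 0 ≤ c := (abs_nonneg x).trans hx
    have h1 : |(a + 1 / 2 - 2 / β) * x| ≤ A * c := by
      rw [abs_mul]; exact mul_le_mul_of_nonneg_left hx hA0
    have h2 : |(-1) ^ l * ((a + 1 / 2) * y)| ≤ B * c := by
      rw [abs_mul, abs_pow, abs_neg, abs_one, one_pow, one_mul, abs_mul]
      exact mul_le_mul_of_nonneg_left hy hB0
    have h3 : |(1 + (-1) ^ l) / 4 * x| ≤ 1 * c := by
      rw [abs_mul]
      have := one_add_neg_one_pow_mem l
      refine mul_le_mul ?_ hx (abs_nonneg _) zero_le_one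
      rw [abs_of_nonneg (by linarith)]; linarith
    refine (abs_sub _ _).trans ?_
    rw [abs_div, abs_two]
    have h4 := abs_add_le ((a + 1 / 2 - 2 / β) * x) ((-1) ^ l * ((a + 1 / 2) * y))
    have := mul_nonneg hA0 hc
    have := mul_nonneg hB0 hc
    nlinarith
  refine ⟨(A + B + 1) * C, by nlinarith, fun l t ht ht1 => ?_, fun l t s ht ht1 hs hs1 => ?_⟩
  · obtain ⟨h1, h2, h3, h4, h5⟩ := hB t ht ht1
    have hst := Real.sqrt_pos.2 ht
    rw [hW.bondCorr_eq hm β a l ht, mul_div_assoc]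
    have hI : 0 < intInvPhi V t := pos_of_mul_pos_right (hst.trans_le h5) hC0.le
    refine hgen l _ _ _ (by rwa [abs_of_pos h3]) ?_
    rw [abs_of_pos (inv_pos.2 hI), inv_le_comm₀ hI (by positivity), inv_div, div_le_iff₀ hC0]
    linarith
  · have hs0 : 0 < s := by linarith
    obtain ⟨h1, h2, h3⟩ := hL t s ht ht1 hs hs1
    rw [hW.bondCorr_eq hm β a l ht, hW.bondCorr_eq hm β a l hs0]
    have := hgen l _ _ _ h2 h3
    refine (le_of_eq ?_).trans (this.trans (le_of_eq ?_))
    · congr 1; ring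
    · ring

theorem Tangent.exists_fineBond_bounds (hm : 0 < m) (hW : Tangent V m) (β a : ℝ) :
    ∃ C : ℝ, 1 ≤ C ∧ ∃ L : ℕ, ∀ n l : ℕ, l < 2 * n - 1 →
      bondScale n l ≤ C * phi V (nodePt n l) ∧ phi V (nodePt n l) ≤ C * bondScale n l ∧
      |fineBond V β a n l - phi V (nodePt n l)| ≤ C * (bondScale n l / (l + 1)) ∧
      (L ≤ l → bondScale n l ≤ C * fineBond V β a n l) := by
  obtain ⟨C, hC1, hB, -⟩ := hW.exists_phi_bounds hm
  obtain ⟨C', hC1', hB', -⟩ := hW.exists_bondCorr_bounds hm β a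
  have hC0 : 0 < C := by linarith
  have hC0' : 0 < C' := by linarith
  -- From this index on the correction is at most half of the lower bound for `φ`, so the fine
  -- minimizer is positive and of natural size. Nearer to the origin it may fail to be positive.
  refine ⟨2 * C + 2 * C', by linarith, ⌈4 * C * C'⌉₊, fun n l hl => ?_⟩
  have hn : 1 ≤ n := by omega
  have hs := bondScale_pos hn l
  have hu0 : 0 < nodePt n l := (bondPt_pos hn l).trans_le (bondPt_le_nodePt hn l)
  obtain ⟨b1, b2, -⟩ := hB _ hu0 (nodePt_le_one hl)
  obtain ⟨s1, s2⟩ := bondScale_le_sqrt_nodePt hn l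
  have hphi := hW.phi_pos hm hu0
  have hl1 : (0 : ℝ) < l + 1 := by positivity
  have hdiff : |fineBond V β a n l - phi V (nodePt n l)| ≤ 2 * C' * (bondScale n l / (l + 1)) := by
    rw [fineBond_eq, add_sub_cancel_left, abs_div, Nat.abs_cast]
    have h1 := hB' l _ hu0 (nodePt_le_one hl)
    have h2 : |bondCorr V β a l (nodePt n l)| ≤ C' / bondScale n l :=
      h1.trans (div_le_div_of_nonneg_left hC0'.le hs s1)
    calc |bondCorr V β a l (nodePt n l)| / n ≤ C' / bondScale n l / n :=
          div_le_div_of_nonneg_right h2 (by positivity)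
      _ = C' / bondScale n l * (1 / n) := by ring
      _ = 2 * C' * (bondScale n l / (l + 1)) := by
          rw [one_div_eq_bondScale hn l]; field_simp
  refine ⟨?_, ?_, ?_, fun hL => ?_⟩
  · nlinarith
  · nlinarith
  · refine hdiff.trans (mul_le_mul_of_nonneg_right (by linarith) (by positivity))
  · have hL' : 4 * C * C' ≤ l := (Nat.ceil_le.1 hL)
    have h1 : 2 * C' * (bondScale n l / (l + 1)) ≤ bondScale n l / (2 * C) := by
      rw [← mul_div_assoc, div_le_div_iff₀ hl1 (by positivity)]
      nlinarith
    have h2 : bondScale n l / C ≤ phi V (nodePt n l) := by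
      rw [div_le_iff₀ hC0]; linarith
    have h3 := (abs_le.1 hdiff).1
    have h4 : bondScale n l / (2 * C) ≤ fineBond V β a n l := by
      have : bondScale n l / C = bondScale n l / (2 * C) + bondScale n l / (2 * C) := by
        field_simp; ring
      linarith
    rw [div_le_iff₀ (by positivity)] at h4
    have : 0 < fineBond V β a n l := by
      by_contra hcon
      have : fineBond V β a n l * (2 * C) ≤ 0 :=
        mul_nonpos_of_nonpos_of_nonneg (not_lt.1 hcon) (by positivity)
      linarith
    nlinarith

/-- The fine minimizer to first order around bond `l`. -/
theorem Tangent.exists_fineBond_expansion (hm : 0 < m) (hW : Tangent V m) (β a : ℝ) (D : ℕ) :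
    ∃ C : ℝ, 0 ≤ C ∧ ∀ (n l k : ℕ) (s : ℤ), (k : ℤ) = s + l → |s| ≤ D → 2 * D ≤ l + 1 →
      l < 2 * n - 1 → k < 2 * n - 1 →
      |fineBond V β a n k - (phi V (bondPt n l)
        + ((a + 1 / 2 - 2 / β) * phiDeriv V (bondPt n l) / (2 * n)
          + (-1) ^ l * ((a + 1 / 2) * (intInvPhi V (bondPt n l))⁻¹) / (2 * n) * (-1) ^ s
          + phiDeriv V (bondPt n l) / (2 * n) * s))| ≤ C * (bondScale n l / (l + 1) ^ 2) := by
  obtain ⟨C, hC1, -, hL⟩ := hW.exists_phi_bounds hm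
  obtain ⟨C', hC1', -, hL'⟩ := hW.exists_bondCorr_bounds hm β a
  have hC0 : 0 < C := by linarith
  have hC0' : 0 < C' := by linarith
  refine ⟨4 * C * ((D : ℝ) + 1) ^ 2 + 4 * C' * (D + 1), by positivity,
    fun n l k s hk hs hD hl hkn => ?_⟩
  have hn : 1 ≤ n := by omega
  have hn' : (0 : ℝ) < n := by exact_mod_cast hn
  have hsc := bondScale_pos hn l
  have ht0 := bondPt_pos hn l
  have ht1 := bondPt_le_one hl
  have hkr : (k : ℝ) = s + l := by exact_mod_cast hk
  have hsr : |(s : ℝ)| ≤ D := by exact_mod_cast hs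
  have hpt : nodePt n k - bondPt n l = (s + (1 + (-1) ^ k) / 2) / (2 * n) := by
    rw [nodePt_eq hn, bondPt, bondPt, hkr]; field_simp; ring
  obtain ⟨o1, o2⟩ := one_add_neg_one_pow_mem k
  have hdist : |nodePt n k - bondPt n l| ≤ (D + 1) / (2 * n) := by
    rw [hpt, abs_div, abs_of_pos (by positivity : (0 : ℝ) < 2 * n)]
    refine div_le_div_of_nonneg_right ?_ (by positivity)
    refine (abs_add_le _ _).trans (add_le_add hsr ?_)
    rw [abs_of_nonneg (by linarith)]
    linarith
  -- The Lipschitz bounds around a point `t` hold only to the right of `t / 2`; `2 * D ≤ l + 1`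
  -- keeps all neighbours there.
  have hhalf : bondPt n l / 2 ≤ nodePt n k := by
    refine le_trans ?_ (bondPt_le_nodePt hn k)
    rw [bondPt, bondPt, div_div, div_le_div_iff₀ (by positivity) (by positivity), hkr]
    have h1 : -(D : ℝ) ≤ s := (abs_le.1 hsr).1
    have h2 : 2 * (D : ℝ) ≤ l + 1 := by exact_mod_cast hD
    nlinarith
  obtain ⟨e1, -, -⟩ := hL _ _ ht0 ht1 hhalf (nodePt_le_one hkn)
  have e2 := hL' k _ _ ht0 ht1 hhalf (nodePt_le_one hkn)
  have hroot : √(bondPt n l) = bondScale n l := rfl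
  rw [hroot] at e1 e2
  have hsplit : fineBond V β a n k - (phi V (bondPt n l)
        + ((a + 1 / 2 - 2 / β) * phiDeriv V (bondPt n l) / (2 * n)
          + (-1) ^ l * ((a + 1 / 2) * (intInvPhi V (bondPt n l))⁻¹) / (2 * n) * (-1) ^ s
          + phiDeriv V (bondPt n l) / (2 * n) * s))
      = (phi V (nodePt n k) - phi V (bondPt n l)
          - (nodePt n k - bondPt n l) * phiDeriv V (bondPt n l))
        + (bondCorr V β a k (nodePt n k) - bondCorr V β a k (bondPt n l)) / n := by
    have hsign : (-1 : ℝ) ^ k = (-1) ^ l * (-1) ^ s := by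
      rw [← zpow_natCast, ← zpow_natCast, ← zpow_add₀ (by norm_num), hk, add_comm]
    rw [fineBond_eq, hW.bondCorr_eq hm β a k ht0, hpt, hsign]
    field_simp
    ring
  rw [hsplit]
  have f1 : |phi V (nodePt n k) - phi V (bondPt n l)
      - (nodePt n k - bondPt n l) * phiDeriv V (bondPt n l)|
        ≤ 4 * C * ((D : ℝ) + 1) ^ 2 * (bondScale n l / (l + 1) ^ 2) := by
    have h1 : (nodePt n k - bondPt n l) ^ 2 ≤ (((D : ℝ) + 1) / (2 * n)) ^ 2 := by
      rw [← sq_abs]; exact pow_le_pow_left₀ (abs_nonneg _) hdist 2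
    refine e1.trans ((mul_le_mul_of_nonneg_left h1 (by positivity)).trans ?_)
    have h2 : (((D : ℝ) + 1) / (2 * n)) ^ 2 = (((D : ℝ) + 1) / 2 * (1 / n)) ^ 2 := by
      field_simp
    rw [h2, one_div_eq_bondScale hn l]
    have h3 : C / bondScale n l ^ 3 * (((D : ℝ) + 1) / 2 * (2 * bondScale n l ^ 2 / (l + 1))) ^ 2
        = C * ((D : ℝ) + 1) ^ 2 * (bondScale n l / (l + 1) ^ 2) := by
      field_simp
    rw [h3]
    refine mul_le_mul_of_nonneg_right ?_ (by positivity)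
    have : 0 ≤ C * ((D : ℝ) + 1) ^ 2 := by positivity
    linarith
  have f2 : |(bondCorr V β a k (nodePt n k) - bondCorr V β a k (bondPt n l)) / n|
      ≤ 4 * C' * (D + 1) * (bondScale n l / (l + 1) ^ 2) := by
    rw [abs_div, Nat.abs_cast]
    calc _ ≤ C' / bondScale n l ^ 3 * (((D : ℝ) + 1) / (2 * n)) / n := by gcongr; exact e2.trans (by gcongr)
      _ = C' / bondScale n l ^ 3 * (((D : ℝ) + 1) / 2 * (1 / n) * (1 / n)) := by field_simp
      _ = 2 * C' * (D + 1) * (bondScale n l / (l + 1) ^ 2) := by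
        rw [one_div_eq_bondScale hn l]; field_simp
        try ring
      _ ≤ _ := by
        refine mul_le_mul_of_nonneg_right ?_ (by positivity)
        have : 0 ≤ C' * ((D : ℝ) + 1) := by positivity
        linarith
  refine (abs_add_le _ _).trans ((add_le_add f1 f2).trans (le_of_eq ?_))
  ring

end FineExpansion

end HardEdge

namespace HardEdge

open Polynomial

/-! ### The residual of the approximate minimizer in the critical point equations. -/

section Residual

/-- The fine minimizer, with the first few weights replaced by the coarse ones. -/
noncomputable def approxBond (V : ℝ[X]) (β a : ℝ) (L n l : ℕ) : ℝ :=
  if l < L then phi V (nodePt n l) else fineBond V β a n l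

variable {V : ℝ[X]} {m : ℝ}

/-- Only boundedly many bonds are modified, and there the modification is the correction itself, of
order `bondScale n l / (l + 1)`; one more factor `1 / (l + 1)` costs a constant. -/
theorem Tangent.exists_approxBond_bounds (hm : 0 < m) (hW : Tangent V m) (β a : ℝ) :
    ∃ C : ℝ, 1 ≤ C ∧ ∃ L : ℕ, ∀ n l : ℕ, l < 2 * n - 1 →
      bondScale n l ≤ C * approxBond V β a L n l ∧ 0 < approxBond V β a L n l ∧
      approxBond V β a L n l ≤ C * bondScale n l ∧
      |fineBond V β a n l - approxBond V β a L n l| ≤ C * (bondScale n l / (l + 1) ^ 2) := by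
  obtain ⟨C, hC1, L, h⟩ := hW.exists_fineBond_bounds hm β a
  have hC0 : 0 < C := by linarith
  refine ⟨2 * C + C * L, by nlinarith [Nat.cast_nonneg (α := ℝ) L], L, fun n l hl => ?_⟩
  have hn : 1 ≤ n := by omega
  obtain ⟨h1, h2, h3, h4⟩ := h n l hl
  have hs := bondScale_pos hn l
  have hl1 : (1 : ℝ) ≤ l + 1 := by linarith [Nat.cast_nonneg (α := ℝ) l]
  have hL0 : (0 : ℝ) ≤ L := Nat.cast_nonneg L
  have hCL : 0 ≤ C * L := by positivity
  have hsl : bondScale n l / (l + 1) ≤ bondScale n l := div_le_self hs.le hl1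
  simp only [approxBond]
  split_ifs with hlL
  · have hphi : 0 < phi V (nodePt n l) := pos_of_mul_pos_right (hs.trans_le h1) hC0.le
    refine ⟨by nlinarith, hphi, by nlinarith, h3.trans ?_⟩
    have hlL' : (l : ℝ) + 1 ≤ L := by exact_mod_cast hlL
    have e : bondScale n l / (l + 1) = (l + 1) * (bondScale n l / (l + 1) ^ 2) := by
      field_simp
    rw [e, ← mul_assoc]
    refine mul_le_mul_of_nonneg_right ?_ (by positivity)
    nlinarith
  · have h4 := h4 (by omega)
    have hf : 0 < fineBond V β a n l := pos_of_mul_pos_right (hs.trans_le h4) hC0.le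
    refine ⟨by nlinarith, hf, ?_, ?_⟩
    · have := (abs_le.1 h3).2
      nlinarith
    · rw [sub_self, abs_zero]; positivity

theorem bondWeight_eq {n : ℕ} (hn : 1 ≤ n) (β a : ℝ) (l : ℕ) : bondWeight β a n l
    = bondPt n l + ((a + 1 / 2 - 2 / β) / 2 + (-1) ^ l * ((a + 1 / 2) / 2)) / n := by
  have hn' : (n : ℝ) ≠ 0 := by positivity
  simp only [bondWeight, interlace, xWeight, yWeight, bondPt, neg_one_pow_eq]
  split_ifs with h
  · obtain ⟨k, rfl⟩ : ∃ k, l = 2 * k := ⟨l / 2, by omega⟩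
    have : 2 * k / 2 = k := by omega
    rw [this]; push_cast; field_simp; ring
  · obtain ⟨k, rfl⟩ : ∃ k, l = 2 * k + 1 := ⟨l / 2, by omega⟩
    have : (2 * k + 1) / 2 = k := by omega
    rw [this]; push_cast; field_simp; ring

/-- The first order expansion of `w / z` with exact remainder, `δ` being the intended first order
part of the deviation `ζ`. -/
theorem abs_sub_div_expansion {t φ ζ ω δ : ℝ} (hφ : 0 < φ) (hz : 0 < φ + ζ) :
    (t + ω) / (φ + ζ) - (t / φ + ω / φ - t * δ / φ ^ 2)
      = t * ζ ^ 2 / (φ ^ 2 * (φ + ζ)) - ω * ζ / (φ * (φ + ζ)) - t * (ζ - δ) / φ ^ 2 := by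
  field_simp
  ring

/-- If all weights near bond `l` are of the natural size, then so is the entry of the potential. -/
theorem exists_abs_bondEntry_le_bondScale (V : ℝ[X]) (C : ℝ) (hC : 0 ≤ C) : ∃ C' : ℝ, 0 ≤ C' ∧
    ∀ (n : ℕ) (z : ℕ → ℝ), (∀ l < 2 * n - 1, |z l| ≤ C * bondScale n l) → ∀ l < 2 * n - 1,
      |bondEntry (derivative (V.comp (X ^ 2))) (2 * n - 1) z l| ≤ C' * bondScale n l := by
  set d := 2 * V.natDegree with hd
  obtain ⟨L, hL, h⟩ := exists_abs_bondEntry_le V (C * (d + 1)) (by positivity)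
  refine ⟨L * (C * (d + 1)), by positivity, fun n z hz l hl => ?_⟩
  have hs := bondScale_pos (n := n) (by omega) l
  rw [mul_assoc]
  refine h _ l z _ hl (by positivity) ?_ fun s hs' => ?_
  · exact mul_le_of_le_one_right (by positivity) (bondScale_le_one hl)
  · rw [extend]
    split_ifs with hk
    · have h1 := hz (s + l).toNat (by omega)
      have h2 := bondScale_le_of_le (n := n) (s + l).toNat l d (by
        have := (abs_le.1 hs').2
        omega)
      rw [mul_assoc]
      exact h1.trans (mul_le_mul_of_nonneg_left h2 hC)
    · rw [abs_zero]; positivity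

theorem exists_bondWeight_le (β a : ℝ) : ∃ C : ℝ, 0 ≤ C ∧ ∀ n l : ℕ, 1 ≤ n →
    |bondWeight β a n l| ≤ C * bondScale n l ^ 2 := by
  refine ⟨1 + |a + 1 / 2 - 2 / β| + |a + 1 / 2|, by positivity, fun n l hn => ?_⟩
  have hn' : (0 : ℝ) < n := by exact_mod_cast hn
  have hl : (0 : ℝ) ≤ l := Nat.cast_nonneg l
  rw [bondScale_sq hn, bondWeight_eq hn]
  have h0 := bondPt_pos hn l
  have h1 : 1 / (n : ℝ) ≤ 2 * bondPt n l := by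
    rw [bondPt, ← mul_div_assoc, div_le_div_iff₀ hn' (by positivity)]; nlinarith
  refine (abs_add_le _ _).trans ?_
  rw [abs_of_pos h0, abs_div, Nat.abs_cast]
  have h2 : |(a + 1 / 2 - 2 / β) / 2 + (-1) ^ l * ((a + 1 / 2) / 2)|
      ≤ (|a + 1 / 2 - 2 / β| + |a + 1 / 2|) / 2 := by
    refine (abs_add_le _ _).trans ?_
    rw [abs_mul, abs_pow, abs_neg, abs_one, one_pow, one_mul, abs_div, abs_div, abs_two]
    linarith
  have h3 : |(a + 1 / 2 - 2 / β) / 2 + (-1) ^ l * ((a + 1 / 2) / 2)| / n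
      ≤ (|a + 1 / 2 - 2 / β| + |a + 1 / 2|) / 2 * (2 * bondPt n l) := by
    rw [div_eq_mul_one_div]
    exact mul_le_mul h2 h1 (by positivity) (by positivity)
  linarith

set_option maxHeartbeats 1000000 in
/-- The residual of the fine minimizer in the Euler–Lagrange equations, away from both ends. -/
theorem Tangent.exists_fine_residual_le (hm : 0 < m) (hW : Tangent V m) (β a : ℝ) {C₀ : ℝ}
    (hC₀ : 1 ≤ C₀) {L : ℕ} (hap : ∀ n l : ℕ, l < 2 * n - 1 →
      bondScale n l ≤ C₀ * approxBond V β a L n l ∧ 0 < approxBond V β a L n l) :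
    ∃ C : ℝ, 0 ≤ C ∧ ∀ n l : ℕ, L + 4 * V.natDegree ≤ l → l + 2 * V.natDegree < 2 * n - 1 →
      |bondEntry (derivative (V.comp (X ^ 2))) (2 * n - 1) (approxBond V β a L n) l
        - bondWeight β a n l / approxBond V β a L n l| ≤ C * (bondScale n l / (l + 1) ^ 2) := by
  obtain ⟨C₁, hC₁, hB, -⟩ := hW.exists_phi_bounds hm
  obtain ⟨C₂, hC₂, hE⟩ := hW.exists_fineBond_expansion hm β a (2 * V.natDegree)
  have hC₁0 : 0 < C₁ := by linarith
  have hC₀0 : 0 < C₀ := by linarith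
  set A := |a + 1 / 2 - 2 / β| with hA
  set B := |a + 1 / 2| with hB'
  have hA0 : 0 ≤ A := abs_nonneg _
  have hB0 : 0 ≤ B := abs_nonneg _
  set d : ℝ := ((2 * V.natDegree : ℕ) : ℝ) with hd
  have hd0 : 0 ≤ d := Nat.cast_nonneg _
  set K₁ := (A + B + d) * C₁ + C₂ with hK₁
  have hK₁0 : 0 ≤ K₁ := by positivity
  obtain ⟨L', hL', hX⟩ := exists_bondEntry_expansion V (C₁ + K₁) (by positivity)
  refine ⟨L' * (K₁ ^ 2 + C₂) + (C₁ ^ 2 * C₀ * K₁ ^ 2 + (A + B) * C₁ * C₀ * K₁ + C₁ ^ 2 * C₂),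
    by positivity, fun n l hl hln => ?_⟩
  have hn : 1 ≤ n := by omega
  have hlN : l < 2 * n - 1 := by omega
  have hn' : (0 : ℝ) < n := by exact_mod_cast hn
  have hl1 : (1 : ℝ) ≤ l + 1 := by linarith [Nat.cast_nonneg (α := ℝ) l]
  have hl0 : (0 : ℝ) < l + 1 := by linarith
  set t := bondPt n l with ht
  set s := bondScale n l with hs
  have ht0 : 0 < t := bondPt_pos hn l
  have hs0 : 0 < s := bondScale_pos hn l
  have hs1 : s ≤ 1 := bondScale_le_one hlN
  have hst : s ^ 2 = t := bondScale_sq hn l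
  obtain ⟨b1, b2, b3, b4, b5⟩ := hB t ht0 (bondPt_le_one hlN)
  have hroot : √t = s := rfl
  rw [hroot] at b1 b2 b4 b5
  set φ := phi V t with hφ
  set φ' := phiDeriv V t with hφ'
  set I := intInvPhi V t with hI
  have hφ0 : 0 < φ := hW.phi_pos hm ht0
  have hI0 : 0 < I := pos_of_mul_pos_right (hs0.trans_le b5) hC₁0.le
  set α := (a + 1 / 2 - 2 / β) * φ' / (2 * n) with hα
  set σ := (-1) ^ l * ((a + 1 / 2) * I⁻¹) / (2 * n) with hσ
  set τ := φ' / (2 * n) with hτ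
  set ε := C₂ * (s / (l + 1) ^ 2) with hε
  set η := K₁ * (s / (l + 1)) with hη
  have hinvn : 1 / (n : ℝ) = 2 * s ^ 2 / (l + 1) := one_div_eq_bondScale hn l
  have hscale : C₁ / s / (2 * n) = C₁ * (s / (l + 1)) := by
    have : C₁ / s / (2 * n) = C₁ / s * (1 / n) / 2 := by field_simp
    rw [this, hinvn]; field_simp
  have hsl2 : s / (l + 1) ^ 2 ≤ s / (l + 1) := by
    refine div_le_div_of_nonneg_left hs0.le hl0 ?_
    nlinarith
  have hτb : |τ| ≤ C₁ * (s / (l + 1)) := by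
    rw [hτ, abs_div, abs_of_pos b3, abs_of_pos (by positivity), ← hscale]
    gcongr
  have hαb : |α| ≤ A * (C₁ * (s / (l + 1))) := by
    have : α = (a + 1 / 2 - 2 / β) * τ := by rw [hα, hτ]; ring
    rw [this, abs_mul]
    exact mul_le_mul_of_nonneg_left hτb hA0
  have hσb : |σ| ≤ B * (C₁ * (s / (l + 1))) := by
    rw [hσ, abs_div, abs_mul, abs_pow, abs_neg, abs_one, one_pow, one_mul, abs_mul,
      abs_of_pos (inv_pos.2 hI0), abs_of_pos (by positivity : (0 : ℝ) < 2 * n), mul_div_assoc,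
      ← hscale]
    refine mul_le_mul_of_nonneg_left (div_le_div_of_nonneg_right ?_ (by positivity)) hB0
    rw [inv_le_comm₀ hI0 (by positivity), inv_div, div_le_iff₀ hC₁0]
    linarith
  have hε0 : 0 ≤ ε := by positivity
  have hη0 : 0 ≤ η := by positivity
  -- the weights near bond `l`
  have hZ' : ∀ r : ℤ, |r| ≤ 2 * V.natDegree →
      |extend (2 * n - 1) (approxBond V β a L n) (r + l) - (φ + (α + σ * (-1) ^ r + τ * r))| ≤ ε := by
    intro r hr
    obtain ⟨r1, r2⟩ := abs_le.1 hr
    have hk : ((r + l).toNat : ℤ) = r + l := by omega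
    -- The assumed range of `l` keeps every bond within reach of the walks on the path and beyond
    -- the modified ones.
    rw [← hk, extend_natCast _ (by omega), approxBond, if_neg (by omega)]
    exact hE n l (r + l).toNat r hk (by push_cast; exact hr) (by omega) hlN (by omega)
  have hZ : ∀ r : ℤ, |r| ≤ 2 * V.natDegree →
      |extend (2 * n - 1) (approxBond V β a L n) (r + l) - φ| ≤ η := by
    intro r hr
    have h1 := hZ' r hr
    have hr' : |(r : ℝ)| ≤ d := by rw [hd]; exact_mod_cast hr
    have h2 : |α + σ * (-1) ^ r + τ * r| ≤ (A + B + d) * (C₁ * (s / (l + 1))) := by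
      refine (abs_add_le _ _).trans ((add_le_add_left (abs_add_le _ _) _).trans ?_)
      have e1 : |σ * (-1) ^ r| = |σ| := by
        rw [abs_mul, abs_zpow, abs_neg, abs_one, one_zpow, mul_one]
      have e2 : |τ * r| ≤ C₁ * (s / (l + 1)) * d := by
        rw [abs_mul]; exact mul_le_mul hτb hr' (abs_nonneg _) (by positivity)
      rw [e1]
      linarith
    have e : extend (2 * n - 1) (approxBond V β a L n) (r + l) - φ
        = (extend (2 * n - 1) (approxBond V β a L n) (r + l) - (φ + (α + σ * (-1) ^ r + τ * r)))
          + (α + σ * (-1) ^ r + τ * r) := by ring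
    rw [e]
    refine (abs_add_le _ _).trans ((add_le_add h1 h2).trans ?_)
    have := mul_le_mul_of_nonneg_left hsl2 hC₂
    rw [hε, hη, hK₁]
    linarith
  have hη1 : η ≤ K₁ := by
    rw [hη]
    refine mul_le_of_le_one_right hK₁0 ?_
    rw [div_le_one hl0]; linarith
  have hmain := hX (2 * n - 1) l (approxBond V β a L n) φ α σ τ η ε hlN hφ0
    (by nlinarith) hη0 (by linarith) hε0 hZ hZ'
  rw [(hW.phi_spec hm ht0.le).2] at hmain
  have hηε : η ^ 2 + ε ≤ (K₁ ^ 2 + C₂) * (s / (l + 1) ^ 2) := by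
    have : η ^ 2 = K₁ ^ 2 * (s * (s / (l + 1) ^ 2)) := by rw [hη]; field_simp
    rw [this, hε, add_mul]
    have h1 : s * (s / (l + 1) ^ 2) ≤ 1 * (s / (l + 1) ^ 2) :=
      mul_le_mul_of_nonneg_right hs1 (by positivity)
    have := mul_le_mul_of_nonneg_left h1 (sq_nonneg K₁)
    linarith
  -- the logarithmic term
  have hz0 : extend (2 * n - 1) (approxBond V β a L n) (0 + l) = approxBond V β a L n l := by
    rw [zero_add, extend_natCast _ hlN]
  have hd0' : |(0 : ℤ)| ≤ 2 * V.natDegree := by simp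
  have g1 := hZ 0 hd0'
  have g2 := hZ' 0 hd0'
  rw [hz0] at g1 g2
  simp only [zpow_zero, mul_one, Int.cast_zero, mul_zero, add_zero] at g2
  obtain ⟨p1, p2⟩ := hap n l hlN
  set z := approxBond V β a L n l with hz
  set ζ := z - φ with hζ
  have hzφ : φ + ζ = z := by rw [hζ]; ring
  set ω := ((a + 1 / 2 - 2 / β) / 2 + (-1) ^ l * ((a + 1 / 2) / 2)) / n with hω
  have hw : bondWeight β a n l = t + ω := bondWeight_eq hn β a l
  have hlog := abs_sub_div_expansion (t := t) (ω := ω) (δ := α + σ) hφ0 (ζ := ζ) (by rwa [hzφ])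
  rw [hzφ] at hlog
  have hfd : 2 * (coarse V).derivative.eval (φ ^ 2) = 1 / (φ * φ') := by
    have hpos : 0 < (coarse V).derivative.eval (φ ^ 2) :=
      hm.trans_le (hW.le_coarse_derivative (sq_nonneg _))
    rw [hφ', phiDeriv, ← hφ]
    field_simp
  have hInt : coarseInt V φ = I := (hW.intInvPhi_eq hm ht0.le).symm
  -- The reason for the choice of the corrections. The zeroth orders agree by definition of `φ`, and
  -- the first orders agree because `α / φ' + σ * I = ω`, separately for the constant and the
  -- alternating part.
  have hcancel : t / φ + α * (2 * (coarse V).derivative.eval (φ ^ 2) - t / φ ^ 2)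
      + σ * (coarseInt V φ / φ - t / φ ^ 2) = t / φ + ω / φ - t * (α + σ) / φ ^ 2 := by
    rw [hfd, hInt, hα, hσ, hω]
    field_simp
    ring
  rw [hcancel] at hmain
  have hωb : |ω| ≤ (A + B) * (s ^ 2 / (l + 1)) := by
    have h2 : |(a + 1 / 2 - 2 / β) / 2 + (-1) ^ l * ((a + 1 / 2) / 2)| ≤ (A + B) / 2 := by
      refine (abs_add_le _ _).trans ?_
      rw [abs_mul, abs_pow, abs_neg, abs_one, one_pow, one_mul, abs_div, abs_div, abs_two]
      linarith
    rw [hω, abs_div, Nat.abs_cast, div_eq_mul_one_div, hinvn]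
    calc _ ≤ (A + B) / 2 * (2 * s ^ 2 / (l + 1)) := mul_le_mul_of_nonneg_right h2 (by positivity)
      _ = _ := by ring
  have hinvφ : 1 / φ ≤ C₁ / s := by rw [div_le_div_iff₀ hφ0 hs0]; linarith
  have hinvz : 1 / z ≤ C₀ / s := by rw [div_le_div_iff₀ p2 hs0]; linarith
  have hinvφ2 : 1 / φ ^ 2 ≤ C₁ ^ 2 / s ^ 2 := by
    have := pow_le_pow_left₀ (by positivity) hinvφ 2
    rwa [div_pow, div_pow, one_pow] at this
  have q1 : |t * ζ ^ 2 / (φ ^ 2 * z)| ≤ C₁ ^ 2 * C₀ * K₁ ^ 2 * (s / (l + 1) ^ 2) := by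
    have h1 : ζ ^ 2 ≤ η ^ 2 := by rw [← sq_abs]; exact pow_le_pow_left₀ (abs_nonneg _) g1 2
    rw [abs_of_nonneg (by positivity)]
    calc t * ζ ^ 2 / (φ ^ 2 * z) = t * ζ ^ 2 * (1 / φ ^ 2 * (1 / z)) := by field_simp
      _ ≤ t * η ^ 2 * (C₁ ^ 2 / s ^ 2 * (C₀ / s)) := by gcongr
      _ = _ := by rw [hη, ← hst]; field_simp
  have q2 : |ω * ζ / (φ * z)| ≤ (A + B) * C₁ * C₀ * K₁ * (s / (l + 1) ^ 2) := by
    rw [abs_div, abs_mul, abs_of_pos (by positivity : 0 < φ * z)]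
    calc |ω| * |ζ| / (φ * z) = |ω| * |ζ| * (1 / φ * (1 / z)) := by field_simp
      _ ≤ ((A + B) * (s ^ 2 / (l + 1))) * η * (C₁ / s * (C₀ / s)) := by gcongr
      _ = _ := by rw [hη]; field_simp
  have q3 : |t * (ζ - (α + σ)) / φ ^ 2| ≤ C₁ ^ 2 * C₂ * (s / (l + 1) ^ 2) := by
    have h1 : |ζ - (α + σ)| ≤ ε := by
      have : ζ - (α + σ) = z - (φ + (α + σ)) := by rw [hζ]; ring
      rw [this]; exact g2
    rw [abs_div, abs_mul, abs_of_pos ht0, abs_of_pos (by positivity : 0 < φ ^ 2)]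
    calc t * |ζ - (α + σ)| / φ ^ 2 = t * |ζ - (α + σ)| * (1 / φ ^ 2) := by field_simp
      _ ≤ t * ε * (C₁ ^ 2 / s ^ 2) := by gcongr
      _ = _ := by rw [hε, ← hst]; field_simp
  have hfin : bondEntry (derivative (V.comp (X ^ 2))) (2 * n - 1) (approxBond V β a L n) l
        - bondWeight β a n l / z
      = (bondEntry (derivative (V.comp (X ^ 2))) (2 * n - 1) (approxBond V β a L n) l
          - (t / φ + ω / φ - t * (α + σ) / φ ^ 2))
        - (t * ζ ^ 2 / (φ ^ 2 * z) - ω * ζ / (φ * z) - t * (ζ - (α + σ)) / φ ^ 2) := by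
    rw [hw, ← hlog]; ring
  rw [hfin]
  refine (abs_sub _ _).trans ?_
  have h1 := hmain.trans (mul_le_mul_of_nonneg_left hηε hL')
  have h2 := (abs_sub (t * ζ ^ 2 / (φ ^ 2 * z) - ω * ζ / (φ * z)) (t * (ζ - (α + σ)) / φ ^ 2)).trans
    (add_le_add_left (abs_sub (t * ζ ^ 2 / (φ ^ 2 * z)) (ω * ζ / (φ * z))) _)
  refine (add_le_add h1 (h2.trans (add_le_add (add_le_add q1 q2) q3))).trans (le_of_eq ?_)
  ring

/-- At the left end the crude bound by `bondScale` suffices, as `l` is bounded there. At the right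
end the walks feel the missing bonds, the expansion fails, and the residual is merely bounded. -/
theorem Tangent.exists_residual_bounds (hm : 0 < m) (hW : Tangent V m) (β a : ℝ) :
    ∃ C : ℝ, 1 ≤ C ∧ ∃ L : ℕ, ∀ n l : ℕ, l < 2 * n - 1 →
      (bondScale n l ≤ C * approxBond V β a L n l ∧ 0 < approxBond V β a L n l ∧
        approxBond V β a L n l ≤ C * bondScale n l ∧
        |fineBond V β a n l - approxBond V β a L n l| ≤ C * (bondScale n l / (l + 1) ^ 2)) ∧
      |bondEntry (derivative (V.comp (X ^ 2))) (2 * n - 1) (approxBond V β a L n) l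
        - bondWeight β a n l / approxBond V β a L n l| ≤ C ∧
      (l + 2 * V.natDegree < 2 * n - 1 →
        |bondEntry (derivative (V.comp (X ^ 2))) (2 * n - 1) (approxBond V β a L n) l
          - bondWeight β a n l / approxBond V β a L n l| ≤ C * (bondScale n l / (l + 1) ^ 2)) := by
  obtain ⟨C₀, hC₀, L, hap⟩ := hW.exists_approxBond_bounds hm β a
  have hC₀0 : 0 < C₀ := by linarith
  obtain ⟨C₁, hC₁, hfine⟩ := hW.exists_fine_residual_le hm β a hC₀
    (fun n l hl => ⟨(hap n l hl).1, (hap n l hl).2.1⟩)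
  obtain ⟨C₂, hC₂, hent⟩ := exists_abs_bondEntry_le_bondScale V C₀ hC₀0.le
  obtain ⟨C₃, hC₃, hwt⟩ := exists_bondWeight_le β a
  set Λ := ((L + 4 * V.natDegree : ℕ) : ℝ) with hΛ
  have hΛ0 : 0 ≤ Λ := Nat.cast_nonneg _
  have hcrude : ∀ n l : ℕ, l < 2 * n - 1 →
      |bondEntry (derivative (V.comp (X ^ 2))) (2 * n - 1) (approxBond V β a L n) l
        - bondWeight β a n l / approxBond V β a L n l| ≤ (C₂ + C₃ * C₀) * bondScale n l := by
    intro n l hl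
    have hs := bondScale_pos (n := n) (by omega) l
    obtain ⟨h1, h2, h3, -⟩ := hap n l hl
    have e1 := hent n (approxBond V β a L n) (fun k hk => by
      rw [abs_of_pos (hap n k hk).2.1]; exact (hap n k hk).2.2.1) l hl
    have e2 := hwt n l (by omega)
    have e3 : |bondWeight β a n l / approxBond V β a L n l| ≤ C₃ * C₀ * bondScale n l := by
      rw [abs_div, abs_of_pos h2, div_le_iff₀ h2]
      refine e2.trans ?_
      have := mul_le_mul_of_nonneg_left h1 (by positivity : 0 ≤ C₃ * bondScale n l)
      calc _ = C₃ * bondScale n l * bondScale n l := by ring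
        _ ≤ _ := this
        _ = _ := by ring
    refine (abs_sub _ _).trans ((add_le_add e1 e3).trans (le_of_eq ?_))
    ring
  refine ⟨C₀ + C₁ + (C₂ + C₃ * C₀) + (C₂ + C₃ * C₀) * (Λ + 1) ^ 2, ?_, L, fun n l hl => ?_⟩
  · have : 0 ≤ C₁ + (C₂ + C₃ * C₀) + (C₂ + C₃ * C₀) * (Λ + 1) ^ 2 := by positivity
    linarith
  have hs := bondScale_pos (n := n) (by omega) l
  obtain ⟨h1, h2, h3, h4⟩ := hap n l hl
  have hrest : 0 ≤ C₁ + (C₂ + C₃ * C₀) + (C₂ + C₃ * C₀) * (Λ + 1) ^ 2 := by positivity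
  have hle : C₀ ≤ C₀ + C₁ + (C₂ + C₃ * C₀) + (C₂ + C₃ * C₀) * (Λ + 1) ^ 2 := by linarith
  refine ⟨⟨h1.trans (mul_le_mul_of_nonneg_right hle h2.le), h2,
    h3.trans (mul_le_mul_of_nonneg_right hle hs.le),
    h4.trans (mul_le_mul_of_nonneg_right hle (by positivity))⟩, ?_, fun hln => ?_⟩
  · refine (hcrude n l hl).trans ?_
    have h5 := mul_le_of_le_one_right (by positivity : 0 ≤ C₂ + C₃ * C₀) (bondScale_le_one hl)
    have : 0 ≤ C₀ + C₁ + (C₂ + C₃ * C₀) * (Λ + 1) ^ 2 := by positivity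
    linarith
  · by_cases hL : L + 4 * V.natDegree ≤ l
    · refine (hfine n l hL hln).trans (mul_le_mul_of_nonneg_right ?_ (by positivity))
      have : 0 ≤ C₀ + (C₂ + C₃ * C₀) + (C₂ + C₃ * C₀) * (Λ + 1) ^ 2 := by positivity
      linarith
    · refine (hcrude n l hl).trans ?_
      have hl' : (l : ℝ) + 1 ≤ Λ + 1 := by
        have : (l : ℝ) ≤ Λ := by rw [hΛ]; exact_mod_cast (by omega)
        linarith
      have hl0 : (0 : ℝ) < l + 1 := by positivity
      calc (C₂ + C₃ * C₀) * bondScale n l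
          = (C₂ + C₃ * C₀) * (l + 1) ^ 2 * (bondScale n l / (l + 1) ^ 2) := by field_simp
        _ ≤ (C₂ + C₃ * C₀) * (Λ + 1) ^ 2 * (bondScale n l / (l + 1) ^ 2) := by gcongr
        _ ≤ _ := by
          refine mul_le_mul_of_nonneg_right ?_ (by positivity)
          have : 0 ≤ C₀ + C₁ + (C₂ + C₃ * C₀) := by positivity
          linarith

end Residual

end HardEdge

namespace HardEdge

open Polynomial

/-! ### Exponential stability and the pointwise error. -/

section ErrorBound

theorem sum_exp_neg_abs_le {γ : ℝ} (hγ : 0 < γ) (N j : ℕ) :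
    ∑ l ∈ Finset.range N, Real.exp (-(γ * |(l : ℝ) - j|)) ≤ 2 / (1 - Real.exp (-γ)) := by
  set x := Real.exp (-γ) with hx
  have hx0 : 0 < x := Real.exp_pos _
  have hx1 : x < 1 := Real.exp_lt_one_iff.2 (by linarith)
  have hgeom : ∀ k : ℕ, ∑ i ∈ Finset.range k, x ^ i ≤ 1 / (1 - x) := by
    intro k
    rw [le_div_iff₀ (by linarith), mul_comm, mul_neg_geom_sum]
    linarith [pow_pos hx0 k]
  have h1 : ∑ l ∈ Finset.range (j + 1), Real.exp (-(γ * |(l : ℝ) - j|))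
      = ∑ i ∈ Finset.range (j + 1), x ^ i := by
    rw [← Finset.sum_range_reflect]
    refine Finset.sum_congr rfl fun l hl => ?_
    have hl := Finset.mem_range.1 hl
    have e : j + 1 - 1 - l = j - l := by omega
    rw [e, hx, ← Real.exp_nat_mul, Nat.cast_sub (by omega), abs_of_nonpos (by
      have : 0 ≤ (l : ℝ) := Nat.cast_nonneg l
      linarith)]
    congr 1; ring
  have h2 : ∑ l ∈ Finset.range N, Real.exp (-(γ * |((j + 1 + l : ℕ) : ℝ) - j|))
      ≤ ∑ i ∈ Finset.range N, x ^ i := by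
    refine Finset.sum_le_sum fun l _ => ?_
    rw [hx, ← Real.exp_nat_mul]
    refine Real.exp_le_exp.2 ?_
    push_cast
    rw [abs_of_nonneg (by have : 0 ≤ (l : ℝ) := Nat.cast_nonneg l; linarith)]
    nlinarith
  calc ∑ l ∈ Finset.range N, Real.exp (-(γ * |(l : ℝ) - j|))
      ≤ ∑ l ∈ Finset.range (j + 1 + N), Real.exp (-(γ * |(l : ℝ) - j|)) :=
        Finset.sum_le_sum_of_subset_of_nonneg (Finset.range_mono (by omega))
          fun _ _ _ => (Real.exp_pos _).le
    _ ≤ 1 / (1 - x) + 1 / (1 - x) := by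
        rw [Finset.sum_range_add, h1]
        exact add_le_add (hgeom _) (h2.trans (hgeom _))
    _ = 2 / (1 - x) := by ring

theorem one_div_add_one_sq_le (k : ℕ) (hk : 1 ≤ k) :
    1 / ((k : ℝ) + 1) ^ 2 ≤ 1 / k - 1 / (k + 1) := by
  have hk : (0 : ℝ) < k := by exact_mod_cast hk
  rw [div_sub_div _ _ hk.ne' (by positivity), div_le_div_iff₀ (by positivity) (by positivity)]
  nlinarith

theorem sum_one_div_sq_le (N : ℕ) : ∑ l ∈ Finset.range N, 1 / ((l : ℝ) + 1) ^ 2 ≤ 2 := by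
  have key : ∀ N : ℕ, ∑ l ∈ Finset.range (N + 1), 1 / ((l : ℝ) + 1) ^ 2 ≤ 2 - 1 / ((N : ℝ) + 1) := by
    intro N
    induction N with
    | zero => norm_num
    | succ N ih =>
      rw [Finset.sum_range_succ]
      have h := one_div_add_one_sq_le (N + 1) (by omega)
      push_cast at h ⊢
      linarith
  rcases N with _ | N
  · simp
  have h := key N
  have : 0 ≤ 1 / ((N : ℝ) + 1) := by positivity
  linarith

/-- The logarithmic part of the equation is monotone with the favourable sign, bond by bond, so it
can be dropped even with weights and even though it is singular at zero. -/
theorem IsBondMinimizer.sub_mul_bondEntry_sub_le {W : ℝ[X]} {m : ℝ} (hm : 0 < m)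
    (hW : ∀ s t : ℝ, W.eval t + W.derivative.eval t * (s - t) + m / 2 * (s - t) ^ 2 ≤ W.eval s)
    {N : ℕ} {w z z' : ℕ → ℝ} (hw : ∀ l < N, 0 ≤ w l) (hz : IsBondMinimizer W N w z) {l : ℕ}
    (hl : l < N) (hz' : 0 < z' l) :
    (z l - z' l) * (bondEntry (derivative W) N z l - bondEntry (derivative W) N z' l)
      ≤ |z l - z' l| * |bondEntry (derivative W) N z' l - w l / z' l| := by
  rw [hz.bondEntry_eq hm hW hw hl, ← abs_mul]
  have h := sub_mul_div_sub_div_nonpos (hw l hl) (hz.1 l hl).2 (fun _ => hz')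
  have h2 := neg_abs_le ((z l - z' l) * (bondEntry (derivative W) N z' l - w l / z' l))
  linarith

theorem sum_mul_sq_le_of_sum_mul_le {μ : ℝ} (hμ : 0 < μ) {N : ℕ} {σ e r : ℕ → ℝ}
    (hσ : ∀ l, 0 ≤ σ l) (h : μ * ∑ l ∈ Finset.range N, σ l * e l ^ 2
      ≤ ∑ l ∈ Finset.range N, σ l * (|e l| * |r l|)) :
    ∑ l ∈ Finset.range N, σ l * e l ^ 2
      ≤ 1 / μ ^ 2 * ∑ l ∈ Finset.range N, σ l * r l ^ 2 := by
  have h1 : ∑ l ∈ Finset.range N, σ l * (|e l| * |r l|) ≤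
      μ / 2 * ∑ l ∈ Finset.range N, σ l * e l ^ 2
        + 1 / (2 * μ) * ∑ l ∈ Finset.range N, σ l * r l ^ 2 := by
    rw [Finset.mul_sum, Finset.mul_sum, ← Finset.sum_add_distrib]
    refine Finset.sum_le_sum fun l _ => ?_
    have h2 : |e l| * |r l| ≤ μ / 2 * e l ^ 2 + 1 / (2 * μ) * r l ^ 2 := by
      rw [← sq_abs (e l), ← sq_abs (r l)]
      have h3 : μ / 2 * |e l| ^ 2 + 1 / (2 * μ) * |r l| ^ 2 - |e l| * |r l|
          = 1 / (2 * μ) * (μ * |e l| - |r l|) ^ 2 := by field_simp; ring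
      have : 0 ≤ 1 / (2 * μ) * (μ * |e l| - |r l|) ^ 2 := by positivity
      linarith
    linarith [mul_le_mul_of_nonneg_left h2 (hσ l)]
  have h4 : μ / 2 * ∑ l ∈ Finset.range N, σ l * e l ^ 2
      ≤ 1 / (2 * μ) * ∑ l ∈ Finset.range N, σ l * r l ^ 2 := by linarith
  calc ∑ l ∈ Finset.range N, σ l * e l ^ 2
      = 2 / μ * (μ / 2 * ∑ l ∈ Finset.range N, σ l * e l ^ 2) := by field_simp
    _ ≤ 2 / μ * (1 / (2 * μ) * ∑ l ∈ Finset.range N, σ l * r l ^ 2) :=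
        mul_le_mul_of_nonneg_left h4 (by positivity)
    _ = _ := by field_simp

/-- Exponential stability: the error of an approximate solution of the critical point equations is
controlled by an exponentially weighted sum of the residuals. -/
theorem IsBondMinimizer.exists_sq_error_le {W : ℝ[X]} {m : ℝ} (hm : 0 < m)
    (hW : ∀ s t : ℝ, W.eval t + W.derivative.eval t * (s - t) + m / 2 * (s - t) ^ 2 ≤ W.eval s)
    {K : ℝ} (hK : 0 ≤ K) :
    ∃ γ : ℝ, 0 < γ ∧ ∀ (N : ℕ) (w z z' : ℕ → ℝ), (∀ l < N, 0 ≤ w l) →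
      IsBondMinimizer W N w z → (∀ l < N, |z l| ≤ K) → (∀ l < N, |z' l| ≤ K) →
      (∀ l < N, 0 < z' l) → ∀ j < N, (z j - z' j) ^ 2 ≤ 20 / m ^ 2 *
        ∑ l ∈ Finset.range N, Real.exp (-(2 * γ * |(l : ℝ) - j|)) *
          (bondEntry (derivative W) N z' l - w l / z' l) ^ 2 := by
  set D := divDiffConst (derivative W) (4 * K)
  -- Small enough for the perturbation to consume at most half of the convexity constant.
  set η := min 1 (m / (2 * (|D| + 1))) with hη
  have hη0 : 0 < η := lt_min one_pos (by positivity)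
  have hη1 : η ≤ 1 := min_le_left _ _
  have hDη : D * η ≤ m / 2 := by
    calc D * η ≤ (|D| + 1) * (m / (2 * (|D| + 1))) :=
          mul_le_mul ((le_abs_self D).trans (by linarith)) (min_le_right _ _) hη0.le (by positivity)
      _ = m / 2 := by field_simp
  set γ := Real.log (1 + η) with hγ
  have hγ0 : 0 < γ := Real.log_pos (by linarith)
  have heγ : Real.exp γ = 1 + η := Real.exp_log (by linarith)
  refine ⟨γ, hγ0, fun N w z z' hw hz hzK hzK' hpos j hj => ?_⟩
  -- The weight is centred at the bond of interest; `γ = log (1 + η)` makes neighbouring ratios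
  -- differ from `1` by at most `η`.
  set ρ : ℕ → ℝ := fun v => Real.exp (-(γ * |(v : ℝ) - j|)) with hρ
  have hρ0 : ∀ v, 0 < ρ v := fun v => Real.exp_pos _
  have hexp : ∀ t : ℝ, |t| ≤ 1 → |Real.exp (γ * t) - 1| ≤ η := by
    intro t ht
    obtain ⟨h1, h2⟩ := abs_le.1 ht
    have u1 : Real.exp (γ * t) ≤ 1 + η := by rw [← heγ]; exact Real.exp_le_exp.2 (by nlinarith)
    have u2 : Real.exp (-γ) ≤ Real.exp (γ * t) := Real.exp_le_exp.2 (by nlinarith)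
    have u3 : 1 - η ≤ Real.exp (-γ) := by
      rw [Real.exp_neg, heγ, ← one_div, le_div_iff₀ (by linarith)]; nlinarith
    rw [abs_le]; constructor <;> linarith
  have hdiff : ∀ v : ℕ, |(|((v + 1 : ℕ) : ℝ) - j| - |(v : ℝ) - j|)| ≤ 1 := by
    intro v
    refine (abs_abs_sub_abs_le _ _).trans ?_
    push_cast
    rw [show (v : ℝ) + 1 - j - (v - j) = 1 by ring, abs_one]
  have hρ1 : ∀ v, |ρ v / ρ (v + 1) - 1| ≤ η := by
    intro v
    have := hexp _ (hdiff v)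
    rwa [show γ * (|((v + 1 : ℕ) : ℝ) - j| - |(v : ℝ) - j|)
      = -(γ * |(v : ℝ) - j|) - -(γ * |((v + 1 : ℕ) : ℝ) - j|) by ring, Real.exp_sub] at this
  have hρ2 : ∀ v, |ρ (v + 1) / ρ v - 1| ≤ η := by
    intro v
    have h := hdiff v
    rw [← abs_neg] at h
    have := hexp _ h
    rwa [show γ * -(|((v + 1 : ℕ) : ℝ) - j| - |(v : ℝ) - j|)
      = -(γ * |((v + 1 : ℕ) : ℝ) - j|) - -(γ * |(v : ℝ) - j|) by ring, Real.exp_sub] at this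
  have hmono := weighted_bondEntry_monotone hW hK hη0.le hη1 hzK hzK' hρ0 hρ1 hρ2
  set σ : ℕ → ℝ := fun l => ρ l ^ 2 + ρ (l + 1) ^ 2 with hσ
  have hσ0 : ∀ l, 0 ≤ σ l := fun l => by positivity
  have hsum0 : 0 ≤ ∑ l ∈ Finset.range N, σ l * (z l - z' l) ^ 2 :=
    Finset.sum_nonneg fun l _ => mul_nonneg (hσ0 l) (sq_nonneg _)
  have hstab : m / 2 * ∑ l ∈ Finset.range N, σ l * (z l - z' l) ^ 2
      ≤ ∑ l ∈ Finset.range N, σ l * (|z l - z' l| *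
        |bondEntry (derivative W) N z' l - w l / z' l|) :=
    calc m / 2 * ∑ l ∈ Finset.range N, σ l * (z l - z' l) ^ 2
        ≤ (m - D * η) * ∑ l ∈ Finset.range N, σ l * (z l - z' l) ^ 2 :=
          mul_le_mul_of_nonneg_right (by linarith) hsum0
      _ ≤ _ := hmono
      _ ≤ _ := Finset.sum_le_sum fun l hl => mul_le_mul_of_nonneg_left
          (hz.sub_mul_bondEntry_sub_le hm hW hw (Finset.mem_range.1 hl)
            (hpos l (Finset.mem_range.1 hl))) (hσ0 l)
  have h1 := sum_mul_sq_le_of_sum_mul_le (e := fun l => z l - z' l)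
    (r := fun l => bondEntry (derivative W) N z' l - w l / z' l) (half_pos hm) hσ0 hstab
  have hσj : 1 ≤ σ j := by
    have : ρ j = 1 := by simp [hρ]
    simp only [hσ, this]; nlinarith [sq_nonneg (ρ (j + 1))]
  -- Neighbouring weights differ by a factor of at most two, which gives `1 + 4 = 5`; with `1 / (m /
  -- 2) ^ 2` this is the constant `20 / m ^ 2`.
  have hσle : ∀ l, σ l ≤ 5 * Real.exp (-(2 * γ * |(l : ℝ) - j|)) := by
    intro l
    have e1 : Real.exp (-(2 * γ * |(l : ℝ) - j|)) = ρ l ^ 2 := by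
      rw [hρ, ← Real.exp_nat_mul]; congr 1; push_cast; ring
    have e2 : ρ (l + 1) ≤ 2 * ρ l := by
      have h := (abs_le.1 (hρ2 l)).2
      have : ρ (l + 1) / ρ l ≤ 2 := by linarith
      rwa [div_le_iff₀ (hρ0 l)] at this
    rw [e1]
    have := mul_self_le_mul_self (hρ0 (l + 1)).le e2
    simp only [hσ]; nlinarith
  calc (z j - z' j) ^ 2 ≤ σ j * (z j - z' j) ^ 2 := le_mul_of_one_le_left (sq_nonneg _) hσj
    _ ≤ ∑ l ∈ Finset.range N, σ l * (z l - z' l) ^ 2 :=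
        Finset.single_le_sum (f := fun l => σ l * (z l - z' l) ^ 2)
          (fun l _ => mul_nonneg (hσ0 l) (sq_nonneg _)) (Finset.mem_range.2 hj)
    _ ≤ _ := h1
    _ ≤ 1 / (m / 2) ^ 2 * ∑ l ∈ Finset.range N, 5 * (Real.exp (-(2 * γ * |(l : ℝ) - j|)) *
          (bondEntry (derivative W) N z' l - w l / z' l) ^ 2) := by
        refine mul_le_mul_of_nonneg_left (Finset.sum_le_sum fun l _ => ?_) (by positivity)
        rw [← mul_assoc]
        exact mul_le_mul_of_nonneg_right (hσle l) (sq_nonneg _)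
    _ = _ := by rw [← Finset.mul_sum, ← mul_assoc]; congr 1; field_simp; norm_num

theorem one_add_pow_three_mul_exp_le {γ : ℝ} (hγ : 0 < γ) {k : ℝ} (hk : 0 ≤ k) :
    (1 + k) ^ 3 * Real.exp (-(γ * k)) ≤ 6 / γ ^ 3 * Real.exp γ := by
  have h := Real.pow_div_factorial_le_exp (γ * (1 + k)) (by positivity) 3
  have e : Real.exp (γ * (1 + k)) = Real.exp γ * Real.exp (γ * k) := by
    rw [← Real.exp_add]; ring_nf
  rw [e, mul_pow, show (Nat.factorial 3 : ℝ) = 6 by norm_num [Nat.factorial],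
    div_le_iff₀ (by norm_num)] at h
  rw [Real.exp_neg, ← div_eq_mul_inv, div_le_iff₀ (Real.exp_pos _), div_mul_eq_mul_div,
    div_mul_eq_mul_div, le_div_iff₀ (by positivity)]
  linarith

/-- Half of the decay rate is spent on replacing the residual at `l` by its analogue at `j`, at the
price of a polynomial factor in the distance, or on reaching the right end. The other half is kept
to make the sum over `l` converge. -/
theorem exp_mul_sq_residual_le {γ C : ℝ} (hγ : 0 < γ) (d : ℕ) {n j l : ℕ}
    (hn : 1 ≤ n) {r : ℝ} (hr : |r| ≤ C)
    (hr' : l + d < 2 * n - 1 → |r| ≤ C * (bondScale n l / (l + 1) ^ 2)) :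
    Real.exp (-(2 * γ * |(l : ℝ) - j|)) * r ^ 2 ≤
      (C ^ 2 * (6 / γ ^ 3 * Real.exp γ + Real.exp (γ * (d + 1)))) *
        ((bondScale n j / (j + 1) ^ 2) ^ 2 + Real.exp (-(γ * (2 * n - j)))) *
          Real.exp (-(γ * |(l : ℝ) - j|)) := by
  set k := |(l : ℝ) - j| with hk
  have hk0 : 0 ≤ k := abs_nonneg _
  have hn' : (0 : ℝ) < n := by exact_mod_cast hn
  have hE := Real.exp_pos (-(γ * k))
  have hEj := Real.exp_pos (-(γ * (2 * n - j)))
  have hEd := Real.exp_pos (γ * (d + 1))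
  have hM : 0 < 6 / γ ^ 3 * Real.exp γ := by positivity
  have e2 : Real.exp (-(2 * γ * k)) = Real.exp (-(γ * k)) * Real.exp (-(γ * k)) := by
    rw [← Real.exp_add]; ring_nf
  have hS : ∀ i : ℕ, (bondScale n i / (i + 1) ^ 2) ^ 2 = 1 / (2 * n) * (1 / ((i : ℝ) + 1) ^ 3) := by
    intro i
    rw [div_pow, bondScale_sq hn, bondPt]; field_simp
  set T := (bondScale n j / (j + 1) ^ 2) ^ 2 with hT
  have hT0 : 0 ≤ T := sq_nonneg _
  have hkey : Real.exp (-(γ * k)) * r ^ 2 ≤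
      C ^ 2 * (6 / γ ^ 3 * Real.exp γ * T + Real.exp (γ * (d + 1)) *
        Real.exp (-(γ * (2 * n - j)))) := by
    by_cases h : l + d < 2 * n - 1
    · have h1 : r ^ 2 ≤ C ^ 2 * (bondScale n l / (l + 1) ^ 2) ^ 2 := by
        rw [← sq_abs r, ← mul_pow]; exact pow_le_pow_left₀ (abs_nonneg _) (hr' h) 2
      rw [hS l] at h1
      have h2 : 1 / ((l : ℝ) + 1) ^ 3 ≤ (1 + k) ^ 3 * (1 / ((j : ℝ) + 1) ^ 3) := by
        rw [mul_one_div, div_le_div_iff₀ (by positivity) (by positivity), one_mul, ← mul_pow]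
        refine pow_le_pow_left₀ (by positivity) ?_ 3
        have : (j : ℝ) - l ≤ k := by rw [hk, abs_sub_comm]; exact le_abs_self _
        nlinarith [Nat.cast_nonneg (α := ℝ) l]
      have h3 := one_add_pow_three_mul_exp_le hγ hk0
      calc Real.exp (-(γ * k)) * r ^ 2
          ≤ Real.exp (-(γ * k)) * (C ^ 2 * (1 / (2 * n) *
              ((1 + k) ^ 3 * (1 / ((j : ℝ) + 1) ^ 3)))) := by
            refine mul_le_mul_of_nonneg_left (h1.trans ?_) hE.le
            gcongr
        _ = C ^ 2 * (((1 + k) ^ 3 * Real.exp (-(γ * k))) *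
              (1 / (2 * n) * (1 / ((j : ℝ) + 1) ^ 3))) := by ring
        _ ≤ C ^ 2 * ((6 / γ ^ 3 * Real.exp γ) *
              (1 / (2 * n) * (1 / ((j : ℝ) + 1) ^ 3))) := by gcongr
        _ = C ^ 2 * (6 / γ ^ 3 * Real.exp γ * T) := by rw [hT, hS j]
        _ ≤ _ := by
          refine mul_le_mul_of_nonneg_left ?_ (sq_nonneg C)
          have := mul_pos hEd hEj
          linarith
    · have h1 : r ^ 2 ≤ C ^ 2 := by
        rw [← sq_abs r]; exact pow_le_pow_left₀ (abs_nonneg _) hr 2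
      have h2 : Real.exp (-(γ * k)) ≤ Real.exp (γ * (d + 1)) * Real.exp (-(γ * (2 * n - j))) := by
        rw [← Real.exp_add]
        refine Real.exp_le_exp.2 ?_
        have h3 : (2 * n : ℝ) ≤ l + d + 1 := by
          have : 2 * n ≤ l + d + 1 := by omega
          exact_mod_cast this
        have h4 : (l : ℝ) - j ≤ k := le_abs_self _
        nlinarith
      calc Real.exp (-(γ * k)) * r ^ 2
          ≤ (Real.exp (γ * (d + 1)) * Real.exp (-(γ * (2 * n - j)))) * C ^ 2 := by gcongr
        _ ≤ _ := by
          have := mul_nonneg hM.le hT0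
          nlinarith [mul_nonneg (sq_nonneg C) this]
  rw [e2, mul_assoc, mul_comm (_ * _ : ℝ) (Real.exp (-(γ * k)))]
  refine mul_le_mul_of_nonneg_left (hkey.trans ?_) hE.le
  rw [mul_assoc (C ^ 2)]
  refine mul_le_mul_of_nonneg_left ?_ (sq_nonneg C)
  nlinarith [mul_pos hM hEj, mul_nonneg hEd.le hT0]

variable {V : ℝ[X]} {m : ℝ}

/-- The distance of the minimizer to the fine minimizer, bond by bond. -/
theorem Tangent.exists_abs_sub_fineBond_le (hm : 0 < m) (hW : Tangent V m) {β a : ℝ} (hβ : 1 ≤ β)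
    (ha : 1 / β ≤ 1 + a) :
    ∃ C : ℝ, 1 ≤ C ∧ ∃ γ : ℝ, 0 < γ ∧ ∀ (n : ℕ) (z : ℕ → ℝ),
      IsBondMinimizer (V.comp (X ^ 2)) (2 * n - 1) (bondWeight β a n) z → ∀ l < 2 * n - 1,
        |z l - fineBond V β a n l| ≤
          C * (bondScale n l / (l + 1) ^ 2 + Real.exp (-(γ * (2 * n - l)))) := by
  obtain ⟨C, hC, L, hres⟩ := hW.exists_residual_bounds hm β a
  have hC0 : 0 < C := by linarith
  set d := 2 * V.natDegree with hd
  -- The weighted estimate needs an a priori bound on the minimizer. Unweighted monotonicity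
  -- supplies it: the squared residuals have a sum bounded independently of `n`, with `2` from the
  -- bulk and `d + 1` from the right end.
  set E := √(1 / m ^ 2 * (C ^ 2 * (2 + (d + 1)))) with hE
  obtain ⟨γ, hγ, hstab⟩ := IsBondMinimizer.exists_sq_error_le hm hW (K := C + E) (by positivity)
  set A := C ^ 2 * (6 / γ ^ 3 * Real.exp γ + Real.exp (γ * (d + 1))) with hA
  have hA0 : 0 < A := by positivity
  have hS0 : 0 < 1 - Real.exp (-γ) := by
    have := Real.exp_lt_one_iff.2 (show -γ < 0 by linarith)
    linarith
  set M := 20 / m ^ 2 * (A * (2 / (1 - Real.exp (-γ)))) with hM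
  have hM0 : 0 < M := by positivity
  refine ⟨√M + C, by linarith [Real.sqrt_nonneg M], γ / 2, by positivity, fun n z hz j hj => ?_⟩
  have hn : 1 ≤ n := by omega
  have hw : ∀ l < 2 * n - 1, 0 ≤ bondWeight β a n l := fun l _ => bondWeight_nonneg hβ ha n l
  set z' := approxBond V β a L n with hz'
  set r : ℕ → ℝ := fun l => bondEntry (derivative (V.comp (X ^ 2))) (2 * n - 1) z' l
    - bondWeight β a n l / z' l with hr
  have hpos : ∀ l < 2 * n - 1, 0 < z' l := fun l hl => (hres n l hl).1.2.1
  have hz'C : ∀ l < 2 * n - 1, |z' l| ≤ C := fun l hl => by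
    rw [abs_of_pos (hpos l hl)]
    refine (hres n l hl).1.2.2.1.trans ?_
    have := bondScale_le_one hl
    nlinarith
  have hrC : ∀ l < 2 * n - 1, |r l| ≤ C := fun l hl => (hres n l hl).2.1
  have hrS : ∀ l < 2 * n - 1, l + d < 2 * n - 1 → |r l| ≤ C * (bondScale n l / (l + 1) ^ 2) :=
    fun l hl => (hres n l hl).2.2
  have hrsum : ∑ l ∈ Finset.range (2 * n - 1), r l ^ 2 ≤ C ^ 2 * (2 + (d + 1)) := by
    have h1 : ∀ l ∈ Finset.range (2 * n - 1), r l ^ 2 ≤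
        C ^ 2 * (1 / ((l : ℝ) + 1) ^ 2 + if 2 * n - 1 ≤ l + d then 1 else 0) := by
      intro l hl
      have hl := Finset.mem_range.1 hl
      rw [← sq_abs (r l)]
      by_cases h : l + d < 2 * n - 1
      · rw [if_neg (by omega), add_zero]
        refine (pow_le_pow_left₀ (abs_nonneg _) (hrS l hl h) 2).trans ?_
        rw [mul_pow, div_pow]
        refine mul_le_mul_of_nonneg_left ?_ (sq_nonneg C)
        have h2 : bondScale n l ^ 2 ≤ 1 := pow_le_one₀ (bondScale_pos hn l).le (bondScale_le_one hl)
        have h3 : (1 : ℝ) ≤ (l + 1) ^ 2 := one_le_pow₀ (by linarith [Nat.cast_nonneg (α := ℝ) l])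
        refine div_le_div₀ (by norm_num) h2 (by positivity) ?_
        nlinarith
      · rw [if_pos (by omega)]
        refine (pow_le_pow_left₀ (abs_nonneg _) (hrC l hl) 2).trans ?_
        have : 0 ≤ 1 / ((l : ℝ) + 1) ^ 2 := by positivity
        nlinarith [mul_nonneg (sq_nonneg C) this]
    refine (Finset.sum_le_sum h1).trans ?_
    rw [← Finset.mul_sum, Finset.sum_add_distrib]
    refine mul_le_mul_of_nonneg_left (add_le_add (sum_one_div_sq_le _) ?_) (sq_nonneg C)
    rw [← Finset.sum_filter, Finset.sum_const, nsmul_eq_mul, mul_one]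
    have : (Finset.filter (fun l => 2 * n - 1 ≤ l + d) (Finset.range (2 * n - 1))).card ≤ d + 1 := by
      refine (Finset.card_le_card (t := Finset.Ico (2 * n - 1 - d) (2 * n - 1)) ?_).trans ?_
      · intro l hl
        simp only [Finset.mem_filter, Finset.mem_range, Finset.mem_Ico] at hl ⊢
        omega
      · simp only [Nat.card_Ico]; omega
    exact_mod_cast this
  have hunw : ∀ l < 2 * n - 1, |z l - z' l| ≤ E := by
    have h1 := bondEntry_monotone hW (2 * n - 1) z z'
    have h2 : m * ∑ l ∈ Finset.range (2 * n - 1), (1 : ℝ) * (z l - z' l) ^ 2 ≤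
        ∑ l ∈ Finset.range (2 * n - 1), 1 * (|z l - z' l| * |r l|) := by
      simp only [one_mul]
      exact h1.trans (Finset.sum_le_sum fun l hl =>
        hz.sub_mul_bondEntry_sub_le hm hW hw (Finset.mem_range.1 hl)
          (hpos l (Finset.mem_range.1 hl)))
    have h3 := sum_mul_sq_le_of_sum_mul_le (σ := fun _ => 1) (e := fun l => z l - z' l) (r := r) hm
      (fun _ => zero_le_one) h2
    simp only [one_mul] at h3
    intro l hl
    rw [hE]
    refine Real.abs_le_sqrt ?_
    calc (z l - z' l) ^ 2 ≤ ∑ l ∈ Finset.range (2 * n - 1), (z l - z' l) ^ 2 :=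
          Finset.single_le_sum (f := fun l => (z l - z' l) ^ 2) (fun l _ => sq_nonneg _)
            (Finset.mem_range.2 hl)
      _ ≤ _ := h3
      _ ≤ _ := mul_le_mul_of_nonneg_left hrsum (by positivity)
  have hzK : ∀ l < 2 * n - 1, |z l| ≤ C + E := fun l hl => by
    calc |z l| = |z' l + (z l - z' l)| := by ring_nf
      _ ≤ |z' l| + |z l - z' l| := abs_add_le _ _
      _ ≤ _ := add_le_add (hz'C l hl) (hunw l hl)
  have hzK' : ∀ l < 2 * n - 1, |z' l| ≤ C + E := fun l hl =>
    (hz'C l hl).trans (by linarith [Real.sqrt_nonneg (1 / m ^ 2 * (C ^ 2 * (2 + (d + 1))))])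
  have hsq := hstab (2 * n - 1) _ z z' hw hz hzK hzK' hpos j hj
  set T := bondScale n j / (j + 1) ^ 2 with hT
  have hT0 : 0 ≤ T := div_nonneg (bondScale_pos hn j).le (by positivity)
  set F := Real.exp (-(γ / 2 * (2 * n - j))) with hF
  have hF0 : 0 < F := Real.exp_pos _
  have hF2 : F ^ 2 = Real.exp (-(γ * (2 * n - j))) := by
    rw [hF, ← Real.exp_nat_mul]; congr 1; push_cast; ring
  have hle : (z j - z' j) ^ 2 ≤ M * (T ^ 2 + F ^ 2) := by
    refine hsq.trans ?_
    calc 20 / m ^ 2 * ∑ l ∈ Finset.range (2 * n - 1),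
          Real.exp (-(2 * γ * |(l : ℝ) - j|)) * r l ^ 2
        ≤ 20 / m ^ 2 * ∑ l ∈ Finset.range (2 * n - 1),
            A * (T ^ 2 + F ^ 2) * Real.exp (-(γ * |(l : ℝ) - j|)) := by
          refine mul_le_mul_of_nonneg_left (Finset.sum_le_sum fun l hl => ?_) (by positivity)
          have hl := Finset.mem_range.1 hl
          rw [hF2]
          exact exp_mul_sq_residual_le hγ d hn (hrC l hl) (hrS l hl)
      _ ≤ 20 / m ^ 2 * (A * (T ^ 2 + F ^ 2) * (2 / (1 - Real.exp (-γ)))) := by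
          rw [← Finset.mul_sum]
          have := sum_exp_neg_abs_le hγ (2 * n - 1) j
          gcongr
      _ = M * (T ^ 2 + F ^ 2) := by rw [hM]; ring
  have hfin : |z j - z' j| ≤ √M * (T + F) := by
    refine abs_le_of_sq_le_sq ?_ (by positivity)
    rw [mul_pow, Real.sq_sqrt hM0.le]
    refine hle.trans (mul_le_mul_of_nonneg_left ?_ hM0.le)
    nlinarith [mul_nonneg hT0 hF0.le]
  calc |z j - fineBond V β a n j|
      = |(z j - z' j) + (z' j - fineBond V β a n j)| := by ring_nf
    _ ≤ |z j - z' j| + |fineBond V β a n j - z' j| := by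
        rw [abs_sub_comm (fineBond V β a n j)]; exact abs_add_le _ _
    _ ≤ √M * (T + F) + C * T := add_le_add hfin (hres n j hj).1.2.2.2
    _ ≤ (√M + C) * (T + F) := by nlinarith [mul_pos hC0 hF0]

end ErrorBound

end HardEdge

namespace HardEdge

open Polynomial

/-! ### Relative errors and the three ranges of the index. -/

section Comparison

variable {V : ℝ[X]} {m : ℝ}

/-- Where `bondScale` is small the right end is far away and the exponential is smaller still. This
makes the error from the right end relative to the size of the weights. -/
theorem exp_neg_le_bondScale {γ : ℝ} (hγ : 0 < γ) {n l : ℕ} (hl : l < 2 * n - 1) :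
    Real.exp (-(γ * (2 * n - l))) ≤ 1 / γ * bondScale n l := by
  have hn : 1 ≤ n := by omega
  have hn' : (0 : ℝ) < n := by exact_mod_cast hn
  have hl0 : (0 : ℝ) ≤ l := Nat.cast_nonneg l
  have hl' : (l : ℝ) + 1 < 2 * n := by
    have : l + 1 < 2 * n := by omega
    exact_mod_cast this
  set q := (2 * n - l : ℝ) with hq
  have hq1 : 1 ≤ q := by linarith
  have hs : 1 / q ≤ bondScale n l := by
    rw [bondScale]
    refine Real.le_sqrt_of_sq_le ?_
    rw [bondPt, div_pow, one_pow, div_le_div_iff₀ (by positivity) (by positivity)]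
    nlinarith [mul_nonneg hl0 (sub_nonneg.2 hq1)]
  have hexp : Real.exp (-(γ * q)) ≤ 1 / γ * (1 / q) := by
    rw [Real.exp_neg, ← one_div, one_div_mul_one_div]
    refine one_div_le_one_div_of_le (by positivity) ?_
    linarith [Real.add_one_le_exp (γ * q)]
  exact hexp.trans (mul_le_mul_of_nonneg_left hs (by positivity))

theorem Tangent.exists_abs_sub_fineBond_le_mul (hm : 0 < m) (hW : Tangent V m) {β a : ℝ}
    (hβ : 1 ≤ β) (ha : 1 / β ≤ 1 + a) :
    ∃ C : ℝ, 1 ≤ C ∧ ∃ γ : ℝ, 0 < γ ∧ ∀ (n : ℕ) (z : ℕ → ℝ),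
      IsBondMinimizer (V.comp (X ^ 2)) (2 * n - 1) (bondWeight β a n) z → ∀ l < 2 * n - 1,
        |z l - fineBond V β a n l| ≤
          C * bondScale n l * (1 / (l + 1) ^ 2 + Real.exp (-(γ * (2 * n - l)))) := by
  obtain ⟨C, hC, γ, hγ, h⟩ := hW.exists_abs_sub_fineBond_le hm hβ ha
  refine ⟨C * (1 + 2 / γ), ?_, γ / 2, by positivity, fun n z hz l hl => ?_⟩
  · have : 0 < 2 / γ := by positivity
    nlinarith
  refine (h n z hz l hl).trans ?_
  have h1 := exp_neg_le_bondScale (half_pos hγ) hl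
  have hs := bondScale_pos (show 1 ≤ n by omega) l
  set F := Real.exp (-(γ / 2 * (2 * n - l))) with hF
  have hF0 : 0 < F := Real.exp_pos _
  -- One of the two factors is traded for `bondScale`.
  have e : Real.exp (-(γ * (2 * n - l))) = F * F := by rw [hF, ← Real.exp_add]; ring_nf
  rw [e, mul_assoc C, mul_assoc C]
  refine mul_le_mul_of_nonneg_left ?_ (by linarith)
  have h2 : F * F ≤ 1 / (γ / 2) * bondScale n l * F := mul_le_mul_of_nonneg_right h1 hF0.le
  rw [one_div_div] at h2
  have h3 : 0 ≤ 1 / ((l : ℝ) + 1) ^ 2 := by positivity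
  have h4 : 0 < 2 / γ := by positivity
  rw [div_eq_mul_one_div (bondScale n l)]
  nlinarith [mul_nonneg (mul_nonneg h4.le hs.le) h3, mul_pos hs hF0]

theorem fineDist_le {β a : ℝ} {n : ℕ} {x y : ℕ → ℝ} {i : ℕ} {e : ℝ} (he : 0 ≤ e)
    (hx : |fineX V β a n i - x i| ≤ e) (hy : i < n → |fineY V β a n i - y i| ≤ e) :
    fineDist V β a n x y i ≤ 2 * e := by
  rw [fineDist]
  refine Real.sqrt_le_iff.2 ⟨by positivity, ?_⟩
  have h1 : (fineX V β a n i - x i) ^ 2 ≤ e ^ 2 := sq_le_sq' (abs_le.1 hx).1 (abs_le.1 hx).2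
  split_ifs with h
  · have h2 : (fineY V β a n i - y i) ^ 2 ≤ e ^ 2 :=
      sq_le_sq' (abs_le.1 (hy h)).1 (abs_le.1 (hy h)).2
    nlinarith
  · nlinarith

theorem bondScale_mul_le {γ C : ℝ} (hγ : 0 < γ) (hC : 0 ≤ C) {n i l : ℕ} (hi : 1 ≤ i)
    (hin : i ≤ n) (hl : l < 2 * n - 1) (hli : 2 * i ≤ l + 2) (hli' : l < 2 * i) :
    C * bondScale n l * (1 / (l + 1) ^ 2 + Real.exp (-(γ * (2 * n - l)))) ≤
      C * (1 / Real.sqrt ((n : ℝ) * (i : ℝ) ^ 3) + Real.exp (-(γ * (n - i)))) := by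
  have hn : 1 ≤ n := by omega
  have hn' : (0 : ℝ) < n := by exact_mod_cast hn
  have hi' : (1 : ℝ) ≤ i := by exact_mod_cast hi
  have hin' : (i : ℝ) ≤ n := by exact_mod_cast hin
  have hl1 : 2 * (i : ℝ) ≤ l + 2 := by exact_mod_cast hli
  have hl2 : (l : ℝ) + 1 ≤ 2 * i := by exact_mod_cast hli'
  have hs := bondScale_pos hn l
  have h1 : bondScale n l * (1 / (l + 1) ^ 2) ≤ 1 / Real.sqrt ((n : ℝ) * (i : ℝ) ^ 3) := by
    have e : bondScale n l * (1 / ((l : ℝ) + 1) ^ 2) = Real.sqrt (1 / (2 * n * (l + 1) ^ 3)) := by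
      rw [eq_comm, Real.sqrt_eq_iff_mul_self_eq (by positivity) (by positivity), ← sq, mul_pow,
        bondScale_sq hn, bondPt]
      field_simp
    rw [e, ← Real.sqrt_one, ← Real.sqrt_div zero_le_one, Real.sqrt_one]
    refine Real.sqrt_le_sqrt (one_div_le_one_div_of_le (by positivity) ?_)
    have : (i : ℝ) ^ 3 ≤ (l + 1) ^ 3 := pow_le_pow_left₀ (by linarith) (by linarith) 3
    nlinarith [mul_le_mul_of_nonneg_left this hn'.le, mul_pos hn' (pow_pos (by linarith : (0 : ℝ) < i) 3)]
  have h2 : bondScale n l * Real.exp (-(γ * (2 * n - l))) ≤ Real.exp (-(γ * (n - i))) := by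
    refine (mul_le_of_le_one_left (Real.exp_pos _).le (bondScale_le_one hl)).trans ?_
    refine Real.exp_le_exp.2 (neg_le_neg (mul_le_mul_of_nonneg_left ?_ hγ.le))
    linarith
  rw [mul_assoc, mul_add]
  exact mul_le_mul_of_nonneg_left (add_le_add h1 h2) hC

theorem abs_interlace_sub_le {β a : ℝ} {n : ℕ} {x y : ℕ → ℝ} {F : ℕ → ℝ}
    (h : ∀ l < 2 * n - 1, |interlace x y l - fineBond V β a n l| ≤ F l) {i : ℕ} (hi : 1 ≤ i)
    (hin : i ≤ n) : |fineX V β a n i - x i| ≤ F (2 * i - 2) ∧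
      (i < n → |fineY V β a n i - y i| ≤ F (2 * i - 1)) := by
  constructor
  · have := h (2 * i - 2) (by omega)
    rwa [fineBond, interlace_even _ _ hi, interlace_even _ _ hi, abs_sub_comm] at this
  · intro hlt
    have := h (2 * i - 1) (by omega)
    rwa [fineBond, interlace_odd _ _ hi, interlace_odd _ _ hi, abs_sub_comm] at this

theorem Tangent.exists_fineDist_le (hm : 0 < m) (hW : Tangent V m) {β a : ℝ} (hβ : 1 ≤ β)
    (ha : 1 / β ≤ 1 + a) :
    ∃ C : ℝ, 1 ≤ C ∧ ∃ γ : ℝ, 0 < γ ∧ ∀ (n : ℕ) (x y : ℕ → ℝ) (i : ℕ),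
      IsHamiltonianMinimizer V β a n x y → 1 ≤ i → i ≤ n →
        fineDist V β a n x y i ≤
          C * (1 / Real.sqrt ((n : ℝ) * (i : ℝ) ^ 3) + Real.exp (-(γ * (n - i)))) := by
  obtain ⟨C, hC, γ, hγ, h⟩ := hW.exists_abs_sub_fineBond_le_mul hm hβ ha
  refine ⟨2 * C, by linarith, γ, hγ, fun n x y i hxy hi hin => ?_⟩
  have hz := (isHamiltonianMinimizer_iff V β a (by omega) x y).1 hxy
  obtain ⟨h1, h2⟩ := abs_interlace_sub_le (h n _ hz) hi hin
  rw [mul_assoc]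
  refine fineDist_le (by positivity) (h1.trans ?_) fun hlt => (h2 hlt).trans ?_
  · exact bondScale_mul_le hγ (by linarith) hi hin (by omega) (by omega) (by omega)
  · exact bondScale_mul_le hγ (by linarith) hi hin (by omega) (by omega) (by omega)

/-- Up to a constant, `c log n` is at most `n / 2`: an index in the first range is far from `n`, and
one in the third range is comparable to `n`, also for small `n`. -/
theorem mul_log_le_half_add {c : ℝ} (hc : 0 < c) {u : ℝ} (hu : 0 < u) :
    c * Real.log u ≤ u / 2 + 2 * c ^ 2 := by
  have h1 := Real.log_le_sub_one_of_pos (show 0 < u / (2 * c) by positivity)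
  have h2 := Real.log_le_sub_one_of_pos (show 0 < 2 * c by positivity)
  rw [Real.log_div hu.ne' (by positivity)] at h1
  have h3 : c * (Real.log u - Real.log (2 * c)) ≤ c * (u / (2 * c) - 1) :=
    mul_le_mul_of_nonneg_left h1 hc.le
  have h4 : c * Real.log (2 * c) ≤ c * (2 * c - 1) := mul_le_mul_of_nonneg_left h2 hc.le
  have h5 : c * (u / (2 * c)) = u / 2 := by field_simp
  nlinarith

/-- A bound by `1/√(n i³)` plus a term decaying exponentially away from `n`, split into the three
ranges of the index. -/
theorem exists_range_bounds {C γ c : ℝ} (hC : 0 < C) (hγ : 0 < γ) (hc : 2 / γ ≤ c) :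
    ∃ c' : ℝ, 0 < c' ∧ ∀ n i : ℕ, 1 ≤ i → i ≤ n → ∀ e : ℝ,
      e ≤ C * (1 / Real.sqrt ((n : ℝ) * (i : ℝ) ^ 3) + Real.exp (-(γ * (n - i)))) →
      ((i : ℝ) ≤ c * Real.log n → e ≤ c' * (1 / Real.sqrt n)) ∧
      (c * Real.log n < i → (i : ℝ) ≤ n - c * Real.log n →
        e ≤ c' * (1 / Real.sqrt ((n : ℝ) * (i : ℝ) ^ 3))) ∧
      ((n : ℝ) - c * Real.log n < i → e ≤ c' * Real.exp (-((n : ℝ) - i) / c')) := by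
  have hc0 : 0 < c := lt_of_lt_of_le (by positivity) hc
  have hγc : 2 ≤ γ * c := by
    rw [div_le_iff₀ hγ] at hc; linarith
  set K := 2 * c ^ 2 with hK
  have hK0 : 0 < K := by positivity
  set c' := C * (1 + Real.exp (γ * K) * (2 / γ)) + 2 * C + C * (2 + 2 * K + 1) + 1 / γ + c with hc'
  have hP : 0 < C * (1 + Real.exp (γ * K) * (2 / γ)) := by positivity
  have hQ : 0 < C * (2 + 2 * K + 1) := by positivity
  have hR : 0 < 1 / γ := by positivity
  have hc'0 : 0 < c' := by positivity
  refine ⟨c', hc'0, fun n i hi hin e he => ?_⟩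
  have hi' : (1 : ℝ) ≤ i := by exact_mod_cast hi
  have hin' : (i : ℝ) ≤ n := by exact_mod_cast hin
  have hn1 : (1 : ℝ) ≤ n := hi'.trans hin'
  have hn0 : (0 : ℝ) < n := by linarith
  have hlog := mul_log_le_half_add hc0 hn0
  have hsn : 0 < Real.sqrt n := Real.sqrt_pos.2 hn0
  have hi3 : (1 : ℝ) ≤ (i : ℝ) ^ 3 := one_le_pow₀ hi'
  have hni : 0 < Real.sqrt ((n : ℝ) * (i : ℝ) ^ 3) := Real.sqrt_pos.2 (by positivity)
  refine ⟨fun h => ?_, fun _ h => ?_, fun h => ?_⟩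
  · refine he.trans ?_
    have h1 : 1 / Real.sqrt ((n : ℝ) * (i : ℝ) ^ 3) ≤ 1 / Real.sqrt n :=
      one_div_le_one_div_of_le hsn (Real.sqrt_le_sqrt (by nlinarith))
    have h2 : Real.exp (-(γ * (n - i))) ≤ Real.exp (γ * K) * (2 / γ) * (1 / Real.sqrt n) := by
      have h3 : Real.exp (-(γ * (n - i))) ≤ Real.exp (γ * K) * Real.exp (-(γ * (n / 2))) := by
        rw [← Real.exp_add]
        refine Real.exp_le_exp.2 ?_
        nlinarith
      have h4 : Real.exp (-(γ * (n / 2))) ≤ 2 / γ * (1 / Real.sqrt n) := by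
        have h5 : Real.sqrt n ≤ n := Real.sqrt_le_self_iff.2 (Or.inr hn1)
        have h6 : 2 / γ * (1 / Real.sqrt n) = 1 / (γ * (Real.sqrt n / 2)) := by field_simp
        rw [h6, Real.exp_neg, ← one_div]
        refine one_div_le_one_div_of_le (by positivity) ?_
        have := Real.add_one_le_exp (γ * (n / 2))
        nlinarith
      calc _ ≤ _ := h3
        _ ≤ Real.exp (γ * K) * (2 / γ * (1 / Real.sqrt n)) :=
          mul_le_mul_of_nonneg_left h4 (Real.exp_pos _).le
        _ = _ := by ring
    calc _ ≤ C * (1 / Real.sqrt n + Real.exp (γ * K) * (2 / γ) * (1 / Real.sqrt n)) :=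
          mul_le_mul_of_nonneg_left (add_le_add h1 h2) hC.le
      _ = C * (1 + Real.exp (γ * K) * (2 / γ)) * (1 / Real.sqrt n) := by ring
      _ ≤ _ := mul_le_mul_of_nonneg_right (by linarith) (by positivity)
  · refine he.trans ?_
    -- Since `γ * c ≥ 2`, the exponential is at most `n ^ (-2)` in this range, which is the least
    -- possible value of the right side.
    have h1 : Real.exp (-(γ * (n - i))) ≤ 1 / Real.sqrt ((n : ℝ) * (i : ℝ) ^ 3) := by
      have h2 : Real.exp (-(γ * (n - i))) ≤ Real.exp (-(2 * Real.log n)) := by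
        refine Real.exp_le_exp.2 (neg_le_neg ?_)
        have : c * Real.log n ≤ n - i := by linarith
        have h3 := mul_le_mul_of_nonneg_left this hγ.le
        have h4 := mul_le_mul_of_nonneg_right hγc (Real.log_nonneg hn1)
        linarith
      refine h2.trans ?_
      rw [Real.exp_neg, two_mul, Real.exp_add, Real.exp_log hn0, ← one_div]
      refine one_div_le_one_div_of_le hni (Real.sqrt_le_iff.2 ⟨by positivity, ?_⟩)
      have : (i : ℝ) ^ 3 ≤ (n : ℝ) ^ 3 := pow_le_pow_left₀ (by linarith) hin' 3
      calc (n : ℝ) * (i : ℝ) ^ 3 ≤ n * (n : ℝ) ^ 3 := mul_le_mul_of_nonneg_left this hn0.le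
        _ = _ := by ring
    calc _ ≤ C * (1 / Real.sqrt ((n : ℝ) * (i : ℝ) ^ 3) + 1 / Real.sqrt ((n : ℝ) * (i : ℝ) ^ 3)) :=
          mul_le_mul_of_nonneg_left (add_le_add le_rfl h1) hC.le
      _ = 2 * C * (1 / Real.sqrt ((n : ℝ) * (i : ℝ) ^ 3)) := by ring
      _ ≤ _ := mul_le_mul_of_nonneg_right (by linarith) (by positivity)
  · refine he.trans ?_
    have hnn : 0 ≤ (n : ℝ) - i := by linarith
    have hcc : c ≤ c' := by linarith
    have h1 : Real.exp (-(γ * (n - i))) ≤ Real.exp (-((n : ℝ) - i) / c') := by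
      refine Real.exp_le_exp.2 ?_
      rw [neg_div]
      refine neg_le_neg ?_
      rw [div_le_iff₀ hc'0]
      have : 1 ≤ γ * c' := by
        have h2 : 1 / γ ≤ c' := by linarith
        rw [div_le_iff₀ hγ] at h2; linarith
      nlinarith
    have h2 : 1 / Real.sqrt ((n : ℝ) * (i : ℝ) ^ 3)
        ≤ (2 + 2 * K) * Real.exp (-((n : ℝ) - i) / c') := by
      have h3 : (n : ℝ) ≤ (2 + 2 * K) * i := by nlinarith
      have h4 : 1 / Real.sqrt ((n : ℝ) * (i : ℝ) ^ 3) ≤ (2 + 2 * K) * (1 / n) := by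
        rw [mul_one_div, div_le_div_iff₀ hni hn0, one_mul]
        have h5 : (n : ℝ) ≤ Real.sqrt (((2 + 2 * K) * Real.sqrt ((n : ℝ) * (i : ℝ) ^ 3)) ^ 2) := by
          refine Real.le_sqrt_of_sq_le ?_
          rw [mul_pow, Real.sq_sqrt (by positivity)]
          have h6 : (i : ℝ) ≤ (i : ℝ) ^ 3 := le_self_pow₀ hi' (by norm_num)
          calc (n : ℝ) ^ 2 = n * n := sq _
            _ ≤ n * ((2 + 2 * K) * i) := mul_le_mul_of_nonneg_left h3 hn0.le
            _ ≤ n * ((2 + 2 * K) * (i : ℝ) ^ 3) := by gcongr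
            _ = (2 + 2 * K) * (n * (i : ℝ) ^ 3) := by ring
            _ ≤ (2 + 2 * K) ^ 2 * (n * (i : ℝ) ^ 3) :=
              mul_le_mul_of_nonneg_right (by nlinarith) (by positivity)
        rwa [Real.sqrt_sq (by positivity)] at h5
      -- In the last range `n - i < c log n`, so `c ≤ c'` is what is needed.
      have h7 : 1 / (n : ℝ) ≤ Real.exp (-((n : ℝ) - i) / c') := by
        rw [one_div, ← Real.exp_log hn0, ← Real.exp_neg, Real.exp_log hn0]
        refine Real.exp_le_exp.2 ?_
        rw [neg_div]
        refine neg_le_neg ?_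
        rw [div_le_iff₀ hc'0]
        have := mul_le_mul_of_nonneg_right hcc (Real.log_nonneg hn1)
        linarith
      exact h4.trans (mul_le_mul_of_nonneg_left h7 (by positivity))
    calc _ ≤ C * ((2 + 2 * K) * Real.exp (-((n : ℝ) - i) / c') + Real.exp (-((n : ℝ) - i) / c')) :=
          mul_le_mul_of_nonneg_left (add_le_add h2 h1) hC.le
      _ = C * (2 + 2 * K + 1) * Real.exp (-((n : ℝ) - i) / c') := by ring
      _ ≤ _ := mul_le_mul_of_nonneg_right (by linarith) (Real.exp_pos _).le

end Comparison

end HardEdge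

namespace HardEdge

open Polynomial

/-! ### Lower bounds for the minimizer and expansion of its logarithms. -/

section LogComparison

variable {V : ℝ[X]} {m : ℝ}

theorem Tangent.exists_bondMinimizer_le (hm : 0 < m) (hW : Tangent V m) {β a : ℝ}
    (hβ : 1 ≤ β) (ha : 1 / β ≤ 1 + a) :
    ∃ C : ℝ, 0 < C ∧ ∀ (n : ℕ) (z : ℕ → ℝ),
      IsBondMinimizer (V.comp (X ^ 2)) (2 * n - 1) (bondWeight β a n) z → ∀ l < 2 * n - 1,
        |z l| ≤ C * bondScale n l := by
  obtain ⟨C, hC, γ, hγ, h⟩ := hW.exists_abs_sub_fineBond_le_mul hm hβ ha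
  obtain ⟨C', hC', L, h'⟩ := hW.exists_fineBond_bounds hm β a
  refine ⟨2 * C + 2 * C', by linarith, fun n z hz l hl => ?_⟩
  have hn : 1 ≤ n := by omega
  have hs := bondScale_pos hn l
  obtain ⟨-, h2, h3, -⟩ := h' n l hl
  have h1 := h n z hz l hl
  have hl0 : (0 : ℝ) ≤ l := Nat.cast_nonneg l
  have h4 : 1 / ((l : ℝ) + 1) ^ 2 ≤ 1 := by
    rw [div_le_one (by positivity)]; nlinarith
  have h5 : Real.exp (-(γ * (2 * n - l))) ≤ 1 := by
    rw [Real.exp_le_one_iff]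
    have : (l : ℝ) ≤ 2 * n := by
      have : l ≤ 2 * n := by omega
      exact_mod_cast this
    nlinarith
  have h6 : bondScale n l / (l + 1) ≤ bondScale n l := div_le_self hs.le (by linarith)
  have h7 : |phi V (nodePt n l)| ≤ C' * bondScale n l := by
    rw [abs_of_pos]
    · exact h2
    · exact hW.phi_pos hm ((bondPt_pos hn l).trans_le (bondPt_le_nodePt hn l))
  have h8 : |z l| ≤ |z l - fineBond V β a n l| + |fineBond V β a n l - phi V (nodePt n l)|
      + |phi V (nodePt n l)| := by
    calc |z l| = |(z l - fineBond V β a n l) + (fineBond V β a n l - phi V (nodePt n l))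
          + phi V (nodePt n l)| := by ring_nf
      _ ≤ _ := abs_add_three _ _ _
  have h9 : C * bondScale n l * (1 / ((l : ℝ) + 1) ^ 2 + Real.exp (-(γ * (2 * n - l))))
      ≤ C * bondScale n l * 2 := mul_le_mul_of_nonneg_left (by linarith) (by positivity)
  have h10 := mul_le_mul_of_nonneg_left h6 (show 0 ≤ C' by linarith)
  linarith

/-- Only the coefficients with `k = 1` can degenerate, and they do so exactly in the boundary cases
of the parameters; bonds `l ≥ 2` have `k ≥ 2`. -/
theorem exists_le_bondWeight {β a : ℝ} (hβ : 1 ≤ β) (ha : 1 / β ≤ 1 + a) :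
    ∃ δ : ℝ, 0 < δ ∧ ∀ n l : ℕ, 1 ≤ n → ((1 < β ∧ 1 / β < 1 + a) ∨ 2 ≤ l) →
      δ * nodePt n l ≤ bondWeight β a n l := by
  have hβ0 : 0 < β := by linarith
  have hb : 1 / β ≤ 1 := by rw [div_le_one hβ0]; exact hβ
  have hform : ∀ n l : ℕ, 1 ≤ n → ∀ δ : ℝ,
      (δ * ((l / 2 + 1 : ℕ) : ℝ) ≤ ((l / 2 + 1 : ℕ) : ℝ) + a - 1 / β) →
      (δ * ((l / 2 + 1 : ℕ) : ℝ) ≤ ((l / 2 + 1 : ℕ) : ℝ) - 1 / β) →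
      δ * nodePt n l ≤ bondWeight β a n l := by
    intro n l hn δ h1 h2
    have hn' : (0 : ℝ) < n := by exact_mod_cast hn
    rw [bondWeight, interlace, nodePt, ← mul_div_assoc]
    split_ifs
    · have e : xWeight β a n (l / 2 + 1) = (((l / 2 + 1 : ℕ) : ℝ) + a - 1 / β) / n := by
        rw [xWeight]; field_simp
      rw [e]; exact div_le_div_of_nonneg_right h1 hn'.le
    · have e : yWeight β n (l / 2 + 1) = (((l / 2 + 1 : ℕ) : ℝ) - 1 / β) / n := by
        rw [yWeight]; field_simp
      rw [e]; exact div_le_div_of_nonneg_right h2 hn'.le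
  by_cases hcond : 1 < β ∧ 1 / β < 1 + a
  · have hb' : 1 / β < 1 := by rw [div_lt_one hβ0]; exact hcond.1
    have hd1 : 0 < 1 - 1 / β := by linarith
    have hd2 : 0 < 1 + a - 1 / β := by linarith [hcond.2]
    refine ⟨min 1 (min (1 - 1 / β) (1 + a - 1 / β)), lt_min one_pos (lt_min hd1 hd2),
      fun n l hn _ => ?_⟩
    set δ := min 1 (min (1 - 1 / β) (1 + a - 1 / β)) with hδ
    have e1 : δ ≤ 1 := min_le_left _ _
    have e2 : δ ≤ 1 - 1 / β := (min_le_right _ _).trans (min_le_left _ _)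
    have e3 : δ ≤ 1 + a - 1 / β := (min_le_right _ _).trans (min_le_right _ _)
    have hk : (1 : ℝ) ≤ ((l / 2 + 1 : ℕ) : ℝ) := by
      have : 1 ≤ l / 2 + 1 := by omega
      exact_mod_cast this
    refine hform n l hn δ ?_ ?_ <;> nlinarith
  · refine ⟨1 / 2, by norm_num, fun n l hn h => ?_⟩
    have hl : 2 ≤ l := h.resolve_left hcond
    have hk : (2 : ℝ) ≤ ((l / 2 + 1 : ℕ) : ℝ) := by
      have : 2 ≤ l / 2 + 1 := by omega
      exact_mod_cast this
    refine hform n l hn _ ?_ ?_ <;> linarith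

/-- The error bound alone gives no positivity near the origin. The critical point equation does: the
coefficient is at least of order `bondScale ^ 2` and the entry at most of order `bondScale`, so
their quotient `z l` is at least of order `bondScale`. -/
theorem Tangent.exists_le_bondMinimizer (hm : 0 < m) (hW : Tangent V m) {β a : ℝ}
    (hβ : 1 ≤ β) (ha : 1 / β ≤ 1 + a) :
    ∃ κ : ℝ, 0 < κ ∧ ∀ (n : ℕ) (z : ℕ → ℝ),
      IsBondMinimizer (V.comp (X ^ 2)) (2 * n - 1) (bondWeight β a n) z → ∀ l < 2 * n - 1,
        ((1 < β ∧ 1 / β < 1 + a) ∨ 2 ≤ l) → κ * bondScale n l ≤ z l := by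
  obtain ⟨C, hC, h⟩ := hW.exists_bondMinimizer_le hm hβ ha
  obtain ⟨δ, hδ, hwt⟩ := exists_le_bondWeight hβ ha
  obtain ⟨C', hC', hent⟩ := exists_abs_bondEntry_le_bondScale V C hC.le
  refine ⟨δ / (C' + 1), by positivity, fun n z hz l hl hcond => ?_⟩
  have hn : 1 ≤ n := by omega
  have hs := bondScale_pos hn l
  have hw := hwt n l hn hcond
  have h1 : bondScale n l ^ 2 ≤ nodePt n l := by
    rw [bondScale_sq hn]; exact bondPt_le_nodePt hn l
  have hwpos : 0 < bondWeight β a n l :=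
    lt_of_lt_of_le (mul_pos hδ ((pow_pos hs 2).trans_le h1)) hw
  have hzpos : 0 < z l := (hz.1 l hl).2 hwpos.ne'
  have hG := hent n z (h n z hz) l hl
  rw [hz.bondEntry_eq hm hW (fun l _ => bondWeight_nonneg hβ ha n l) hl,
    abs_of_pos (div_pos hwpos hzpos), div_le_iff₀ hzpos] at hG
  have h2 : δ * bondScale n l ^ 2 ≤ (C' + 1) * bondScale n l * z l := by
    calc δ * bondScale n l ^ 2 ≤ δ * nodePt n l := mul_le_mul_of_nonneg_left h1 hδ.le
      _ ≤ C' * bondScale n l * z l := hw.trans hG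
      _ ≤ _ := by nlinarith [mul_pos hs hzpos]
  rw [div_mul_eq_mul_div, div_le_iff₀ (by positivity)]
  have h3 : bondScale n l * (δ * bondScale n l) ≤ bondScale n l * (z l * (C' + 1)) := by linarith
  exact le_of_mul_le_mul_left h3 hs

theorem abs_log_one_add_sub_le {κ v : ℝ} (hκ : 0 < κ) (hv : κ ≤ 1 + v) :
    |Real.log (1 + v) - v| ≤ v ^ 2 / κ := by
  have hpos : 0 < 1 + v := hκ.trans_le hv
  have h1 := Real.log_le_sub_one_of_pos hpos
  have h2 := Real.one_sub_inv_le_log_of_pos hpos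
  have h3 : 1 - (1 + v)⁻¹ = v - v ^ 2 / (1 + v) := by field_simp; ring
  have h4 : v ^ 2 / (1 + v) ≤ v ^ 2 / κ := div_le_div_of_nonneg_left (sq_nonneg v) hκ hv
  have h5 : 0 ≤ v ^ 2 / κ := by positivity
  rw [abs_le]; constructor <;> linarith

/-- The linear approximation of the logarithm when `v` is within order `ε` of a term `b` whose
square is of order `ε`. In the application `q = 1 / (l + 1)`, so the quadratic error is of the same
order as the error in `v`. -/
theorem abs_log_one_add_sub_le_of_abs_le {κ A B ε q v b : ℝ} (hκ : 0 < κ) (hv : κ ≤ 1 + v)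
    (hε : 0 ≤ ε) (hε2 : ε ≤ 2) (hq : q ^ 2 ≤ ε) (hvb : |v - b| ≤ A * ε) (hb : |b| ≤ B * q) :
    |Real.log (1 + v) - b| ≤ (A + (2 * B ^ 2 + 4 * A ^ 2) / κ) * ε := by
  have hlog := abs_log_one_add_sub_le hκ hv
  have hv2 : v ^ 2 ≤ (2 * B ^ 2 + 4 * A ^ 2) * ε := by
    have q1 : v ^ 2 ≤ 2 * b ^ 2 + 2 * (v - b) ^ 2 := by nlinarith [sq_nonneg (v - 2 * b)]
    have q2 : b ^ 2 ≤ B ^ 2 * ε := by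
      rw [← sq_abs]
      refine (pow_le_pow_left₀ (abs_nonneg _) hb 2).trans ?_
      rw [mul_pow]
      exact mul_le_mul_of_nonneg_left hq (sq_nonneg B)
    have q3 : (v - b) ^ 2 ≤ A ^ 2 * (2 * ε) := by
      rw [← sq_abs]
      refine (pow_le_pow_left₀ (abs_nonneg _) hvb 2).trans ?_
      rw [mul_pow]
      exact mul_le_mul_of_nonneg_left (by nlinarith) (sq_nonneg A)
    linarith
  calc |Real.log (1 + v) - b| = |(Real.log (1 + v) - v) + (v - b)| := by ring_nf
    _ ≤ v ^ 2 / κ + A * ε := (abs_add_le _ _).trans (add_le_add hlog hvb)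
    _ ≤ (2 * B ^ 2 + 4 * A ^ 2) * ε / κ + A * ε := by gcongr
    _ = (A + (2 * B ^ 2 + 4 * A ^ 2) / κ) * ε := by ring

theorem Tangent.exists_abs_log_sub_le (hm : 0 < m) (hW : Tangent V m) {β a : ℝ}
    (hβ : 1 ≤ β) (ha : 1 / β ≤ 1 + a) :
    ∃ C : ℝ, 1 ≤ C ∧ ∃ γ : ℝ, 0 < γ ∧ ∀ (n : ℕ) (z : ℕ → ℝ),
      IsBondMinimizer (V.comp (X ^ 2)) (2 * n - 1) (bondWeight β a n) z → ∀ l < 2 * n - 1,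
        ((1 < β ∧ 1 / β < 1 + a) ∨ 2 ≤ l) → 0 < z l ∧
        |Real.log (z l) - Real.log (phi V (nodePt n l))
          - bondCorr V β a l (nodePt n l) / (n * phi V (nodePt n l))| ≤
            C * (1 / (l + 1) ^ 2 + Real.exp (-(γ * (2 * n - l)))) := by
  obtain ⟨C₁, hC₁, γ, hγ, h1⟩ := hW.exists_abs_sub_fineBond_le_mul hm hβ ha
  obtain ⟨C₂, hC₂, L, h2⟩ := hW.exists_fineBond_bounds hm β a
  obtain ⟨κ, hκ, h3⟩ := hW.exists_le_bondMinimizer hm hβ ha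
  have hC₁0 : 0 < C₁ := by linarith
  have hC₂0 : 0 < C₂ := by linarith
  set A := C₁ * C₂ with hA
  set B := C₂ ^ 2 with hB
  have hA0 : 0 < A := by positivity
  set κ' := min 1 (κ / C₂) with hκ'
  have hκ'0 : 0 < κ' := lt_min one_pos (by positivity)
  refine ⟨A + (2 * B ^ 2 + 4 * A ^ 2) / κ' + 1, ?_, γ, hγ, fun n z hz l hl hcond => ?_⟩
  · have : 0 < (2 * B ^ 2 + 4 * A ^ 2) / κ' := by positivity
    linarith
  have hn : 1 ≤ n := by omega
  have hn' : (0 : ℝ) < n := by exact_mod_cast hn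
  have hs := bondScale_pos hn l
  have hl0 : (0 : ℝ) ≤ l := Nat.cast_nonneg l
  obtain ⟨p1, p2, p3, -⟩ := h2 n l hl
  set t := nodePt n l with ht
  have hφ : 0 < phi V t := hW.phi_pos hm ((bondPt_pos hn l).trans_le (bondPt_le_nodePt hn l))
  have hzl := h3 n z hz l hl hcond
  have hzpos : 0 < z l := (mul_pos hκ hs).trans_le hzl
  refine ⟨hzpos, ?_⟩
  set b := bondCorr V β a l t / (n * phi V t) with hb
  set v := z l / phi V t - 1 with hv
  set ε := 1 / ((l : ℝ) + 1) ^ 2 + Real.exp (-(γ * (2 * n - l))) with hε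
  have hε1 : 0 < 1 / ((l : ℝ) + 1) ^ 2 := by positivity
  have hε2 := Real.exp_pos (-(γ * (2 * n - l)))
  have hε0 : 0 < ε := by positivity
  have hε3 : ε ≤ 2 := by
    have h4 : 1 / ((l : ℝ) + 1) ^ 2 ≤ 1 := by
      rw [div_le_one (by positivity)]; nlinarith
    have h5 : Real.exp (-(γ * (2 * n - l))) ≤ 1 := by
      rw [Real.exp_le_one_iff]
      have : (l : ℝ) ≤ 2 * n := by
        have : l ≤ 2 * n := by omega
        exact_mod_cast this
      nlinarith
    linarith
  have hratio : bondScale n l / phi V t ≤ C₂ := by rw [div_le_iff₀ hφ]; exact p1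
  have hbv : |v - b| ≤ A * ε := by
    have e : v - b = (z l - fineBond V β a n l) / phi V t := by
      rw [fineBond_eq, hv, hb, ← ht]; field_simp; ring
    rw [e, abs_div, abs_of_pos hφ]
    calc |z l - fineBond V β a n l| / phi V t ≤ C₁ * bondScale n l * ε / phi V t :=
          div_le_div_of_nonneg_right (h1 n z hz l hl) hφ.le
      _ = C₁ * ε * (bondScale n l / phi V t) := by ring
      _ ≤ C₁ * ε * C₂ := by gcongr
      _ = A * ε := by rw [hA]; ring
  have hbb : |b| ≤ B * (1 / (l + 1)) := by
    have e : b = (fineBond V β a n l - phi V t) / phi V t := by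
      rw [fineBond_eq, hb, ← ht]; field_simp; ring
    rw [e, abs_div, abs_of_pos hφ]
    calc |fineBond V β a n l - phi V t| / phi V t ≤ C₂ * (bondScale n l / (l + 1)) / phi V t :=
          div_le_div_of_nonneg_right p3 hφ.le
      _ = C₂ * (1 / (l + 1)) * (bondScale n l / phi V t) := by ring
      _ ≤ C₂ * (1 / (l + 1)) * C₂ := by gcongr
      _ = B * (1 / (l + 1)) := by rw [hB]; ring
  have hvκ : κ' ≤ 1 + v := by
    have : κ / C₂ ≤ z l / phi V t := by
      rw [div_le_div_iff₀ hC₂0 hφ]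
      calc κ * phi V t ≤ κ * (C₂ * bondScale n l) := mul_le_mul_of_nonneg_left p2 hκ.le
        _ = κ * bondScale n l * C₂ := by ring
        _ ≤ z l * C₂ := mul_le_mul_of_nonneg_right hzl hC₂0.le
    rw [hv]
    have := (min_le_right 1 (κ / C₂)).trans this
    linarith
  have hlv : Real.log (1 + v) = Real.log (z l) - Real.log (phi V t) := by
    rw [← Real.log_div hzpos.ne' hφ.ne', hv, add_sub_cancel]
  rw [← hlv]
  refine (abs_log_one_add_sub_le_of_abs_le hκ'0 hvκ hε0.le hε3 ?_ hbv hbb).trans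
    (mul_le_mul_of_nonneg_right (by linarith) hε0.le)
  rw [div_pow, one_pow]
  linarith

/-- The logarithm of the ratio of the two weights at one index. -/
theorem Tangent.exists_abs_log_ratio_sub_le (hm : 0 < m) (hW : Tangent V m) {β a : ℝ}
    (hβ : 1 ≤ β) (ha : 1 / β ≤ 1 + a) :
    ∃ C : ℝ, 1 ≤ C ∧ ∃ γ : ℝ, 0 < γ ∧ ∀ (n : ℕ) (x y : ℕ → ℝ) (k : ℕ),
      IsHamiltonianMinimizer V β a n x y → 1 ≤ k → k ≤ n - 1 →
        ((1 < β ∧ 1 / β < 1 + a) ∨ 2 ≤ k) →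
        |Real.log (x k / y k) - corrDiff V a ((k : ℝ) / n) / (n * phi V ((k : ℝ) / n))| ≤
          C * (1 / (k : ℝ) ^ 2 + Real.exp (-(γ * (n - k)))) := by
  obtain ⟨C, hC, γ, hγ, h⟩ := hW.exists_abs_log_sub_le hm hβ ha
  refine ⟨2 * C, by linarith, γ, hγ, fun n x y k hxy hk hkn hcond => ?_⟩
  have hz := (isHamiltonianMinimizer_iff V β a (by omega) x y).1 hxy
  have hx := h n _ hz (2 * k - 2) (by omega) (hcond.imp_right fun h => by omega)
  have hy := h n _ hz (2 * k - 1) (by omega) (hcond.imp_right fun h => by omega)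
  rw [interlace_even _ _ hk] at hx
  rw [interlace_odd _ _ hk] at hy
  -- Both weights of index `k` are compared with `φ` at the same point `k / n`, so `log φ` cancels
  -- in the ratio and only the difference of the corrections is left.
  have n1 : nodePt n (2 * k - 2) = (k : ℝ) / n := by
    rw [nodePt, show (2 * k - 2) / 2 + 1 = k by omega]
  have n2 : nodePt n (2 * k - 1) = (k : ℝ) / n := by
    rw [nodePt, show (2 * k - 1) / 2 + 1 = k by omega]
  have c1 : bondCorr V β a (2 * k - 2) ((k : ℝ) / n) = corrX V β a ((k : ℝ) / n) := by
    rw [bondCorr, if_pos (by omega)]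
  have c2 : bondCorr V β a (2 * k - 1) ((k : ℝ) / n) = corrY V β a ((k : ℝ) / n) := by
    rw [bondCorr, if_neg (by omega)]
  rw [n1, c1] at hx
  rw [n2, c2] at hy
  have hk' : (1 : ℝ) ≤ k := by exact_mod_cast hk
  have hbd : ∀ l : ℕ, 2 * k ≤ l + 2 → l < 2 * k →
      C * (1 / ((l : ℝ) + 1) ^ 2 + Real.exp (-(γ * (2 * n - l)))) ≤
        C * (1 / (k : ℝ) ^ 2 + Real.exp (-(γ * (n - k)))) := by
    intro l h1 h2
    have h1' : 2 * (k : ℝ) ≤ l + 2 := by exact_mod_cast h1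
    have h2' : (l : ℝ) + 1 ≤ 2 * k := by exact_mod_cast h2
    have h3' : (k : ℝ) ≤ n := by
      have : k ≤ n := by omega
      exact_mod_cast this
    refine mul_le_mul_of_nonneg_left (add_le_add ?_ ?_) (by linarith)
    · exact one_div_le_one_div_of_le (by positivity)
        (pow_le_pow_left₀ (by linarith) (by linarith) 2)
    · exact Real.exp_le_exp.2 (neg_le_neg (mul_le_mul_of_nonneg_left (by linarith) hγ.le))
  have hx2 := hx.2.trans (hbd _ (by omega) (by omega))
  have hy2 := hy.2.trans (hbd _ (by omega) (by omega))
  rw [Real.log_div hx.1.ne' hy.1.ne']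
  have e : corrDiff V a ((k : ℝ) / n) / (n * phi V ((k : ℝ) / n)) =
      corrX V β a ((k : ℝ) / n) / (n * phi V ((k : ℝ) / n))
        - corrY V β a ((k : ℝ) / n) / (n * phi V ((k : ℝ) / n)) := by
    rw [← sub_div, corrX, corrY]; congr 1; ring
  rw [e]
  calc _ = |(Real.log (x k) - Real.log (phi V ((k : ℝ) / n))
          - corrX V β a ((k : ℝ) / n) / (n * phi V ((k : ℝ) / n)))
        - (Real.log (y k) - Real.log (phi V ((k : ℝ) / n))
          - corrY V β a ((k : ℝ) / n) / (n * phi V ((k : ℝ) / n)))| := by ring_nf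
    _ ≤ _ := abs_sub _ _
    _ ≤ _ := add_le_add hx2 hy2
    _ = _ := by ring

end LogComparison

end HardEdge

namespace HardEdge

open Polynomial

/-! ### The sum of logarithms as a Riemann sum. -/

section LogSum

variable {V : ℝ[X]} {m : ℝ}

/-- The function whose increments are the limits of the sums of logarithms. -/
noncomputable def logProfile (V : ℝ[X]) (a t : ℝ) : ℝ :=
  (a + 1 / 2) * Real.log (intInvPhi V t) - 1 / 2 * Real.log (phi V t)

theorem Tangent.intInvPhi_pos (hm : 0 < m) (hW : Tangent V m) {t : ℝ} (ht : 0 < t) (ht1 : t ≤ 1) :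
    0 < intInvPhi V t := by
  obtain ⟨C, hC, h, -⟩ := hW.exists_phi_bounds hm
  have h1 := (h t ht ht1).2.2.2.2
  exact pos_of_mul_pos_right ((Real.sqrt_pos.2 ht).trans_le h1) (by linarith)

/-- The two terms of `corrDiff`, divided by `φ`, are the logarithmic derivatives of the integral and
of `φ`, with their coefficients. -/
theorem Tangent.logProfile_hasDerivAt (hm : 0 < m) (hW : Tangent V m) (a : ℝ) {t : ℝ} (ht : 0 < t)
    (ht1 : t ≤ 1) : HasDerivAt (logProfile V a) (corrDiff V a t / phi V t) t := by
  have hφ := hW.phi_pos hm ht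
  have hI := hW.intInvPhi_pos hm ht ht1
  have h1 := ((hW.intInvPhi_hasDerivAt hm ht).log hI.ne').const_mul (a + 1 / 2)
  have h2 := ((hW.phi_hasDerivAt hm ht).log hφ.ne').const_mul (1 / 2)
  refine (h1.sub h2).congr_deriv ?_
  rw [corrDiff, hW.deriv_phi hm ht]
  field_simp

theorem Tangent.logProfile_sub (hm : 0 < m) (hW : Tangent V m) (a : ℝ) {s t : ℝ} (hs : 0 < s)
    (hst : s < t) (ht1 : t ≤ 1) :
    (a / 2 + 1 / 4) * Real.log (theta V t / theta V s) - 1 / 2 * Real.log (phi V t / phi V s)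
      = logProfile V a t - logProfile V a s := by
  have ht : 0 < t := hs.trans hst
  have hIt := hW.intInvPhi_pos hm ht ht1
  have hIs := hW.intInvPhi_pos hm hs (hst.le.trans ht1)
  have hI1 := hW.intInvPhi_pos hm one_pos le_rfl
  have e : theta V t / theta V s = (intInvPhi V t / intInvPhi V s) ^ 2 := by
    rw [theta, theta, kappa]; field_simp
  rw [e, Real.log_pow, Real.log_div hIt.ne' hIs.ne',
    Real.log_div (hW.phi_pos hm ht).ne' (hW.phi_pos hm hs).ne', logProfile, logProfile]
  push_cast; ring

theorem Tangent.exists_slope_bounds (hm : 0 < m) (hW : Tangent V m) (a : ℝ) :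
    ∃ C : ℝ, 0 < C ∧
      (∀ t : ℝ, 0 < t → t ≤ 1 → |corrDiff V a t / phi V t| ≤ C / t) ∧
      (∀ t s : ℝ, 0 < t → t ≤ 1 → t / 2 ≤ s → s ≤ t →
        |corrDiff V a s / phi V s - corrDiff V a t / phi V t| ≤ C / t ^ 2 * |s - t|) := by
  obtain ⟨C, hC, hB, hL⟩ := hW.exists_phi_bounds hm
  obtain ⟨C', hC', hB', hL'⟩ := hW.exists_bondCorr_bounds hm 1 a
  have hC0 : 0 < C := by linarith
  have hC0' : 0 < C' := by linarith
  -- The difference of the corrections does not involve `β`, so the bounds for `β = 1` serve.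
  have hD : ∀ t, corrDiff V a t = bondCorr V 1 a 0 t - bondCorr V 1 a 1 t := by
    intro t
    simp only [bondCorr, corrX, corrY]; norm_num; ring
  have hDb : ∀ t, 0 < t → t ≤ 1 → |corrDiff V a t| ≤ 2 * C' / √t := by
    intro t ht ht1
    rw [hD]
    refine (abs_sub _ _).trans ((add_le_add (hB' 0 t ht ht1) (hB' 1 t ht ht1)).trans (le_of_eq ?_))
    ring
  refine ⟨4 * C' * C + 8 * C' * C ^ 3, by positivity, fun t ht ht1 => ?_,
    fun t s ht ht1 hs hst => ?_⟩
  · have hr := Real.sqrt_pos.2 ht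
    have hφ := hW.phi_pos hm ht
    have h1 := hDb t ht ht1
    have h2 : 1 / phi V t ≤ C / √t := by
      rw [div_le_div_iff₀ hφ hr, one_mul]; exact (hB t ht ht1).1
    have h3 : 0 ≤ C' * C ^ 3 := by positivity
    have h4 : 0 < C' * C := by positivity
    calc |corrDiff V a t / phi V t| = |corrDiff V a t| * (1 / phi V t) := by
          rw [abs_div, abs_of_pos hφ]; ring
      _ ≤ 2 * C' / √t * (C / √t) := by gcongr
      _ = 2 * C' * C / t := by
          rw [div_mul_div_comm, Real.mul_self_sqrt ht.le]
      _ ≤ _ := div_le_div_of_nonneg_right (by nlinarith) ht.le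
  · have hs0 : 0 < s := by linarith
    have hs1 : s ≤ 1 := hst.trans ht1
    have hφs := hW.phi_pos hm hs0
    have hφt := hW.phi_pos hm ht
    set r := √t with hr'
    have hr := Real.sqrt_pos.2 ht
    have hrt : t = r ^ 2 := (Real.sq_sqrt ht.le).symm
    have hδ : |s - t| ≤ r ^ 2 := by
      rw [← hrt, abs_of_nonpos (by linarith)]; linarith
    have h1 : 1 / phi V t ≤ C / r := by
      rw [div_le_div_iff₀ hφt hr, one_mul]; exact (hB t ht ht1).1
    have h2 : 1 / phi V s ≤ 2 * C / r := by
      have h3 : r ≤ 2 * √s := by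
        rw [hr']
        refine Real.sqrt_le_iff.2 ⟨by positivity, ?_⟩
        rw [mul_pow, Real.sq_sqrt hs0.le]; linarith
      rw [div_le_div_iff₀ hφs hr, one_mul]
      linarith [(hB s hs0 hs1).1]
    have hDl : |corrDiff V a s - corrDiff V a t| ≤ 2 * C' / r ^ 3 * |s - t| := by
      have q0 := hL' 0 t s ht ht1 hs hs1
      have q1 := hL' 1 t s ht ht1 hs hs1
      rw [hD, hD]
      calc _ = |(bondCorr V 1 a 0 s - bondCorr V 1 a 0 t)
            - (bondCorr V 1 a 1 s - bondCorr V 1 a 1 t)| := by ring_nf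
        _ ≤ _ := abs_sub _ _
        _ ≤ _ := add_le_add q0 q1
        _ = _ := by ring
    have hφl : |phi V s - phi V t| ≤ 2 * C / r * |s - t| := by
      have q := (hL t s ht ht1 hs hs1).1
      have q2 : |phi V s - phi V t| ≤ C / r ^ 3 * (s - t) ^ 2 + |s - t| * phiDeriv V t := by
        calc |phi V s - phi V t| = |(phi V s - phi V t - (s - t) * phiDeriv V t)
              + (s - t) * phiDeriv V t| := by ring_nf
          _ ≤ _ := abs_add_le _ _
          _ ≤ _ := by
            rw [abs_mul, abs_of_pos (hB t ht ht1).2.2.1]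
            exact add_le_add q le_rfl
      have q3 : C / r ^ 3 * (s - t) ^ 2 ≤ C / r * |s - t| := by
        rw [← sq_abs]
        calc C / r ^ 3 * |s - t| ^ 2 = C / r ^ 3 * |s - t| * |s - t| := by ring
          _ ≤ C / r ^ 3 * r ^ 2 * |s - t| := by gcongr
          _ = _ := by field_simp
      have q4 : |s - t| * phiDeriv V t ≤ |s - t| * (C / r) :=
        mul_le_mul_of_nonneg_left (hB t ht ht1).2.2.2.1 (abs_nonneg _)
      calc _ ≤ _ := q2
        _ ≤ C / r * |s - t| + |s - t| * (C / r) := add_le_add q3 q4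
        _ = _ := by ring
    have e : corrDiff V a s / phi V s - corrDiff V a t / phi V t =
        (corrDiff V a s - corrDiff V a t) * (1 / phi V s)
          - corrDiff V a t * (phi V s - phi V t) * (1 / phi V s) * (1 / phi V t) := by
      field_simp; ring
    rw [e]
    refine (abs_sub _ _).trans ?_
    rw [abs_mul, abs_mul, abs_mul, abs_mul, abs_of_pos (one_div_pos.2 hφs),
      abs_of_pos (one_div_pos.2 hφt)]
    calc _ ≤ 2 * C' / r ^ 3 * |s - t| * (2 * C / r)
          + 2 * C' / r * (2 * C / r * |s - t|) * (2 * C / r) * (C / r) := by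
          have := hDb t ht ht1
          gcongr
      _ = _ := by rw [hrt]; field_simp; ring

theorem Tangent.exists_abs_logProfile_sub_le (hm : 0 < m) (hW : Tangent V m) (a : ℝ) :
    ∃ C : ℝ, 0 < C ∧
      (∀ s t : ℝ, 0 < s → s ≤ t → t ≤ 1 →
        |logProfile V a t - logProfile V a s| ≤ C * (Real.log t - Real.log s)) ∧
      (∀ n k : ℕ, 1 ≤ k → k + 1 ≤ n →
        |logProfile V a ((k + 1 : ℕ) / n) - logProfile V a (k / n)
          - corrDiff V a ((k + 1 : ℕ) / n) / (n * phi V ((k + 1 : ℕ) / n))| ≤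
            C / ((k + 1 : ℕ) : ℝ) ^ 2) ∧
      (∀ n k : ℕ, 1 ≤ k → k ≤ n →
        |corrDiff V a (k / n) / (n * phi V (k / n))| ≤ C / k) := by
  obtain ⟨C, hC, hB, hL⟩ := hW.exists_slope_bounds hm a
  refine ⟨C, hC, fun s t hs hst ht1 => ?_, fun n k hk hkn => ?_, fun n k hk hkn => ?_⟩
  · have hder : ∀ u ∈ Set.Icc s t, HasDerivAt (logProfile V a) (corrDiff V a u / phi V u) u ∧
        HasDerivAt Real.log u⁻¹ u ∧ |corrDiff V a u / phi V u| ≤ C * u⁻¹ := by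
      intro u hu
      have hu0 : 0 < u := hs.trans_le hu.1
      have hu1 : u ≤ 1 := hu.2.trans ht1
      exact ⟨hW.logProfile_hasDerivAt hm a hu0 hu1, Real.hasDerivAt_log hu0.ne', by
        rw [← div_eq_mul_inv]; exact hB u hu0 hu1⟩
    -- The derivative of `logProfile` is at most `C / u` in absolute value, so `C log u ±
    -- logProfile` is monotone; no integral is needed.
    have hmono : ∀ σ : ℝ, |σ| = 1 →
        MonotoneOn (fun u => C * Real.log u - σ * logProfile V a u) (Set.Icc s t) := by
      intro σ hσ
      have hd : ∀ u ∈ Set.Icc s t, HasDerivAt (fun u => C * Real.log u - σ * logProfile V a u)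
          (C * u⁻¹ - σ * (corrDiff V a u / phi V u)) u := fun u hu =>
        ((hder u hu).2.1.const_mul C).sub ((hder u hu).1.const_mul σ)
      refine monotoneOn_of_deriv_nonneg (convex_Icc s t)
        (fun u hu => (hd u hu).continuousAt.continuousWithinAt)
        (fun u hu => (hd u (interior_subset hu)).differentiableAt.differentiableWithinAt)
        (fun u hu => ?_)
      rw [(hd u (interior_subset hu)).deriv]
      have h1 := (hder u (interior_subset hu)).2.2
      have h2 : σ * (corrDiff V a u / phi V u) ≤ |corrDiff V a u / phi V u| := by
        refine (le_abs_self _).trans (le_of_eq ?_)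
        rw [abs_mul, hσ, one_mul]
      linarith
    have h1 := hmono 1 (by simp) ⟨le_rfl, hst⟩ ⟨hst, le_rfl⟩ hst
    have h2 := hmono (-1) (by simp) ⟨le_rfl, hst⟩ ⟨hst, le_rfl⟩ hst
    simp only at h1 h2
    rw [abs_le]; constructor <;> linarith
  · have hn : (0 : ℝ) < n := by
      have : 0 < n := by omega
      exact_mod_cast this
    have hk' : (1 : ℝ) ≤ k := by exact_mod_cast hk
    set t := ((k + 1 : ℕ) : ℝ) / n with ht'
    have htk : t = ((k : ℝ) + 1) / n := by rw [ht']; push_cast; rfl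
    have ht : 0 < t := by rw [htk]; positivity
    have ht1 : t ≤ 1 := by
      rw [ht', div_le_one hn]; exact_mod_cast hkn
    have hsub : (k : ℝ) / n = t - 1 / n := by rw [htk]; ring
    have hs : t / 2 ≤ t - 1 / n := by
      rw [← hsub, htk, div_div, div_le_div_iff₀ (by positivity) hn]; nlinarith
    have hn1 : 0 < 1 / (n : ℝ) := by positivity
    set G := corrDiff V a t / phi V t with hG
    have hder : ∀ u ∈ Set.Icc (t - 1 / n) t, HasDerivWithinAt (fun u => logProfile V a u - G * u)
        (corrDiff V a u / phi V u - G) (Set.Icc (t - 1 / n) t) u := by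
      intro u hu
      have hu0 : 0 < u := by linarith [hu.1]
      have h1 := (hW.logProfile_hasDerivAt hm a hu0 (hu.2.trans ht1)).sub
        ((hasDerivAt_id u).const_mul G)
      rw [mul_one] at h1
      exact h1.hasDerivWithinAt
    have h1 := (convex_Icc (t - 1 / n) t).norm_image_sub_le_of_norm_hasDerivWithin_le
      (C := C / t ^ 2 * (1 / n)) hder (fun u hu => by
        rw [Real.norm_eq_abs]
        refine (hL t u ht ht1 (by linarith [hu.1]) hu.2).trans ?_
        refine mul_le_mul_of_nonneg_left ?_ (by positivity)
        rw [abs_of_nonpos (by linarith [hu.2])]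
        linarith [hu.1])
      ⟨le_rfl, by linarith⟩ ⟨by linarith, le_rfl⟩
    rw [Real.norm_eq_abs, Real.norm_eq_abs, sub_sub_cancel, abs_of_pos hn1] at h1
    rw [hsub]
    have e : corrDiff V a t / (n * phi V t) = G * (1 / n) := by
      rw [hG, div_mul_div_comm, mul_one, mul_comm (n : ℝ)]
    rw [e]
    calc _ = |logProfile V a t - G * t - (logProfile V a (t - 1 / n) - G * (t - 1 / n))| := by
          congr 1; ring
      _ ≤ _ := h1
      _ = _ := by rw [ht']; field_simp
  · have hn : (0 : ℝ) < n := by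
      have : 0 < n := by omega
      exact_mod_cast this
    have hk' : (1 : ℝ) ≤ k := by exact_mod_cast hk
    have h1 := hB (k / n) (by positivity) (by
      rw [div_le_one hn]; exact_mod_cast hkn)
    rw [mul_comm (n : ℝ), ← div_div, abs_div, abs_of_pos hn, div_le_iff₀ hn]
    refine h1.trans (le_of_eq ?_)
    field_simp

/-- Each term is an increment of `P` up to a summable error. The first term has no increment to
match it and is absorbed in the error through the bound on `G k₁`. -/
theorem abs_sum_Icc_sub_le {C γ : ℝ} (hC : 0 ≤ C) (hγ : 0 < γ) {n k₁ k₂ : ℕ} (hk₁ : 1 ≤ k₁)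
    (hk : k₁ ≤ k₂) {f G P : ℕ → ℝ}
    (hf : ∀ k, k₁ ≤ k → k ≤ k₂ →
      |f k - G k| ≤ C * (1 / (k : ℝ) ^ 2 + Real.exp (-(γ * (n - k)))))
    (hG : |G k₁| ≤ C / k₁)
    (hP : ∀ k, k₁ ≤ k → k + 1 ≤ k₂ →
      |P (k + 1) - P k - G (k + 1)| ≤ C / ((k + 1 : ℕ) : ℝ) ^ 2) :
    |∑ k ∈ Finset.Icc k₁ k₂, f k - (P k₂ - P k₁)| ≤
      C * (4 / k₁ + 1 / (1 - Real.exp (-γ)) * Real.exp (-(γ * (n - k₂)))) := by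
  have hq1 : Real.exp (-γ) < 1 := Real.exp_lt_one_iff.2 (by linarith)
  have hk₁' : (1 : ℝ) ≤ k₁ := by exact_mod_cast hk₁
  set S := 1 / (1 - Real.exp (-γ)) with hS
  have hSq : S = 1 + S * Real.exp (-γ) := by
    have : 1 - Real.exp (-γ) ≠ 0 := by linarith
    rw [hS]; field_simp; ring
  have hS1 : 1 ≤ S := by
    rw [hS, le_div_iff₀ (by linarith)]; linarith [Real.exp_pos (-γ)]
  -- The induction hypothesis carries `-2 / j`, which decreases in absolute value just enough to
  -- absorb two errors `1 / (j + 1) ^ 2`; the constant `S`, with `S = 1 + S e^(-γ)`, absorbs the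
  -- exponentials likewise.
  have key : ∀ j, k₁ ≤ j → j ≤ k₂ → |∑ k ∈ Finset.Icc k₁ j, f k - (P j - P k₁)| ≤
      C * (4 / k₁ - 2 / j + S * Real.exp (-(γ * (n - j)))) := by
    intro j hj
    induction j, hj using Nat.le_induction with
    | base =>
      intro _
      rw [Finset.Icc_self, Finset.sum_singleton, sub_self, sub_zero]
      have h1 := hf k₁ le_rfl hk
      have h2 : |f k₁| ≤ |f k₁ - G k₁| + |G k₁| := by
        calc |f k₁| = |(f k₁ - G k₁) + G k₁| := by ring_nf
          _ ≤ _ := abs_add_le _ _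
      have h3 : 1 / (k₁ : ℝ) ^ 2 ≤ 1 / k₁ :=
        one_div_le_one_div_of_le (by linarith) (by nlinarith)
      have h4 := Real.exp_pos (-(γ * (n - k₁)))
      have h5 : 1 / (k₁ : ℝ) ^ 2 + Real.exp (-(γ * (n - k₁))) + 1 / k₁
          ≤ 4 / k₁ - 2 / k₁ + S * Real.exp (-(γ * (n - k₁))) := by
        have : 4 / (k₁ : ℝ) - 2 / k₁ = 1 / k₁ + 1 / k₁ := by ring
        rw [this]; nlinarith
      have h6 := mul_le_mul_of_nonneg_left h5 hC
      have h7 : C / k₁ = C * (1 / k₁) := by ring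
      linarith
    | succ j hj ih =>
      intro hj2
      have h0 := ih (by omega)
      have h1 := hf (j + 1) (by omega) hj2
      have h2 := hP j hj hj2
      rw [Finset.sum_Icc_succ_top (by omega)]
      have h3 : |∑ k ∈ Finset.Icc k₁ j, f k + f (j + 1) - (P (j + 1) - P k₁)| ≤
          |∑ k ∈ Finset.Icc k₁ j, f k - (P j - P k₁)| + |f (j + 1) - G (j + 1)|
            + |P (j + 1) - P j - G (j + 1)| := by
        rw [← abs_neg (P (j + 1) - P j - G (j + 1))]
        refine le_trans (le_of_eq ?_) (abs_add_three _ _ _)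
        congr 1; ring
      have h4 := one_div_add_one_sq_le j (by omega)
      have e1 : Real.exp (-(γ * ((n : ℝ) - j)))
          = Real.exp (-γ) * Real.exp (-(γ * ((n : ℝ) - (j + 1 : ℕ)))) := by
        rw [← Real.exp_add]; congr 1; push_cast; ring
      rw [e1] at h0
      set F := Real.exp (-(γ * ((n : ℝ) - (j + 1 : ℕ)))) with hF
      push_cast at h1 h2 ⊢
      have h5 : (4 / (k₁ : ℝ) - 2 / j + S * (Real.exp (-γ) * F)) + (1 / ((j : ℝ) + 1) ^ 2 + F)
          + 1 / ((j : ℝ) + 1) ^ 2 ≤ 4 / k₁ - 2 / ((j : ℝ) + 1) + S * F := by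
        have e2 : S * F = F + S * (Real.exp (-γ) * F) := by
          calc S * F = (1 + S * Real.exp (-γ)) * F := by rw [← hSq]
            _ = _ := by ring
        have e3 : 2 / (j : ℝ) = 2 * (1 / j) := by ring
        have e4 : 2 / ((j : ℝ) + 1) = 2 * (1 / (j + 1)) := by ring
        rw [e2, e3, e4]; linarith
      have h6 := mul_le_mul_of_nonneg_left h5 hC
      have h7 : C / ((j : ℝ) + 1) ^ 2 = C * (1 / ((j : ℝ) + 1) ^ 2) := by ring
      linarith
  refine (key k₂ hk le_rfl).trans (mul_le_mul_of_nonneg_left ?_ hC)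
  have : 0 ≤ 2 / (k₂ : ℝ) := by positivity
  linarith

end LogSum

end HardEdge

namespace HardEdge

open Polynomial

/-! ### Assembly of the two estimates. -/

section Main

variable {V : ℝ[X]} {m : ℝ}

theorem one_div_le_meanError (c : ℝ) (n : ℕ) (s t : ℝ) : 1 / ((n : ℝ) * s) ≤ meanError c n s t := by
  rw [meanError]
  have h1 : 0 ≤ ∑ k ∈ Finset.Icc (max 1 ⌊(n : ℝ) * s⌋₊) ⌊c * Real.log n⌋₊, 1 / Real.sqrt (k : ℝ) :=
    Finset.sum_nonneg fun _ _ => by positivity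
  have h2 : 0 ≤ ∑ k ∈ Finset.Icc ⌊(n : ℝ) * (1 - t)⌋₊ ⌊c * Real.log n⌋₊, Real.exp (-(k : ℝ) / c) :=
    Finset.sum_nonneg fun _ _ => (Real.exp_pos _).le
  linarith

/-- If the exponential sum in `meanError` is nonempty its first term dominates. If it is empty, `t`
is at least `c log n / n` away from `1`, and the exponential is below `1 / n ≤ 1 / (n s)`. -/
theorem exp_neg_le_meanError {γ c : ℝ} (hγ : 0 < γ) (hc : 2 / γ ≤ c) {n k : ℕ} (hn : 1 ≤ n)
    {s t : ℝ} (hs : 0 < s) (hs1 : s ≤ 1) (ht1 : t ≤ 1) (hkt : (k : ℝ) ≤ n * t) :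
    Real.exp (-(γ * (n - k))) ≤ meanError c n s t := by
  have hc0 : 0 < c := lt_of_lt_of_le (by positivity) hc
  have hγc : 2 ≤ γ * c := by
    rw [div_le_iff₀ hγ] at hc; linarith
  have hn1 : (1 : ℝ) ≤ n := by exact_mod_cast hn
  have hn0 : (0 : ℝ) < n := by linarith
  have hlog := Real.log_nonneg hn1
  by_cases h : ⌊(n : ℝ) * (1 - t)⌋₊ ≤ ⌊c * Real.log n⌋₊
  · have h1 : Real.exp (-(γ * (n - k))) ≤ Real.exp (-((⌊(n : ℝ) * (1 - t)⌋₊ : ℕ) : ℝ) / c) := by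
      refine Real.exp_le_exp.2 ?_
      rw [neg_div]
      refine neg_le_neg ?_
      rw [div_le_iff₀ hc0]
      have h0 : 0 ≤ (n : ℝ) * (1 - t) := mul_nonneg hn0.le (by linarith)
      have := Nat.floor_le h0
      nlinarith
    rw [meanError]
    have h2 : 0 ≤ ∑ k ∈ Finset.Icc (max 1 ⌊(n : ℝ) * s⌋₊) ⌊c * Real.log n⌋₊,
        1 / Real.sqrt (k : ℝ) := Finset.sum_nonneg fun _ _ => by positivity
    have h3 := Finset.single_le_sum (f := fun k : ℕ => Real.exp (-(k : ℝ) / c))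
      (fun _ _ => (Real.exp_pos _).le) (Finset.mem_Icc.2 ⟨le_rfl, h⟩)
    have h4 : 0 ≤ 1 / ((n : ℝ) * s) := by positivity
    linarith
  · refine le_trans ?_ (one_div_le_meanError c n s t)
    have h1 : c * Real.log n < n * (1 - t) := by
      have := Nat.lt_of_floor_lt (not_le.1 h)
      exact this.trans_le (Nat.floor_le (mul_nonneg hn0.le (by linarith)))
    have h2 : Real.exp (-(γ * (n - k))) ≤ Real.exp (-Real.log n) := by
      refine Real.exp_le_exp.2 (neg_le_neg ?_)
      nlinarith
    rw [Real.exp_neg (Real.log n), Real.exp_log hn0] at h2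
    refine h2.trans ?_
    rw [← one_div]
    exact one_div_le_one_div_of_le (by positivity) (by nlinarith)

theorem abs_log_sub_log_le {u v : ℝ} (hu : 1 ≤ u) (huv : u ≤ v) (hv : v ≤ u + 1) :
    Real.log v - Real.log u ≤ 1 / u := by
  have hu0 : 0 < u := by linarith
  have h := Real.log_le_sub_one_of_pos (div_pos (hu0.trans_le huv) hu0)
  rw [Real.log_div (by linarith) hu0.ne'] at h
  refine h.trans ?_
  rw [div_sub_one hu0.ne']
  exact div_le_div_of_nonneg_right (by linarith) hu0.le

/-- The constant `c` is left free above a threshold because the estimate of the distances has to use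
the same one. What the argument produces is `1 / (n s)` and one exponential. -/
theorem Tangent.exists_abs_logRatioSum_sub_le (hm : 0 < m) (hW : Tangent V m) {β a : ℝ}
    (hβ : 1 ≤ β) (ha : 1 / β ≤ 1 + a) :
    ∃ γ : ℝ, 0 < γ ∧ ∀ c : ℝ, 2 / γ ≤ c → ∃ C : ℝ, 0 < C ∧ ∀ (n : ℕ) (x y : ℕ → ℝ),
      1 ≤ n → IsHamiltonianMinimizer V β a n x y → ∀ s t : ℝ, 0 < s → s < t → t ≤ 1 →
        (1 < β ∧ 1 / β < 1 + a) ∨ 2 ≤ (n : ℝ) * s →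
        |logRatioSum n x y s t - (logProfile V a t - logProfile V a s)| ≤
          C * meanError c n s t := by
  obtain ⟨C₁, hC₁, γ, hγ, hlog⟩ := hW.exists_abs_log_ratio_sub_le hm hβ ha
  obtain ⟨C₂, hC₂, hP1, hP2, hP3⟩ := hW.exists_abs_logProfile_sub_le hm a
  refine ⟨γ, hγ, fun c hc => ?_⟩
  set S := 1 / (1 - Real.exp (-γ)) with hS
  have hS0 : 0 < S := by
    have := Real.exp_lt_one_iff.2 (show -γ < 0 by linarith)
    exact one_div_pos.2 (by linarith)
  refine ⟨(C₁ + C₂) * (8 + S) + 4 * C₂, by positivity, fun n x y hn hxy s t hs hst ht1 hcond => ?_⟩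
  have hn1 : (1 : ℝ) ≤ n := by exact_mod_cast hn
  have hn0 : (0 : ℝ) < n := by linarith
  have ht : 0 < t := hs.trans hst
  have hns : 0 < (n : ℝ) * s := by positivity
  have hnst : (n : ℝ) * s < n * t := mul_lt_mul_of_pos_left hst hn0
  have hntn : (n : ℝ) * t ≤ n := by nlinarith
  have hM1 := one_div_le_meanError c n s t
  have hM0 : 0 ≤ meanError c n s t := le_trans (by positivity) hM1
  set k₁ := max 1 ⌊(n : ℝ) * s⌋₊ with hk₁
  set k₂ := min (n - 1) ⌊(n : ℝ) * t⌋₊ with hk₂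
  have hk₁1 : 1 ≤ k₁ := le_max_left _ _
  rw [logRatioSum, ← hk₁, ← hk₂]
  by_cases hk : k₁ ≤ k₂
  · have hk₂n : k₂ ≤ n - 1 := min_le_left _ _
    have hk₂t : (k₂ : ℝ) ≤ n * t :=
      (Nat.cast_le.2 (min_le_right _ _)).trans (Nat.floor_le (by positivity))
    have hk₂t' : (n : ℝ) * t ≤ k₂ + 1 := by
      rcases min_choice (n - 1) ⌊(n : ℝ) * t⌋₊ with h | h
      · rw [hk₂, h, Nat.cast_sub hn]; push_cast; linarith
      · rw [hk₂, h]; exact (Nat.lt_floor_add_one _).le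
    have hk₁' : (1 : ℝ) ≤ k₁ := by exact_mod_cast hk₁1
    have hkk : (k₁ : ℝ) ≤ k₂ := by exact_mod_cast hk
    have hk₁s : 1 / (k₁ : ℝ) ≤ 2 * (1 / (n * s)) := by
      rw [mul_one_div, div_le_div_iff₀ (by linarith) hns]
      have h1 : ((⌊(n : ℝ) * s⌋₊ : ℕ) : ℝ) ≤ k₁ := Nat.cast_le.2 (le_max_right _ _)
      linarith [Nat.lt_floor_add_one ((n : ℝ) * s)]
    have hmain := abs_sum_Icc_sub_le (C := C₁ + C₂) (γ := γ) (n := n) (by positivity) hγ hk₁1 hk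
      (f := fun k => Real.log (x k / y k))
      (G := fun k => corrDiff V a (k / n) / (n * phi V (k / n)))
      (P := fun k => logProfile V a (k / n))
      (fun k h1 h2 => (hlog n x y k hxy (by omega) (by omega) (hcond.imp_right fun h => by
          have : 2 ≤ ⌊(n : ℝ) * s⌋₊ := Nat.le_floor (by exact_mod_cast h)
          exact (this.trans (le_max_right _ _)).trans h1)).trans
        (mul_le_mul_of_nonneg_right (by linarith) (by positivity)))
      ((hP3 n k₁ hk₁1 (by omega)).trans
        (div_le_div_of_nonneg_right (by linarith) (by positivity)))
      (fun k h1 h2 => (hP2 n k (by omega) (by omega)).trans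
        (div_le_div_of_nonneg_right (by linarith) (by positivity)))
    have hexp := exp_neg_le_meanError (s := s) hγ hc hn hs (hst.le.trans ht1) ht1 hk₂t
    have hT : |logProfile V a t - logProfile V a (k₂ / n)| ≤ C₂ * (1 / k₁) := by
      have h0 : (0 : ℝ) < k₂ := by linarith
      refine (hP1 (k₂ / n) t (by positivity) (by rw [div_le_iff₀ hn0]; linarith) ht1).trans
        (mul_le_mul_of_nonneg_left ?_ hC₂.le)
      have h1 := abs_log_sub_log_le (hk₁'.trans hkk) hk₂t hk₂t'
      rw [Real.log_mul hn0.ne' ht.ne'] at h1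
      rw [Real.log_div h0.ne' hn0.ne']
      have h2 : 1 / (k₂ : ℝ) ≤ 1 / k₁ := one_div_le_one_div_of_le (by linarith) hkk
      linarith
    have hSs : |logProfile V a (k₁ / n) - logProfile V a s| ≤ C₂ * (2 * (1 / (n * s))) := by
      have h0 : (0 : ℝ) < k₁ := by linarith
      -- Next, moving the lower end from `s` to `k₁ / n`. If `n s ≤ 1` then `k₁ = 1`, possibly far
      -- above `n s`, but `log (1 / (n s)) ≤ 1 / (n s)`; otherwise the two differ by at most one
      -- lattice unit.
      have hk₁n : (k₁ : ℝ) / n ≤ 1 := by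
        rw [div_le_one hn0]; linarith
      rcases le_total ((n : ℝ) * s) 1 with h | h
      · have hk1 : k₁ = 1 := by
          rw [hk₁, max_eq_left]
          exact Nat.floor_le_of_le (by simpa using h)
        have hs' : s ≤ k₁ / n := by
          rw [le_div_iff₀ hn0, hk1]; push_cast; linarith
        refine (hP1 s _ hs hs' hk₁n).trans (mul_le_mul_of_nonneg_left ?_ hC₂.le)
        rw [hk1, Nat.cast_one, one_div, Real.log_inv]
        have h1 := Real.log_le_sub_one_of_pos (one_div_pos.2 hns)
        rw [one_div, Real.log_inv, Real.log_mul hn0.ne' hs.ne', ← one_div] at h1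
        have h2 : 0 < 1 / ((n : ℝ) * s) := by positivity
        linarith
      · have hks : k₁ = ⌊(n : ℝ) * s⌋₊ := max_eq_right (Nat.le_floor (by simpa using h))
        have h1 : (k₁ : ℝ) ≤ n * s := by rw [hks]; exact Nat.floor_le hns.le
        have h2 : (n : ℝ) * s ≤ k₁ + 1 := by rw [hks]; exact (Nat.lt_floor_add_one _).le
        rw [abs_sub_comm]
        refine (hP1 _ s (by positivity) (by rw [div_le_iff₀ hn0]; linarith)
          (hst.le.trans ht1)).trans (mul_le_mul_of_nonneg_left ?_ hC₂.le)
        have h3 := abs_log_sub_log_le hk₁' h1 h2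
        rw [Real.log_mul hn0.ne' hs.ne'] at h3
        rw [Real.log_div h0.ne' hn0.ne']
        linarith
    set Sum := ∑ k ∈ Finset.Icc k₁ k₂, Real.log (x k / y k)
    have htri : |Sum - (logProfile V a t - logProfile V a s)| ≤
        |Sum - (logProfile V a (k₂ / n) - logProfile V a (k₁ / n))|
          + |logProfile V a t - logProfile V a (k₂ / n)|
          + |logProfile V a (k₁ / n) - logProfile V a s| := by
      rw [← abs_neg (logProfile V a t - _), ← abs_neg (logProfile V a (k₁ / n) - _)]
      refine le_trans (le_of_eq ?_) (abs_add_three _ _ _)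
      congr 1; ring
    have h4 : 4 / (k₁ : ℝ) ≤ 8 * meanError c n s t := by
      have : 4 / (k₁ : ℝ) = 4 * (1 / k₁) := by ring
      linarith
    have h5 : (C₁ + C₂) * (4 / k₁ + S * Real.exp (-(γ * (n - k₂))))
        ≤ (C₁ + C₂) * (8 * meanError c n s t + S * meanError c n s t) := by gcongr
    have h6 : C₂ * (1 / k₁) ≤ C₂ * (2 * meanError c n s t) :=
      mul_le_mul_of_nonneg_left (by linarith) hC₂.le
    have h7 : C₂ * (2 * (1 / (n * s))) ≤ C₂ * (2 * meanError c n s t) :=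
      mul_le_mul_of_nonneg_left (by linarith) hC₂.le
    linarith
  · rw [Finset.Icc_eq_empty hk, Finset.sum_empty, zero_sub, abs_neg]
    -- The sum is empty only if `n t ≤ 1`; then the increment of `logProfile` is itself at most of
    -- order `1 / (n s)`.
    have hnt : (n : ℝ) * t ≤ 1 := by
      by_contra h
      have hfl : 1 ≤ ⌊(n : ℝ) * t⌋₊ := Nat.le_floor (by
        rw [Nat.cast_one]; exact (not_le.1 h).le)
      have hfs : ⌊(n : ℝ) * s⌋₊ ≤ ⌊(n : ℝ) * t⌋₊ := Nat.floor_le_floor hnst.le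
      have hfn : ⌊(n : ℝ) * s⌋₊ < n := (Nat.floor_lt hns.le).2 (hnst.trans_le hntn)
      have hn2 : 2 ≤ n := by
        by_contra h2
        have : n = 1 := by omega
        rw [this] at h
        exact h (by rw [Nat.cast_one, one_mul]; exact ht1)
      exact hk (le_min (max_le (by omega) (by omega)) (max_le hfl hfs))
    refine (hP1 s t hs hst.le ht1).trans ?_
    have h1 := Real.log_le_sub_one_of_pos (one_div_pos.2 hns)
    rw [one_div, Real.log_inv, Real.log_mul hn0.ne' hs.ne', ← one_div] at h1
    have h2 := Real.log_nonpos (by positivity) hnt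
    rw [Real.log_mul hn0.ne' ht.ne'] at h2
    have h3 : Real.log t - Real.log s ≤ meanError c n s t := by linarith
    have h4 := mul_le_mul_of_nonneg_left h3 hC₂.le
    have h5 : 0 ≤ ((C₁ + C₂) * (8 + S) + 3 * C₂) * meanError c n s t := by positivity
    linarith

theorem exists_isHamiltonianMinimizer (hm : 0 < m) (hW : Tangent V m) {β a : ℝ} (hβ : 1 ≤ β)
    (ha : 1 / β ≤ 1 + a) {n : ℕ} (hn : 1 ≤ n) :
    ∃ x y : ℕ → ℝ, IsHamiltonianMinimizer V β a n x y := by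
  obtain ⟨z, hz⟩ := exists_isBondMinimizer hm hW (N := 2 * n - 1) (w := bondWeight β a n)
    (fun l _ => bondWeight_nonneg hβ ha n l)
  obtain ⟨x, y, rfl⟩ := exists_interlace_eq z
  exact ⟨x, y, (isHamiltonianMinimizer_iff V β a hn x y).2 hz⟩

theorem IsHamiltonianMinimizer.unique (hm : 0 < m) (hW : Tangent V m) {β a : ℝ} (hβ : 1 ≤ β)
    (ha : 1 / β ≤ 1 + a) {n : ℕ} (hn : 1 ≤ n) {x y x' y' : ℕ → ℝ}
    (h : IsHamiltonianMinimizer V β a n x y) (h' : IsHamiltonianMinimizer V β a n x' y') :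
    (∀ k ∈ Finset.Icc 1 n, x k = x' k) ∧ (∀ k ∈ Finset.Icc 1 (n - 1), y k = y' k) := by
  have hu := IsBondMinimizer.unique hm hW (fun l _ => bondWeight_nonneg hβ ha n l)
    ((isHamiltonianMinimizer_iff V β a hn x y).1 h)
    ((isHamiltonianMinimizer_iff V β a hn x' y').1 h')
  refine ⟨fun k hk => ?_, fun k hk => ?_⟩
  · obtain ⟨h1, h2⟩ := Finset.mem_Icc.1 hk
    have := hu (2 * k - 2) (by omega)
    rwa [interlace_even _ _ h1, interlace_even _ _ h1] at this
  · obtain ⟨h1, h2⟩ := Finset.mem_Icc.1 hk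
    have := hu (2 * k - 1) (by omega)
    rwa [interlace_odd _ _ h1, interlace_odd _ _ h1] at this

end Main

end HardEdge

theorem mainTheorem5 (V : Polynomial ℝ) (hV : HardEdge.UniformlyConvexPotential V)
    (β a : ℝ) (hβ : 1 ≤ β) (ha : 1 / β ≤ 1 + a) :
    ∃ c : ℝ, 0 < c ∧ ∃ c' : ℝ, 0 < c' ∧ ∃ C : ℝ, 0 < C ∧ ∀ n : ℕ, 1 ≤ n →
      -- the minimizer exists and is unique
      (∃ x y : ℕ → ℝ, HardEdge.IsHamiltonianMinimizer V β a n x y) ∧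
      (∀ x y x' y' : ℕ → ℝ, HardEdge.IsHamiltonianMinimizer V β a n x y →
        HardEdge.IsHamiltonianMinimizer V β a n x' y' →
        (∀ k ∈ Finset.Icc 1 n, x k = x' k) ∧ (∀ k ∈ Finset.Icc 1 (n - 1), y k = y' k)) ∧
      ∀ x y : ℕ → ℝ, HardEdge.IsHamiltonianMinimizer V β a n x y →
        -- distance to the fine minimizer
        (∀ i ∈ Finset.Icc 1 n,
          ((i : ℝ) ≤ c * Real.log n →
            HardEdge.fineDist V β a n x y i ≤ c' * (1 / Real.sqrt n)) ∧
          (c * Real.log n < i → (i : ℝ) ≤ n - c * Real.log n →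
            HardEdge.fineDist V β a n x y i ≤ c' * (1 / Real.sqrt ((n : ℝ) * (i : ℝ) ^ 3))) ∧
          ((n : ℝ) - c * Real.log n < i →
            HardEdge.fineDist V β a n x y i ≤ c' * Real.exp (-((n : ℝ) - i) / c'))) ∧
        -- sum of the logarithms
        (∀ s t : ℝ, 0 < s → s < t → t ≤ 1 →
          (1 < β ∧ 1 / β < 1 + a) ∨ 2 ≤ (n : ℝ) * s →
          |HardEdge.logRatioSum n x y s t
              - ((a / 2 + 1 / 4) * Real.log (HardEdge.theta V t / HardEdge.theta V s)
                - 1 / 2 * Real.log (HardEdge.phi V t / HardEdge.phi V s))|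
            ≤ C * HardEdge.meanError c n s t) := by
  obtain ⟨m, hm, hW⟩ := hV.exists_tangent
  have hW : HardEdge.Tangent V m := hW
  obtain ⟨A, hA, γ₁, hγ₁, hdist⟩ := hW.exists_fineDist_le hm hβ ha
  obtain ⟨γ₂, hγ₂, hsum⟩ := hW.exists_abs_logRatioSum_sub_le hm hβ ha
  -- Both estimates allow any sufficiently large `c`, so the maximum of the two thresholds serves
  -- for both.
  have h1 : 2 / γ₁ ≤ max (2 / γ₁) (2 / γ₂) := le_max_left _ _
  have h2 : 2 / γ₂ ≤ max (2 / γ₁) (2 / γ₂) := le_max_right _ _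
  obtain ⟨c', hc', hrange⟩ := HardEdge.exists_range_bounds (show 0 < A by linarith) hγ₁ h1
  obtain ⟨C, hC, hsum⟩ := hsum _ h2
  refine ⟨max (2 / γ₁) (2 / γ₂), lt_of_lt_of_le (by positivity) h1, c', hc', C, hC, fun n hn =>
    ⟨HardEdge.exists_isHamiltonianMinimizer hm hW hβ ha hn,
      fun x y x' y' h h' => h.unique hm hW hβ ha hn h', fun x y hxy => ⟨fun i hi => ?_,
        fun s t hs hst ht hcond => ?_⟩⟩⟩
  · obtain ⟨hi1, hin⟩ := Finset.mem_Icc.1 hi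
    exact hrange n i hi1 hin _ (hdist n x y i hxy hi1 hin)
  · rw [hW.logProfile_sub hm a hs hst ht]
    exact hsum n x y hn hxy s t hs hst ht hcond
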